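/- Let $X$ be a complex manifold of dimension $n$, $\pi:T^*X\to X$ its holomorphic cotangent bundle and $\mathring T^*X$ the complement of the zero section. Local holomorphic coordinates $z=(z_1,\dots,z_n)$ of $X$ induce coordinates $(z;\zeta)$ of $T^*X$, in which covectors are $\sum_j\zeta_j\,dz_j$; all growth conditions below are understood in every such local coordinate system. A set $V\subset T^*X$ is a cone if $(z;\zeta)\in V$ implies $(z;t\zeta)\in V$ for all $t>0$. For an open cone $V\subset\mathring T^*X$, a set $W\subset V$ is an infinitesimal wedge of type $V$ if for every $K$ relatively compact in $V$ there is $\delta>0$ with $\{(z;t\zeta): (z;\zeta)\in K,\ t>\delta\}\subset W$. A cone $V'\subset V$ is a relatively compact cone in $V$ if $V'=\{(z;t\zeta): t>0,\ (z;\zeta)\in K\}$ for some $K$ relatively compact in $V$. *Symbols.* Let $V\subset\mathring T^*X$ be an open cone. A symbol on $V$ is a function $f$ that is holomorphic on some open infinitesimal wedge $W$ of type $V$ such that for every open relatively compact cone $V'$ in $V$ there is an infinitesimal wedge $W'\subset W$ of type $V'$ such that for every $h>0$ there is $C>0$ with $|f|\le Ce^{h|\zeta|}$ on $W'$. It is a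 null-symbol if for every such $V'$ there are an infinitesimal wedge $W'\subset W$ of type $V'$ and $h,C>0$ with $|f|\le Ce^{-h|\zeta|}$ on $W'$. Let $\mathfrak S(V)$ and $\mathfrak N(V)$ be the sets of symbols and of null-symbols on $V$. *Symbols of $C^\infty$-type.* A null-symbol of $C^\infty$-type on $V$ is a function $f$ that, on some open infinitesimal wedge $W$ of type $V$, is $C^\infty$ and holomorphic in $\zeta$, such that for every open relatively compact cone $V'$ in $V$ there is an infinitesimal wedge $W'\subset W$ of type $V'$ such that for all multi-indices $\alpha,\beta\in\mathbb Z_{\ge0}^n$ there are $h,C>0$ with $|\partial_z^\alpha\partial_{\bar z}^\beta f|\le Ce^{-h|\zeta|}$ on $W'$. A symbol of $C^\infty$-type on $V$ is a function $f$ that, on some open infinitesimal wedge $W$ of type $V$, is $C^\infty$ and holomorphic in $\zeta$, such that for every open relatively compact cone $V'$ in $V$ there is an infinitesimal wedge $W'\subset W$ of type $V'$ such that for all $\alpha,\beta$ and all $h>0$ there is $C>0$ with $|\partial_z^\alpha\partial_{\bar z}^\beta f|\le Ce^{h|\zeta|}$ on $W'$, and such that $\partial f/\partial\bar z_i$ is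 a null-symbol of $C^\infty$-type on $V$ for $i=1,\dots,n$. Let $\mathfrak S^\infty(V)$ and $\mathfrak N^\infty(V)$ be the sets of symbols and of null-symbols of $C^\infty$-type on $V$. *Zero section.* These are extended to open cones $V$ of $T^*X$ as follows. Let $U$ be the intersection of $V$ with the zero section $X$, so that $\pi^{-1}(U)\subset V$. Sections of $\mathfrak S$ (resp. $\mathfrak S^\infty$) over $V$ are those over $V\cap\mathring T^*X$ that, in addition, are holomorphic functions on $\pi^{-1}(U)$ such that for every compact $K\subset U$ and every $h>0$ there is $C>0$ with $|f|\le Ce^{h|\zeta|}$ on $\pi^{-1}(K)$. Sections of $\mathfrak N$ (resp. $\mathfrak N^\infty$) over $V$ are those over $V\cap\mathring T^*X$ that vanish on $\pi^{-1}(U)$. Let $\mathfrak S/\mathfrak N$ and $\mathfrak S^\infty/\mathfrak N^\infty$ be the (conic) sheaves on $T^*X$ associated to the presheaves $V\mapsto\mathfrak S(V)/\mathfrak N(V)$ and $V\mapsto\mathfrak S^\infty(V)/\mathfrak N^\infty(V)$ on the open cones $V$ of $T^*X$. **Theorem.** For every open cone $V\subset T^*X$ one has $\mathfrak S(V)\subset\mathfrak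 S^\infty(V)$ and $\mathfrak N(V)\subset\mathfrak N^\infty(V)$, and the morphism $$\iota:\mathfrak S/\mathfrak N\longrightarrow\mathfrak S^\infty/\mathfrak N^\infty$$ induced by these inclusions is an isomorphism of sheaves on $T^*X$. -/

import Mathlib

open Set CategoryTheory TopologicalSpace
open scoped Manifold ContDiff Topology

universe u

noncomputable section

namespace Symb

/-! ### Canonical coordinates `(z, ζ)` -/

/-- The space `ℂⁿ` of the coordinates `z`. -/
abbrev Cn (n : ℕ) : Type := EuclideanSpace ℂ (Fin n)

/-- The space `ℂⁿ` of the fibre coordinates `ζ`, as the dual of `Cn n`: the coordinates are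
`ζ j = ζ (e_j)` and the operator norm is the Hermitian norm `|ζ|`. -/
abbrev CnDual (n : ℕ) : Type := Cn n →L[ℂ] ℂ

/-- `ℂⁿ_z × ℂⁿ_ζ`. -/
abbrev Coord (n : ℕ) : Type := Cn n × CnDual n

variable {n : ℕ}

/-- The fibre dilation `(z; ζ) ↦ (z; t ζ)`. -/
def dil (t : ℝ) (p : Coord n) : Coord n := (p.1, (t : ℂ) • p.2)

/-- `(z; ζ) ∈ V` implies `(z; t ζ) ∈ V` for `t > 0`. -/
def IsCone (V : Set (Coord n)) : Prop := ∀ p ∈ V, ∀ t : ℝ, 0 < t → dil t p ∈ V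

/-- `K` is relatively compact in `V`. -/
def RelCpt (K V : Set (Coord n)) : Prop := ∃ L, IsCompact L ∧ K ⊆ L ∧ L ⊆ V

/-- `W` is an infinitesimal wedge of type `V` (at infinity). -/
def IsWedge (V W : Set (Coord n)) : Prop :=
  W ⊆ V ∧ ∀ K, RelCpt K V → ∃ δ : ℝ, 0 < δ ∧ ∀ p ∈ K, ∀ t : ℝ, δ < t → dil t p ∈ W

/-- `V'` is a relatively compact cone in the cone `V`. -/
def RelCptCone (V' V : Set (Coord n)) : Prop :=
  V' ⊆ V ∧ ∃ K, RelCpt K V ∧ V' = {q | ∃ p ∈ K, ∃ t : ℝ, 0 < t ∧ q = dil t p}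

/-! ### Derivatives -/

/-- `∂/∂z_j = (∂/∂x_j - i ∂/∂y_j) / 2`, at fixed `ζ`. -/
def dz (j : Fin n) (F : Coord n → ℂ) (p : Coord n) : ℂ :=
  (1 / 2 : ℂ) * (fderiv ℝ F p (EuclideanSpace.single j 1, 0)
    - Complex.I * fderiv ℝ F p (EuclideanSpace.single j Complex.I, 0))

/-- `∂/∂z̄_j = (∂/∂x_j + i ∂/∂y_j) / 2`, at fixed `ζ`. -/
def dzbar (j : Fin n) (F : Coord n → ℂ) (p : Coord n) : ℂ :=
  (1 / 2 : ℂ) * (fderiv ℝ F p (EuclideanSpace.single j 1, 0)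
    + Complex.I * fderiv ℝ F p (EuclideanSpace.single j Complex.I, 0))

/-- `d_1^{α_1} ⋯ d_n^{α_n} F` for a family of operators `d_j` and a multi-index `α`. -/
def multi (d : Fin n → (Coord n → ℂ) → (Coord n → ℂ)) (α : Fin n → ℕ) (F : Coord n → ℂ) :
    Coord n → ℂ :=
  (List.finRange n).foldr (fun j G => (d j)^[α j] G) F

/-- `∂^α/∂z^α ∂^β/∂z̄^β F`. -/
def mixed (α β : Fin n → ℕ) (F : Coord n → ℂ) : Coord n → ℂ :=
  multi dz α (multi dzbar β F)

/-! ### Symbols on an open cone `V` of `{ζ ≠ 0}`, in coordinates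

A function on a wedge is represented by a function on the whole space, whose values off the wedge
play no role: the functions that vanish on an open wedge of type `V` are null-symbols on `V`. -/

/-- `F` is holomorphic on the open wedge `W` of type `V` and of infra-exponential growth. -/
structure SymbolOn (V W : Set (Coord n)) (F : Coord n → ℂ) : Prop where
  isOpen : IsOpen W
  wedge : IsWedge V W
  holo : DifferentiableOn ℂ F W
  growth : ∀ V', IsOpen V' → RelCptCone V' V → ∃ W' ⊆ W, IsWedge V' W' ∧
    ∀ h : ℝ, 0 < h → ∃ C : ℝ, 0 < C ∧ ∀ p ∈ W', ‖F p‖ ≤ C * Real.exp (h * ‖p.2‖)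

/-- `F` is a symbol on `V`. -/
def IsSymbol (V : Set (Coord n)) (F : Coord n → ℂ) : Prop := ∃ W, SymbolOn V W F

/-- `F` is a null-symbol on `V`. -/
def IsNull (V : Set (Coord n)) (F : Coord n → ℂ) : Prop :=
  ∃ W, SymbolOn V W F ∧ ∀ V', IsOpen V' → RelCptCone V' V → ∃ W' ⊆ W, IsWedge V' W' ∧
    ∃ h : ℝ, 0 < h ∧ ∃ C : ℝ, 0 < C ∧ ∀ p ∈ W', ‖F p‖ ≤ C * Real.exp (-h * ‖p.2‖)

/-- `F` is smooth on `W`, and holomorphic on `W` in the second variable. -/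
structure SmoothHolo (W : Set (Coord n)) (F : Coord n → ℂ) : Prop where
  smooth : ContDiffOn ℝ ∞ F W
  holo : ∀ p ∈ W, DifferentiableAt ℂ (fun ζ : CnDual n => F (p.1, ζ)) p.2

/-- `F` is a null-symbol of `C^∞`-type on `V`. -/
def IsNullInf (V : Set (Coord n)) (F : Coord n → ℂ) : Prop :=
  ∃ W, IsOpen W ∧ IsWedge V W ∧ SmoothHolo W F ∧
    ∀ V', IsOpen V' → RelCptCone V' V → ∃ W' ⊆ W, IsWedge V' W' ∧ ∀ α β : Fin n → ℕ,
      ∃ h : ℝ, 0 < h ∧ ∃ C : ℝ, 0 < C ∧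
        ∀ p ∈ W', ‖mixed α β F p‖ ≤ C * Real.exp (-h * ‖p.2‖)

/-- `F` is a symbol of `C^∞`-type on `V`. -/
def IsSymbolInf (V : Set (Coord n)) (F : Coord n → ℂ) : Prop :=
  (∃ W, IsOpen W ∧ IsWedge V W ∧ SmoothHolo W F ∧
    ∀ V', IsOpen V' → RelCptCone V' V → ∃ W' ⊆ W, IsWedge V' W' ∧ ∀ α β : Fin n → ℕ,
      ∀ h : ℝ, 0 < h → ∃ C : ℝ, 0 < C ∧
        ∀ p ∈ W', ‖mixed α β F p‖ ≤ C * Real.exp (h * ‖p.2‖)) ∧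
  ∀ j, IsNullInf V (dzbar j F)

/-- Symbols over an open set `U` of the zero section: holomorphic functions on `U × ℂⁿ`
of infra-exponential growth over the compact subsets of `U`. -/
def IsZeroSymbol (U : Set (Cn n)) (F : Coord n → ℂ) : Prop :=
  DifferentiableOn ℂ F (U ×ˢ univ) ∧
    ∀ K, IsCompact K → K ⊆ U → ∀ h : ℝ, 0 < h → ∃ C : ℝ, 0 < C ∧
      ∀ z ∈ K, ∀ ζ : CnDual n, ‖F (z, ζ)‖ ≤ C * Real.exp (h * ‖ζ‖)

/-- The part of `V` off the zero section. -/
def punct (V : Set (Coord n)) : Set (Coord n) := {p | p ∈ V ∧ p.2 ≠ 0}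

/-- The part of `V` on the zero section. -/
def zeroPart (V : Set (Coord n)) : Set (Cn n) := {z | (z, 0) ∈ V}

/-! ### Closure properties -/

lemma IsWedge.inter {V V' W W' : Set (Coord n)} (h' : IsWedge V' W') (h : IsWedge V W)
    (hV : V' ⊆ V) : IsWedge V' (W' ∩ W) := by
  refine ⟨fun p hp => h'.1 hp.1, fun K hK => ?_⟩
  obtain ⟨δ', hδ', H'⟩ := h'.2 K hK
  obtain ⟨L, hL, hKL, hLV⟩ := hK
  obtain ⟨δ, hδ, H⟩ := h.2 K ⟨L, hL, hKL, hLV.trans hV⟩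
  exact ⟨max δ δ', lt_max_of_lt_left hδ, fun p hp t ht =>
    ⟨H' p hp t (lt_of_le_of_lt (le_max_right _ _) ht),
      H p hp t (lt_of_le_of_lt (le_max_left _ _) ht)⟩⟩

lemma IsWedge.self {V : Set (Coord n)} (hV : IsCone V) : IsWedge V V :=
  ⟨subset_rfl, fun _ ⟨_, _, hKL, hLV⟩ =>
    ⟨1, one_pos, fun p hp t ht => hV p (hLV (hKL hp)) t (one_pos.trans ht)⟩⟩

lemma RelCptCone.mono {V₁ V₂ V' : Set (Coord n)} (h : RelCptCone V' V₁) (hV : V₁ ⊆ V₂) :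
    RelCptCone V' V₂ := by
  obtain ⟨h1, K, ⟨L, hL, hKL, hLV⟩, rfl⟩ := h
  exact ⟨h1.trans hV, K, ⟨L, hL, hKL, hLV.trans hV⟩, rfl⟩

lemma IsCone.punct {V : Set (Coord n)} (h : IsCone V) : IsCone (punct V) := by
  intro p hp t ht
  refine ⟨h p hp.1 t ht, smul_ne_zero (by exact_mod_cast ht.ne') hp.2⟩

/-- An operator that is local, additive and preserves smoothness on open sets. -/
structure LocalOp (P : (Coord n → ℂ) → (Coord n → ℂ)) : Prop where
  smooth : ∀ W F, IsOpen W → ContDiffOn ℝ ∞ F W → ContDiffOn ℝ ∞ (P F) W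
  congr : ∀ W F G, IsOpen W → EqOn F G W → EqOn (P F) (P G) W
  add : ∀ W F G, IsOpen W → ContDiffOn ℝ ∞ F W → ContDiffOn ℝ ∞ G W →
    EqOn (P (F + G)) (P F + P G) W
  neg : ∀ F, P (-F) = -P F

lemma LocalOp.id : LocalOp (n := n) (fun F => F) :=
  ⟨fun _ _ _ h => h, fun _ _ _ _ h => h, fun _ _ _ _ _ _ _ _ => rfl, fun _ => rfl⟩

lemma LocalOp.comp {P Q : (Coord n → ℂ) → (Coord n → ℂ)} (hP : LocalOp P) (hQ : LocalOp Q) :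
    LocalOp (fun F => P (Q F)) where
  smooth W F hW hF := hP.smooth W _ hW (hQ.smooth W F hW hF)
  congr W F G hW h := hP.congr W _ _ hW (hQ.congr W F G hW h)
  add W F G hW hF hG := (hP.congr W _ _ hW (hQ.add W F G hW hF hG)).trans
    (hP.add W _ _ hW (hQ.smooth W F hW hF) (hQ.smooth W G hW hG))
  neg F := by rw [hQ.neg, hP.neg]

lemma LocalOp.iterate {P : (Coord n → ℂ) → (Coord n → ℂ)} (hP : LocalOp P) (k : ℕ) :
    LocalOp (fun F => P^[k] F) := by
  induction k with
  | zero => exact LocalOp.id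
  | succ k ih =>
    simp only [Function.iterate_succ_apply']
    exact hP.comp ih

lemma contDiffOn_fderiv_apply {W : Set (Coord n)} {F : Coord n → ℂ} (hW : IsOpen W)
    (hF : ContDiffOn ℝ ∞ F W) (v : Coord n) : ContDiffOn ℝ ∞ (fun p => fderiv ℝ F p v) W :=
  (hF.fderiv_of_isOpen hW (by simp)).clm_apply contDiffOn_const

lemma fderiv_add_on {W : Set (Coord n)} {F G : Coord n → ℂ} (hW : IsOpen W)
    (hF : ContDiffOn ℝ ∞ F W) (hG : ContDiffOn ℝ ∞ G W) {p : Coord n} (hp : p ∈ W) :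
    fderiv ℝ (F + G) p = fderiv ℝ F p + fderiv ℝ G p :=
  fderiv_add ((hF.contDiffAt (hW.mem_nhds hp)).differentiableAt (by simp))
    ((hG.contDiffAt (hW.mem_nhds hp)).differentiableAt (by simp))

lemma fderiv_congr_on {W : Set (Coord n)} {F G : Coord n → ℂ} (hW : IsOpen W)
    (h : EqOn F G W) {p : Coord n} (hp : p ∈ W) : fderiv ℝ F p = fderiv ℝ G p :=
  Filter.EventuallyEq.fderiv_eq (h.eventuallyEq_of_mem (hW.mem_nhds hp))

lemma localOp_dz (j : Fin n) : LocalOp (dz j) where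
  smooth W F hW hF := contDiffOn_const.mul ((contDiffOn_fderiv_apply hW hF _).sub
    (contDiffOn_const.mul (contDiffOn_fderiv_apply hW hF _)))
  congr W F G hW h p hp := by simp only [dz, fderiv_congr_on hW h hp]
  add W F G hW hF hG p hp := by
    simp only [dz, fderiv_add_on hW hF hG hp, Pi.add_apply, add_apply]
    ring
  neg F := by
    funext p
    simp only [dz, fderiv_neg, Pi.neg_apply, neg_apply]
    ring

lemma localOp_dzbar (j : Fin n) : LocalOp (dzbar j) where
  smooth W F hW hF := contDiffOn_const.mul ((contDiffOn_fderiv_apply hW hF _).add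
    (contDiffOn_const.mul (contDiffOn_fderiv_apply hW hF _)))
  congr W F G hW h p hp := by simp only [dzbar, fderiv_congr_on hW h hp]
  add W F G hW hF hG p hp := by
    simp only [dzbar, fderiv_add_on hW hF hG hp, Pi.add_apply, add_apply]
    ring
  neg F := by
    funext p
    simp only [dzbar, fderiv_neg, Pi.neg_apply, neg_apply]
    ring

lemma LocalOp.multi {d : Fin n → (Coord n → ℂ) → (Coord n → ℂ)} (hd : ∀ j, LocalOp (d j))
    (α : Fin n → ℕ) : LocalOp (multi d α) := by
  unfold Symb.multi
  induction List.finRange n with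
  | nil => exact LocalOp.id
  | cons j l ih => exact ((hd j).iterate (α j)).comp ih

lemma localOp_mixed (α β : Fin n → ℕ) : LocalOp (mixed (n := n) α β) :=
  (LocalOp.multi localOp_dz α).comp (LocalOp.multi localOp_dzbar β)

lemma LocalOp.zero {P : (Coord n → ℂ) → (Coord n → ℂ)} (hP : LocalOp P) : P 0 = 0 := by
  have h := hP.neg 0
  rw [neg_zero] at h
  exact self_eq_neg.mp h

lemma SmoothHolo.add {W : Set (Coord n)} {F G : Coord n → ℂ} (hF : SmoothHolo W F)
    (hG : SmoothHolo W G) : SmoothHolo W (F + G) :=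
  ⟨hF.1.add hG.1, fun p hp => (hF.2 p hp).add (hG.2 p hp)⟩

lemma SmoothHolo.neg {W : Set (Coord n)} {F : Coord n → ℂ} (hF : SmoothHolo W F) :
    SmoothHolo W (-F) :=
  ⟨hF.1.neg, fun p hp => (hF.2 p hp).neg⟩

lemma SmoothHolo.mono {W W' : Set (Coord n)} {F : Coord n → ℂ} (hF : SmoothHolo W F)
    (h : W' ⊆ W) : SmoothHolo W' F :=
  ⟨hF.1.mono h, fun p hp => hF.2 p (h hp)⟩

lemma SmoothHolo.congr {W : Set (Coord n)} {F G : Coord n → ℂ} (hW : IsOpen W)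
    (hF : SmoothHolo W F) (h : EqOn F G W) : SmoothHolo W G := by
  refine ⟨hF.1.congr h.symm, fun p hp => (hF.2 p hp).congr_of_eventuallyEq ?_⟩
  have hc : Filter.Tendsto (fun ζ : CnDual n => (p.1, ζ)) (𝓝 p.2) (𝓝 p) :=
    (Continuous.prodMk_right p.1).tendsto p.2
  filter_upwards [hc.eventually (hW.mem_nhds hp)] with ζ hζ
  exact (h hζ).symm

lemma decay_add {x y : ℂ} {r h₁ h₂ C₁ C₂ : ℝ} (hr : 0 ≤ r) (hC₁ : 0 < C₁) (hC₂ : 0 < C₂)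
    (hx : ‖x‖ ≤ C₁ * Real.exp (-h₁ * r)) (hy : ‖y‖ ≤ C₂ * Real.exp (-h₂ * r)) :
    ‖x + y‖ ≤ (C₁ + C₂) * Real.exp (-(min h₁ h₂) * r) := by
  have e₁ : Real.exp (-h₁ * r) ≤ Real.exp (-(min h₁ h₂) * r) := by
    gcongr; exact min_le_left _ _
  have e₂ : Real.exp (-h₂ * r) ≤ Real.exp (-(min h₁ h₂) * r) := by
    gcongr; exact min_le_right _ _
  have a₁ := mul_le_mul_of_nonneg_left e₁ hC₁.le
  have a₂ := mul_le_mul_of_nonneg_left e₂ hC₂.le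
  linarith [norm_add_le x y]

lemma growth_add {x y : ℂ} {s C₁ C₂ : ℝ} (hx : ‖x‖ ≤ C₁ * Real.exp s)
    (hy : ‖y‖ ≤ C₂ * Real.exp s) : ‖x + y‖ ≤ (C₁ + C₂) * Real.exp s := by
  linarith [norm_add_le x y]

lemma SymbolOn.shrink {V W W₀ : Set (Coord n)} {F : Coord n → ℂ} (h : SymbolOn V W F)
    (ho : IsOpen W₀) (hw : IsWedge V W₀) : SymbolOn V (W ∩ W₀) F where
  isOpen := h.isOpen.inter ho
  wedge := h.wedge.inter hw subset_rfl
  holo := h.holo.mono inter_subset_left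
  growth V' hV' hc := by
    obtain ⟨W', hW', hw', H⟩ := h.growth V' hV' hc
    refine ⟨W' ∩ W₀, inter_subset_inter_left _ hW', hw'.inter hw hc.1, fun k hk => ?_⟩
    obtain ⟨C, hC, H⟩ := H k hk
    exact ⟨C, hC, fun p hp => H p hp.1⟩

lemma SymbolOn.add {V W : Set (Coord n)} {F G : Coord n → ℂ} (hF : SymbolOn V W F)
    (hG : SymbolOn V W G) : SymbolOn V W (F + G) where
  isOpen := hF.isOpen
  wedge := hF.wedge
  holo := hF.holo.add hG.holo
  growth V' hV' hc := by
    obtain ⟨W₁, hW₁, hw₁, H₁⟩ := hF.growth V' hV' hc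
    obtain ⟨W₂, hW₂, hw₂, H₂⟩ := hG.growth V' hV' hc
    refine ⟨W₁ ∩ W₂, fun p hp => hW₁ hp.1, hw₁.inter hw₂ subset_rfl, fun k hk => ?_⟩
    obtain ⟨C₁, hC₁, H₁⟩ := H₁ k hk
    obtain ⟨C₂, hC₂, H₂⟩ := H₂ k hk
    exact ⟨C₁ + C₂, add_pos hC₁ hC₂, fun p hp => growth_add (H₁ p hp.1) (H₂ p hp.2)⟩

lemma SymbolOn.neg {V W : Set (Coord n)} {F : Coord n → ℂ} (hF : SymbolOn V W F) :
    SymbolOn V W (-F) where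
  isOpen := hF.isOpen
  wedge := hF.wedge
  holo := hF.holo.neg
  growth V' hV' hc := by simpa using hF.growth V' hV' hc

lemma SymbolOn.restrict {V₁ V₂ W : Set (Coord n)} {F : Coord n → ℂ} (h : SymbolOn V₂ W F)
    (ho : IsOpen V₁) (hc : IsCone V₁) (hV : V₁ ⊆ V₂) : SymbolOn V₁ (V₁ ∩ W) F where
  isOpen := ho.inter h.isOpen
  wedge := (IsWedge.self hc).inter h.wedge hV
  holo := h.holo.mono inter_subset_right
  growth V' hV' hV'c := by
    obtain ⟨W', hW', hw', H⟩ := h.growth V' hV' (hV'c.mono hV)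
    exact ⟨W', subset_inter (hw'.1.trans hV'c.1) hW', hw', H⟩

lemma symbolOn_zero {V : Set (Coord n)} (ho : IsOpen V) (hc : IsCone V) : SymbolOn V V 0 where
  isOpen := ho
  wedge := IsWedge.self hc
  holo := differentiableOn_const 0
  growth V' _ hV' := ⟨V', hV'.1, IsWedge.self (by
    obtain ⟨-, K, -, rfl⟩ := hV'
    rintro _ ⟨p, hp, t, ht, rfl⟩ s hs
    exact ⟨p, hp, s * t, mul_pos hs ht, by simp [dil, mul_smul]⟩),
    fun h _ => ⟨1, one_pos, fun p _ => by simp [Real.exp_nonneg]⟩⟩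

lemma RelCptCone.isCone {V' V : Set (Coord n)} (h : RelCptCone V' V) : IsCone V' := by
  obtain ⟨-, K, -, rfl⟩ := h
  rintro _ ⟨p, hp, t, ht, rfl⟩ s hs
  exact ⟨p, hp, s * t, mul_pos hs ht, by simp [dil, mul_smul]⟩

lemma IsNullInf.add {V : Set (Coord n)} {F G : Coord n → ℂ} (hF : IsNullInf V F)
    (hG : IsNullInf V G) : IsNullInf V (F + G) := by
  obtain ⟨W₁, ho₁, hw₁, hs₁, H₁⟩ := hF
  obtain ⟨W₂, ho₂, hw₂, hs₂, H₂⟩ := hG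
  have s₁ := hs₁.mono (inter_subset_left (t := W₂))
  have s₂ := hs₂.mono (inter_subset_right (s := W₁))
  refine ⟨W₁ ∩ W₂, ho₁.inter ho₂, hw₁.inter hw₂ subset_rfl, s₁.add s₂, fun V' hV' hc => ?_⟩
  obtain ⟨W₁', hW₁', hw₁', H₁⟩ := H₁ V' hV' hc
  obtain ⟨W₂', hW₂', hw₂', H₂⟩ := H₂ V' hV' hc
  refine ⟨W₁' ∩ W₂', inter_subset_inter hW₁' hW₂', hw₁'.inter hw₂' subset_rfl, fun α β => ?_⟩
  obtain ⟨h₁, hh₁, C₁, hC₁, H₁⟩ := H₁ α β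
  obtain ⟨h₂, hh₂, C₂, hC₂, H₂⟩ := H₂ α β
  refine ⟨min h₁ h₂, lt_min hh₁ hh₂, C₁ + C₂, add_pos hC₁ hC₂, fun p hp => ?_⟩
  rw [(localOp_mixed α β).add _ F G (ho₁.inter ho₂) s₁.1 s₂.1 ⟨hW₁' hp.1, hW₂' hp.2⟩]
  exact decay_add (norm_nonneg _) hC₁ hC₂ (H₁ p hp.1) (H₂ p hp.2)

lemma IsNullInf.neg {V : Set (Coord n)} {F : Coord n → ℂ} (hF : IsNullInf V F) :
    IsNullInf V (-F) := by
  obtain ⟨W, ho, hw, hs, H⟩ := hF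
  refine ⟨W, ho, hw, hs.neg, ?_⟩
  simpa only [(localOp_mixed _ _).neg, Pi.neg_apply, norm_neg] using H

lemma isNullInf_zero {V : Set (Coord n)} (ho : IsOpen V) (hc : IsCone V) : IsNullInf V 0 := by
  refine ⟨V, ho, IsWedge.self hc, ⟨contDiffOn_const, fun p _ => differentiableAt_const 0⟩,
    fun V' _ hV' => ⟨V', hV'.1, IsWedge.self hV'.isCone, fun α β => ⟨1, one_pos, 1, one_pos,
      fun p _ => ?_⟩⟩⟩
  simp [(localOp_mixed α β).zero, Real.exp_nonneg]

lemma IsNullInf.congr {V W : Set (Coord n)} {F G : Coord n → ℂ} (hF : IsNullInf V F)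
    (ho : IsOpen W) (hw : IsWedge V W) (h : EqOn F G W) : IsNullInf V G := by
  obtain ⟨W₁, ho₁, hw₁, hs₁, H₁⟩ := hF
  have h' : EqOn F G (W₁ ∩ W) := h.mono inter_subset_right
  refine ⟨W₁ ∩ W, ho₁.inter ho, hw₁.inter hw subset_rfl,
    (hs₁.mono inter_subset_left).congr (ho₁.inter ho) h', fun V' hV' hc => ?_⟩
  obtain ⟨W', hW', hw', H⟩ := H₁ V' hV' hc
  refine ⟨W' ∩ W, inter_subset_inter_left _ hW', hw'.inter hw hc.1, fun α β => ?_⟩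
  obtain ⟨k, hk, C, hC, H⟩ := H α β
  refine ⟨k, hk, C, hC, fun p hp => ?_⟩
  rw [← (localOp_mixed α β).congr _ F G (ho₁.inter ho) h' ⟨hW' hp.1, hp.2⟩]
  exact H p hp.1

lemma IsNullInf.restrict {V₁ V₂ : Set (Coord n)} {F : Coord n → ℂ} (h : IsNullInf V₂ F)
    (ho : IsOpen V₁) (hc : IsCone V₁) (hV : V₁ ⊆ V₂) : IsNullInf V₁ F := by
  obtain ⟨W, hW, hw, hs, H⟩ := h
  refine ⟨V₁ ∩ W, ho.inter hW, (IsWedge.self hc).inter hw hV, hs.mono inter_subset_right,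
    fun V' hV' hV'c => ?_⟩
  obtain ⟨W', hW', hw', H⟩ := H V' hV' (hV'c.mono hV)
  exact ⟨W', subset_inter (hw'.1.trans hV'c.1) hW', hw', H⟩

lemma IsSymbolInf.add {V : Set (Coord n)} {F G : Coord n → ℂ} (hF : IsSymbolInf V F)
    (hG : IsSymbolInf V G) : IsSymbolInf V (F + G) := by
  obtain ⟨⟨W₁, ho₁, hw₁, hs₁, H₁⟩, N₁⟩ := hF
  obtain ⟨⟨W₂, ho₂, hw₂, hs₂, H₂⟩, N₂⟩ := hG
  have s₁ := hs₁.mono (inter_subset_left (t := W₂))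
  have s₂ := hs₂.mono (inter_subset_right (s := W₁))
  have ho := ho₁.inter ho₂
  have hw := hw₁.inter hw₂ subset_rfl
  refine ⟨⟨W₁ ∩ W₂, ho, hw, s₁.add s₂, fun V' hV' hc => ?_⟩, fun j =>
    ((N₁ j).add (N₂ j)).congr ho hw ((localOp_dzbar j).add _ F G ho s₁.1 s₂.1).symm⟩
  obtain ⟨W₁', hW₁', hw₁', H₁⟩ := H₁ V' hV' hc
  obtain ⟨W₂', hW₂', hw₂', H₂⟩ := H₂ V' hV' hc
  refine ⟨W₁' ∩ W₂', inter_subset_inter hW₁' hW₂', hw₁'.inter hw₂' subset_rfl,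
    fun α β h hh => ?_⟩
  obtain ⟨C₁, hC₁, H₁⟩ := H₁ α β h hh
  obtain ⟨C₂, hC₂, H₂⟩ := H₂ α β h hh
  refine ⟨C₁ + C₂, add_pos hC₁ hC₂, fun p hp => ?_⟩
  rw [(localOp_mixed α β).add _ F G ho s₁.1 s₂.1 ⟨hW₁' hp.1, hW₂' hp.2⟩]
  exact growth_add (H₁ p hp.1) (H₂ p hp.2)

lemma IsSymbolInf.neg {V : Set (Coord n)} {F : Coord n → ℂ} (hF : IsSymbolInf V F) :
    IsSymbolInf V (-F) := by
  obtain ⟨⟨W, ho, hw, hs, H⟩, N⟩ := hF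
  refine ⟨⟨W, ho, hw, hs.neg, ?_⟩, fun j => ?_⟩
  · simpa only [(localOp_mixed _ _).neg, Pi.neg_apply, norm_neg] using H
  · rw [(localOp_dzbar j).neg]
    exact (N j).neg

lemma isSymbolInf_zero {V : Set (Coord n)} (ho : IsOpen V) (hc : IsCone V) :
    IsSymbolInf V 0 := by
  refine ⟨⟨V, ho, IsWedge.self hc, ⟨contDiffOn_const, fun p _ => differentiableAt_const 0⟩,
    fun V' _ hV' => ⟨V', hV'.1, IsWedge.self hV'.isCone, fun α β h _ => ⟨1, one_pos,
      fun p _ => ?_⟩⟩⟩, fun j => ?_⟩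
  · simp [(localOp_mixed α β).zero, Real.exp_nonneg]
  · rw [(localOp_dzbar j).zero]
    exact isNullInf_zero ho hc

lemma IsSymbolInf.restrict {V₁ V₂ : Set (Coord n)} {F : Coord n → ℂ} (h : IsSymbolInf V₂ F)
    (ho : IsOpen V₁) (hc : IsCone V₁) (hV : V₁ ⊆ V₂) : IsSymbolInf V₁ F := by
  obtain ⟨⟨W, hW, hw, hs, H⟩, N⟩ := h
  refine ⟨⟨V₁ ∩ W, ho.inter hW, (IsWedge.self hc).inter hw hV, hs.mono inter_subset_right,
    fun V' hV' hV'c => ?_⟩, fun j => (N j).restrict ho hc hV⟩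
  obtain ⟨W', hW', hw', H⟩ := H V' hV' (hV'c.mono hV)
  exact ⟨W', subset_inter (hw'.1.trans hV'c.1) hW', hw', H⟩

lemma IsNull.add {V : Set (Coord n)} {F G : Coord n → ℂ} (hF : IsNull V F)
    (hG : IsNull V G) : IsNull V (F + G) := by
  obtain ⟨W₁, s₁, H₁⟩ := hF
  obtain ⟨W₂, s₂, H₂⟩ := hG
  have s₂' := s₂.shrink s₁.isOpen s₁.wedge
  rw [inter_comm] at s₂'
  refine ⟨W₁ ∩ W₂, (s₁.shrink s₂.isOpen s₂.wedge).add s₂', fun V' hV' hc => ?_⟩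
  obtain ⟨W₁', hW₁', hw₁', h₁, hh₁, C₁, hC₁, H₁⟩ := H₁ V' hV' hc
  obtain ⟨W₂', hW₂', hw₂', h₂, hh₂, C₂, hC₂, H₂⟩ := H₂ V' hV' hc
  exact ⟨W₁' ∩ W₂', inter_subset_inter hW₁' hW₂', hw₁'.inter hw₂' subset_rfl,
    min h₁ h₂, lt_min hh₁ hh₂, C₁ + C₂, add_pos hC₁ hC₂, fun p hp =>
    decay_add (norm_nonneg _) hC₁ hC₂ (H₁ p hp.1) (H₂ p hp.2)⟩

lemma IsSymbol.add {V : Set (Coord n)} {F G : Coord n → ℂ} (hF : IsSymbol V F)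
    (hG : IsSymbol V G) : IsSymbol V (F + G) := by
  obtain ⟨W₁, s₁⟩ := hF
  obtain ⟨W₂, s₂⟩ := hG
  have s₂' := s₂.shrink s₁.isOpen s₁.wedge
  rw [inter_comm] at s₂'
  exact ⟨_, (s₁.shrink s₂.isOpen s₂.wedge).add s₂'⟩

lemma IsNull.neg {V : Set (Coord n)} {F : Coord n → ℂ} (hF : IsNull V F) : IsNull V (-F) := by
  obtain ⟨W, s, H⟩ := hF
  exact ⟨W, s.neg, by simpa using H⟩

lemma isNull_zero {V : Set (Coord n)} (ho : IsOpen V) (hc : IsCone V) : IsNull V 0 :=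
  ⟨V, symbolOn_zero ho hc, fun V' _ hV' => ⟨V', hV'.1, IsWedge.self hV'.isCone, 1, one_pos, 1,
    one_pos, fun p _ => by simp [Real.exp_nonneg]⟩⟩

lemma IsNull.restrict {V₁ V₂ : Set (Coord n)} {F : Coord n → ℂ} (h : IsNull V₂ F)
    (ho : IsOpen V₁) (hc : IsCone V₁) (hV : V₁ ⊆ V₂) : IsNull V₁ F := by
  obtain ⟨W, s, H⟩ := h
  refine ⟨_, s.restrict ho hc hV, fun V' hV' hV'c => ?_⟩
  obtain ⟨W', hW', hw', H⟩ := H V' hV' (hV'c.mono hV)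
  exact ⟨W', subset_inter (hw'.1.trans hV'c.1) hW', hw', H⟩

lemma IsZeroSymbol.add {U : Set (Cn n)} {F G : Coord n → ℂ} (hF : IsZeroSymbol U F)
    (hG : IsZeroSymbol U G) : IsZeroSymbol U (F + G) := by
  refine ⟨hF.1.add hG.1, fun K hK hKU h hh => ?_⟩
  obtain ⟨C₁, hC₁, H₁⟩ := hF.2 K hK hKU h hh
  obtain ⟨C₂, hC₂, H₂⟩ := hG.2 K hK hKU h hh
  exact ⟨C₁ + C₂, add_pos hC₁ hC₂, fun z hz ζ => growth_add (H₁ z hz ζ) (H₂ z hz ζ)⟩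

lemma IsZeroSymbol.neg {U : Set (Cn n)} {F : Coord n → ℂ} (hF : IsZeroSymbol U F) :
    IsZeroSymbol U (-F) :=
  ⟨hF.1.neg, by simpa using hF.2⟩

lemma isZeroSymbol_zero (U : Set (Cn n)) : IsZeroSymbol U 0 :=
  ⟨differentiableOn_const 0, fun _ _ _ _ _ => ⟨1, one_pos, fun _ _ _ => by
    simp [Real.exp_nonneg]⟩⟩

lemma IsZeroSymbol.mono {U₁ U₂ : Set (Cn n)} {F : Coord n → ℂ} (h : IsZeroSymbol U₂ F)
    (hU : U₁ ⊆ U₂) : IsZeroSymbol U₁ F :=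
  ⟨h.1.mono (prod_mono hU subset_rfl), fun K hK hKU => h.2 K hK (hKU.trans hU)⟩

/-! ### The cotangent bundle of a complex manifold -/

section Manifold

variable (n) (X : Type u) [TopologicalSpace X] [ChartedSpace (Cn n) X]

/-- The (holomorphic) cotangent bundle `T*X`. -/
abbrev Cotangent : Type u :=
  Bundle.TotalSpace (CnDual n) (fun x : X => TangentSpace 𝓘(ℂ, Cn n) x →L[ℂ] ℂ)

/-- The set `T*X` with the conic topology: the open sets are the open conic subsets of `T*X`.
Conic sheaves on `T*X` are the sheaves for this topology. -/
def Conic : Type u := Cotangent n X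

variable {n X}

/-- The fibre dilation of `T*X`. -/
def cotDil (t : ℝ) (p : Cotangent n X) : Cotangent n X := ⟨p.1, (t : ℂ) • p.2⟩

instance [IsManifold 𝓘(ℂ, Cn n) ω X] : TopologicalSpace (Conic n X) where
  IsOpen V := IsOpen (X := Cotangent n X) V ∧
    ∀ p : Cotangent n X, p ∈ (V : Set (Cotangent n X)) → ∀ t : ℝ, 0 < t →
      cotDil t p ∈ (V : Set (Cotangent n X))
  isOpen_univ := ⟨isOpen_univ, fun _ _ _ _ => trivial⟩
  isOpen_inter _ _ h₁ h₂ :=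
    ⟨h₁.1.inter h₂.1, fun p hp t ht => ⟨h₁.2 p hp.1 t ht, h₂.2 p hp.2 t ht⟩⟩
  isOpen_sUnion _ h := ⟨isOpen_sUnion fun s hs => (h s hs).1, fun p hp t ht => by
    obtain ⟨s, hs, hps⟩ := hp
    exact ⟨s, hs, (h s hs).2 p hps t ht⟩⟩

/-- The covector with canonical coordinates `(z; ζ)` in the chart `e`, that is
`∑ ζ_j de_j` at the point `e⁻¹(z)`. -/
def ofCoord (e : OpenPartialHomeomorph X (Cn n)) (q : Coord n) : Cotangent n X :=
  ⟨e.symm q.1, q.2.comp (mfderiv 𝓘(ℂ, Cn n) 𝓘(ℂ, Cn n) e (e.symm q.1))⟩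

/-- The subset of `ℂⁿ × ℂⁿ` that corresponds to `V ⊆ T*X` in the chart `e`. -/
def inChart (e : OpenPartialHomeomorph X (Cn n)) (V : Set (Cotangent n X)) : Set (Coord n) :=
  {q | q.1 ∈ e.target ∧ ofCoord e q ∈ V}

variable [IsManifold 𝓘(ℂ, Cn n) ω X]

lemma continuousAt_ofCoord {e : OpenPartialHomeomorph X (Cn n)}
    (he : e ∈ IsManifold.maximalAtlas 𝓘(ℂ, Cn n) ω X) {q : Coord n} (hq : q.1 ∈ e.target) :
    ContinuousAt (ofCoord e) q := by
  have hs : ContinuousAt (fun q : Coord n => e.symm q.1) q :=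
    (e.continuousAt_symm hq).comp (f := fun q : Coord n => q.1) continuousAt_fst
  refine (continuousAt_hom_bundle _ (ofCoord e)).2 ⟨hs, ?_⟩
  have hx : e.symm q.1 ∈ e.source := e.map_target hq
  have h1 : ContMDiffAt 𝓘(ℂ, Cn n) 𝓘(ℂ, Cn n) ω e (e.symm q.1) :=
    contMDiffAt_of_mem_maximalAtlas he hx
  have h2 := (h1.mfderiv_const (m := 0) (by simp)).continuousAt
  have h3 := ContinuousAt.comp (f := fun q : Coord n => e.symm q.1) h2 hs
  have h4 := (continuousAt_snd (p := q)).clm_comp h3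
  refine h4.congr (Filter.Eventually.of_forall fun p => ?_)
  ext v
  simp only [inTangentCoordinates, ContinuousLinearMap.inCoordinates, Function.comp_apply,
    ContinuousLinearMap.comp_apply, id_eq, TangentBundle.continuousLinearMapAt_model_space]
  exact (DFunLike.congr_fun
    (Bundle.Trivial.continuousLinearMapAt_trivialization ℂ X ℂ (e.symm p.1)) _).symm

/-- The subset of `ℂⁿ × ℂⁿ` that corresponds to the open cone `V` of `T*X` in the chart `e`. -/
def chartSet (e : OpenPartialHomeomorph X (Cn n)) (V : Opens (Conic n X)) : Set (Coord n) :=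
  inChart e V.1

lemma isOpen_chartSet {e : OpenPartialHomeomorph X (Cn n)}
    (he : e ∈ IsManifold.maximalAtlas 𝓘(ℂ, Cn n) ω X) (V : Opens (Conic n X)) :
    IsOpen (chartSet e V) := by
  have h : ContinuousOn (ofCoord e) (e.target ×ˢ univ) := fun q hq =>
    (continuousAt_ofCoord he hq.1).continuousWithinAt
  have := h.isOpen_inter_preimage (e.open_target.prod isOpen_univ) V.2.1
  convert this using 1
  ext q
  exact ⟨fun h => ⟨⟨h.1, trivial⟩, h.2⟩, fun h => ⟨h.1.1, h.2⟩⟩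

lemma isCone_chartSet (e : OpenPartialHomeomorph X (Cn n)) (V : Opens (Conic n X)) :
    IsCone (chartSet e V) := by
  intro q hq t ht
  exact ⟨hq.1, V.2.2 _ hq.2 t ht⟩

lemma chartSet_mono (e : OpenPartialHomeomorph X (Cn n)) {V₁ V₂ : Opens (Conic n X)}
    (h : V₁ ≤ V₂) : chartSet e V₁ ⊆ chartSet e V₂ := fun _ hq => ⟨hq.1, h hq.2⟩

lemma isOpen_punct {V : Set (Coord n)} (h : IsOpen V) : IsOpen (punct V) :=
  h.inter (isOpen_compl_singleton.preimage continuous_snd)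

lemma punct_mono {V₁ V₂ : Set (Coord n)} (h : V₁ ⊆ V₂) : punct V₁ ⊆ punct V₂ :=
  fun _ hp => ⟨h hp.1, hp.2⟩

lemma zeroPart_mono {V₁ V₂ : Set (Coord n)} (h : V₁ ⊆ V₂) : zeroPart V₁ ⊆ zeroPart V₂ :=
  fun _ hp => h hp

/-! ### The sections over an open cone `V` of `T*X`

All conditions are imposed in all holomorphic charts of `X`. If `U` is the part of `V` on the zero
section, then `V` contains `π⁻¹(U)`, because it is open and conic; over `U` the zero-section
conditions are imposed, and over `V` minus the zero section the conditions at infinity. -/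

/-- `𝔖(V)`. -/
def symbols (V : Opens (Conic n X)) : AddSubgroup (Cotangent n X → ℂ) where
  carrier := {f | ∀ e ∈ IsManifold.maximalAtlas 𝓘(ℂ, Cn n) ω X,
    IsSymbol (punct (chartSet e V)) (f ∘ ofCoord e) ∧
    IsZeroSymbol (zeroPart (chartSet e V)) (f ∘ ofCoord e)}
  zero_mem' e he := ⟨⟨_, symbolOn_zero (isOpen_punct (isOpen_chartSet he V))
    (isCone_chartSet e V).punct⟩, isZeroSymbol_zero _⟩
  add_mem' hf hg e he := ⟨(hf e he).1.add (hg e he).1, (hf e he).2.add (hg e he).2⟩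
  neg_mem' hf e he := ⟨(hf e he).1.imp fun _ h => h.neg, (hf e he).2.neg⟩

/-- `𝔑(V)`; on the zero section the sheaf `𝔑` is zero. -/
def nullSymbols (V : Opens (Conic n X)) : AddSubgroup (Cotangent n X → ℂ) where
  carrier := {f | ∀ e ∈ IsManifold.maximalAtlas 𝓘(ℂ, Cn n) ω X,
    IsNull (punct (chartSet e V)) (f ∘ ofCoord e) ∧
    ∀ z ∈ zeroPart (chartSet e V), ∀ ζ, f (ofCoord e (z, ζ)) = 0}
  zero_mem' e he := ⟨isNull_zero (isOpen_punct (isOpen_chartSet he V))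
    (isCone_chartSet e V).punct, fun _ _ _ => rfl⟩
  add_mem' hf hg e he := ⟨(hf e he).1.add (hg e he).1, fun z hz ζ => by
    simp [(hf e he).2 z hz ζ, (hg e he).2 z hz ζ]⟩
  neg_mem' hf e he := ⟨(hf e he).1.neg, fun z hz ζ => by simp [(hf e he).2 z hz ζ]⟩

/-- `𝔖^∞(V)`; on the zero section the sheaf `𝔖^∞` is `𝔖`. -/
def symbolsInf (V : Opens (Conic n X)) : AddSubgroup (Cotangent n X → ℂ) where
  carrier := {f | ∀ e ∈ IsManifold.maximalAtlas 𝓘(ℂ, Cn n) ω X,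
    IsSymbolInf (punct (chartSet e V)) (f ∘ ofCoord e) ∧
    IsZeroSymbol (zeroPart (chartSet e V)) (f ∘ ofCoord e)}
  zero_mem' e he := ⟨isSymbolInf_zero (isOpen_punct (isOpen_chartSet he V))
    (isCone_chartSet e V).punct, isZeroSymbol_zero _⟩
  add_mem' hf hg e he := ⟨(hf e he).1.add (hg e he).1, (hf e he).2.add (hg e he).2⟩
  neg_mem' hf e he := ⟨(hf e he).1.neg, (hf e he).2.neg⟩

/-- `𝔑^∞(V)`; on the zero section the sheaf `𝔑^∞` is zero. -/
def nullSymbolsInf (V : Opens (Conic n X)) : AddSubgroup (Cotangent n X → ℂ) where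
  carrier := {f | ∀ e ∈ IsManifold.maximalAtlas 𝓘(ℂ, Cn n) ω X,
    IsNullInf (punct (chartSet e V)) (f ∘ ofCoord e) ∧
    ∀ z ∈ zeroPart (chartSet e V), ∀ ζ, f (ofCoord e (z, ζ)) = 0}
  zero_mem' e he := ⟨isNullInf_zero (isOpen_punct (isOpen_chartSet he V))
    (isCone_chartSet e V).punct, fun _ _ _ => rfl⟩
  add_mem' hf hg e he := ⟨(hf e he).1.add (hg e he).1, fun z hz ζ => by
    simp [(hf e he).2 z hz ζ, (hg e he).2 z hz ζ]⟩
  neg_mem' hf e he := ⟨(hf e he).1.neg, fun z hz ζ => by simp [(hf e he).2 z hz ζ]⟩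

lemma symbols_antitone : Antitone (symbols (n := n) (X := X)) := fun V₁ _ h _ hf e he =>
  ⟨(hf e he).1.elim fun _ hW => ⟨_, hW.restrict (isOpen_punct (isOpen_chartSet he V₁))
    (isCone_chartSet e V₁).punct (punct_mono (chartSet_mono e h))⟩,
    (hf e he).2.mono (zeroPart_mono (chartSet_mono e h))⟩

lemma nullSymbols_antitone : Antitone (nullSymbols (n := n) (X := X)) := fun V₁ _ h _ hf e he =>
  ⟨(hf e he).1.restrict (isOpen_punct (isOpen_chartSet he V₁))
    (isCone_chartSet e V₁).punct (punct_mono (chartSet_mono e h)),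
    fun z hz => (hf e he).2 z (zeroPart_mono (chartSet_mono e h) hz)⟩

lemma symbolsInf_antitone : Antitone (symbolsInf (n := n) (X := X)) := fun V₁ _ h _ hf e he =>
  ⟨(hf e he).1.restrict (isOpen_punct (isOpen_chartSet he V₁))
    (isCone_chartSet e V₁).punct (punct_mono (chartSet_mono e h)),
    (hf e he).2.mono (zeroPart_mono (chartSet_mono e h))⟩

lemma nullSymbolsInf_antitone : Antitone (nullSymbolsInf (n := n) (X := X)) :=
  fun V₁ _ h _ hf e he =>
  ⟨(hf e he).1.restrict (isOpen_punct (isOpen_chartSet he V₁))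
    (isCone_chartSet e V₁).punct (punct_mono (chartSet_mono e h)),
    fun z hz => (hf e he).2 z (zeroPart_mono (chartSet_mono e h) hz)⟩

end Manifold

/-! ### Quotient presheaves and their associated sheaves -/

section Quotient

variable {T : TopCat.{u}} {A : Type u} [AddCommGroup A]

/-- The presheaf `V ↦ S(V) / N(V)`, for two families of subgroups `S(V)`, `N(V)` of `A` that grow
when `V` shrinks; the restriction maps are induced by the inclusions `S(V) ⊆ S(V')`. -/
def quotPresheaf (S N : Opens T → AddSubgroup A) (hS : Antitone S) (hN : Antitone N) :
    TopCat.Presheaf AddCommGrpCat.{u} T where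
  obj V := AddCommGrpCat.of (S V.unop ⧸ (N V.unop).addSubgroupOf (S V.unop))
  map i := AddCommGrpCat.ofHom (QuotientAddGroup.map _ _
    (AddSubgroup.inclusion (hS i.unop.le)) fun _ hx => hN i.unop.le hx)
  map_id V := by
    ext x
    rfl
  map_comp i j := by
    ext x
    rfl

/-- The morphism `S(V) / N(V) → S'(V) / N'(V)` induced by inclusions `S(V) ⊆ S'(V)` and
`N(V) ⊆ N'(V)`. -/
def quotPresheafMap {S N S' N' : Opens T → AddSubgroup A} (hS : Antitone S) (hN : Antitone N)
    (hS' : Antitone S') (hN' : Antitone N') (iS : ∀ V, S V ≤ S' V) (iN : ∀ V, N V ≤ N' V) :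
    quotPresheaf S N hS hN ⟶ quotPresheaf S' N' hS' hN' where
  app V := AddCommGrpCat.ofHom (QuotientAddGroup.map _ _
    (AddSubgroup.inclusion (iS V.unop)) fun _ hx => iN V.unop hx)
  naturality V V' i := by
    ext x
    induction x using QuotientAddGroup.induction_on
    rfl

end Quotient

section Sheaves

variable (n : ℕ) (X : Type u) [TopologicalSpace X] [ChartedSpace (Cn n) X]
  [IsManifold 𝓘(ℂ, Cn n) ω X]

/-- `T*X` with the conic topology. -/
abbrev conicTop : TopCat.{u} := TopCat.of (Conic n X)

/-- The sheaf `𝔖/𝔑` associated to `V ↦ 𝔖(V)/𝔑(V)`. -/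
def symbolSheaf : TopCat.Sheaf AddCommGrpCat.{u} (conicTop n X) :=
  (presheafToSheaf (Opens.grothendieckTopology (conicTop n X)) AddCommGrpCat.{u}).obj
    (quotPresheaf symbols nullSymbols symbols_antitone nullSymbols_antitone)

/-- The sheaf `𝔖^∞/𝔑^∞` associated to `V ↦ 𝔖^∞(V)/𝔑^∞(V)`. -/
def symbolSheafInf : TopCat.Sheaf AddCommGrpCat.{u} (conicTop n X) :=
  (presheafToSheaf (Opens.grothendieckTopology (conicTop n X)) AddCommGrpCat.{u}).obj
    (quotPresheaf symbolsInf nullSymbolsInf symbolsInf_antitone nullSymbolsInf_antitone)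

/-- The morphism `ι : 𝔖/𝔑 ⟶ 𝔖^∞/𝔑^∞` induced by the inclusions `𝔖 ⊆ 𝔖^∞` and `𝔑 ⊆ 𝔑^∞`. -/
def iota (iS : ∀ V : Opens (Conic n X), symbols V ≤ symbolsInf V)
    (iN : ∀ V : Opens (Conic n X), nullSymbols V ≤ nullSymbolsInf V) :
    symbolSheaf n X ⟶ symbolSheafInf n X :=
  (presheafToSheaf (Opens.grothendieckTopology (conicTop n X)) AddCommGrpCat.{u}).map
    (quotPresheafMap symbols_antitone nullSymbols_antitone symbolsInf_antitone
      nullSymbolsInf_antitone iS iN)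

/-- The continuous identity map from `T*X`, with the topology of the bundle, to `T*X` with the
conic topology. The inverse image under this map of a sheaf for the conic topology is the
corresponding conic sheaf on `T*X`. -/
def toConic : TopCat.of (Cotangent n X) ⟶ conicTop n X :=
  TopCat.ofHom ⟨fun p => p, ⟨fun _ h => h.1⟩⟩

end Sheaves

end Symb

end

/-! The question is local: after sheafification a map of presheaves becomes an isomorphism once it
is locally injective and locally surjective (`isIso_presheafToSheaf_map_quotPresheafMap`).

Inclusions and injectivity come from Cauchy's estimates. A neighbourhood of a direction at infinity
contains balls of a fixed radius about most of its points, and on such a ball `exp (a|ζ|)` varies by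
a bounded factor; hence all derivatives of a holomorphic function inherit its exponential bound with
the same `a` (`dirDeriv_isBigO`, `HolGerm.mixed_isBigO`), while the derivatives in `z̄` vanish.
Conversely, the estimate of order zero shows that a holomorphic symbol which is null of `C^∞`-type
is null (`IsSymbol.isNull_of_isNullInf`).

Surjectivity off the zero section is a Dolbeault–Grothendieck lemma with exponential weights. For a
symbol `F` of `C^∞`-type the `∂F/∂z̄_j` decay exponentially. On a polydisc times a truncated cone of
covectors the system `∂u/∂z̄_j = -∂F/∂z̄_j` is solved one variable at a time, by cutting off in
`z_k` and taking the Cauchy transform in `z_k` (`exists_dzbar_eq`, `exists_dbar_solution`). The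
integration fixes `ζ`, so it preserves both decay and holomorphy in `ζ`. Then `u` is null and `F +
u` is holomorphic (`IsSymbolInf.exists_splitting`). Over the zero section the two notions of symbol
coincide, and the fibres over the zero part of an open cone themselves form an open cone.

Two reductions make this work. Conditions on all relatively compact cones are turned into conditions
along the filters `dirInf p`, one for each direction `p` (`isSymbol_iff` and its analogues, through
`exists_wedge_bounds`). And since membership is required in every chart while the splitting is made
in one, null germs must be invariant under changes of canonical coordinates. For this they are
characterized by the decay of all real derivatives (`nullGerm_iff`), which survives composition
because the coordinate changes are homogeneous in `ζ` and their derivatives grow at most linearly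
(`NullGerm.comp_cotMap`). -/

noncomputable section

namespace Symb

open Filter Asymptotics

variable {n : ℕ}

/-! ### The filter of a direction at infinity -/

/-- The filter on `ℂⁿ × ℂⁿ` generated by the sets `{dil t q | q ∈ N, t > δ}`, `N` a neighbourhood
of `p`. -/
def dirInf (p : Coord n) : Filter (Coord n) :=
  map (fun a : ℝ × Coord n => dil a.1 a.2) (atTop ×ˢ 𝓝 p)

lemma mem_dirInf {p : Coord n} {S : Set (Coord n)} :
    S ∈ dirInf p ↔ ∃ N ∈ 𝓝 p, ∃ δ : ℝ, 0 < δ ∧ ∀ q ∈ N, ∀ t : ℝ, δ < t → dil t q ∈ S := by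
  rw [dirInf, mem_map, mem_prod_iff]
  constructor
  · rintro ⟨T, hT, N, hN, h⟩
    obtain ⟨a, ha⟩ := mem_atTop_sets.1 hT
    refine ⟨N, hN, max a 1, by positivity, fun q hq t ht => ?_⟩
    exact h (⟨ha t ((le_max_left _ _).trans ht.le), hq⟩ : (t, q) ∈ T ×ˢ N)
  · rintro ⟨N, hN, δ, -, h⟩
    exact ⟨Ioi δ, Ioi_mem_atTop δ, N, hN, fun a ha => h a.2 ha.2 a.1 ha.1⟩

lemma eventually_dirInf {p : Coord n} {P : Coord n → Prop} :
    (∀ᶠ x in dirInf p, P x) ↔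
      ∃ N ∈ 𝓝 p, ∃ δ : ℝ, 0 < δ ∧ ∀ q ∈ N, ∀ t : ℝ, δ < t → P (dil t q) :=
  mem_dirInf

lemma dil_dil (s t : ℝ) (p : Coord n) : dil s (dil t p) = dil (s * t) p := by
  simp [dil, mul_smul]

lemma dil_one (p : Coord n) : dil 1 p = p := by simp [dil]

lemma norm_dil_snd {t : ℝ} (ht : 0 ≤ t) (p : Coord n) : ‖(dil t p).2‖ = t * ‖p.2‖ := by
  simp [dil, norm_smul, abs_of_nonneg ht]

lemma continuous_dil_uncurry : Continuous fun a : ℝ × Coord n => dil a.1 a.2 := by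
  unfold dil
  fun_prop

lemma continuous_dil (t : ℝ) : Continuous (dil t : Coord n → Coord n) := by
  unfold dil
  fun_prop

lemma dil_inv_dil {t : ℝ} (ht : t ≠ 0) (p : Coord n) : dil t⁻¹ (dil t p) = p := by
  rw [dil_dil, inv_mul_cancel₀ ht, dil_one]

lemma dil_dil_inv {t : ℝ} (ht : t ≠ 0) (p : Coord n) : dil t (dil t⁻¹ p) = p := by
  rw [dil_dil, mul_inv_cancel₀ ht, dil_one]

lemma IsCone.mem_dirInf {V : Set (Coord n)} (hV : IsCone V) (ho : IsOpen V) {p : Coord n}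
    (hp : p ∈ V) : V ∈ dirInf p :=
  Symb.mem_dirInf.2 ⟨V, ho.mem_nhds hp, 1, one_pos, fun q hq t ht =>
    hV q hq t (one_pos.trans ht)⟩

/-- The union of the dilates of an open set is open. -/
lemma isOpen_dil_image {N : Set (Coord n)} (hN : IsOpen N) {δ : ℝ} (hδ : 0 ≤ δ) :
    IsOpen {x | ∃ q ∈ N, ∃ t : ℝ, δ < t ∧ x = dil t q} := by
  have : {x | ∃ q ∈ N, ∃ t : ℝ, δ < t ∧ x = dil t q} =
      ⋃ t ∈ Ioi δ, (dil t⁻¹ : Coord n → Coord n) ⁻¹' N := by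
    ext x
    simp only [mem_ofPred_eq, mem_iUnion, mem_Ioi, mem_preimage, exists_prop]
    constructor
    · rintro ⟨q, hq, t, ht, rfl⟩
      exact ⟨t, ht, by rwa [dil_inv_dil (hδ.trans_lt ht).ne']⟩
    · rintro ⟨t, ht, hx⟩
      exact ⟨_, hx, t, ht, (dil_dil_inv (hδ.trans_lt ht).ne' x).symm⟩
  rw [this]
  exact isOpen_biUnion fun t _ => hN.preimage (continuous_dil _)

/-- The members of `dirInf p` contain balls of a fixed radius about most of their points. -/
lemma exists_closedBall_subset_dirInf {p : Coord n} {S : Set (Coord n)} (h : S ∈ dirInf p) :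
    ∃ ε > 0, ∀ᶠ x in dirInf p, Metric.closedBall x ε ⊆ S := by
  obtain ⟨N, hN, δ, hδ, H⟩ := mem_dirInf.1 h
  obtain ⟨r, hr, hrN⟩ := Metric.mem_nhds_iff.1 hN
  -- For `t > 1` the map `dil t⁻¹` does not increase distances, so a point within `r / 4` of `dil t
  -- q` returns to within `r / 4` of `q`, and thus to within `r / 2` of `p`.
  refine ⟨r / 4, by positivity, eventually_dirInf.2 ⟨Metric.ball p (r / 4),
    Metric.ball_mem_nhds p (by positivity), max δ 1, by positivity, fun q hq t ht y hy => ?_⟩⟩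
  have ht1 : 1 < t := (le_max_right _ _).trans_lt ht
  have ht0 : 0 < t := one_pos.trans ht1
  rw [← dil_dil_inv ht0.ne' y]
  refine H _ (hrN ?_) t ((le_max_left _ _).trans_lt ht)
  have hd : dist (dil t⁻¹ y) q ≤ r / 4 := by
    rw [Metric.mem_closedBall, Prod.dist_eq, max_le_iff] at hy
    rw [Prod.dist_eq, max_le_iff]
    refine ⟨hy.1, ?_⟩
    have e : (dil t⁻¹ y).2 - q.2 = ((t⁻¹ : ℝ) : ℂ) • (y.2 - (dil t q).2) := by
      have ht0' : (t : ℂ) ≠ 0 := by exact_mod_cast ht0.ne'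
      simp [dil, smul_sub, smul_smul, ht0']
    rw [dist_eq_norm, e, norm_smul, Complex.norm_real, Real.norm_of_nonneg (by positivity),
      ← dist_eq_norm]
    calc t⁻¹ * dist y.2 (dil t q).2 ≤ 1 * (r / 4) := by
          gcongr
          · exact inv_le_one_of_one_le₀ ht1.le
          · exact hy.2
      _ = r / 4 := one_mul _
  have := dist_triangle (dil t⁻¹ y) q p
  rw [Metric.mem_ball] at hq ⊢
  linarith

/-! ### Wedges and the filters `dirInf` -/

/-- A compact neighbourhood of `p` in `V` is an admissible test set for the wedge. -/
lemma IsWedge.mem_dirInf {V W : Set (Coord n)} (hV : IsOpen V) (h : IsWedge V W) {p : Coord n}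
    (hp : p ∈ V) : W ∈ dirInf p := by
  obtain ⟨L, hL, hpL, hLV⟩ := exists_compact_subset hV hp
  obtain ⟨δ, hδ, H⟩ := h.2 L ⟨L, hL, subset_rfl, hLV⟩
  exact Symb.mem_dirInf.2 ⟨L, mem_interior_iff_mem_nhds.1 hpL, δ, hδ, H⟩

/-- Uniformity of membership in the filters `dirInf` over compact sets. -/
lemma exists_forall_dil_mem {L S : Set (Coord n)} (hL : IsCompact L)
    (h : ∀ p ∈ L, S ∈ dirInf p) : ∃ δ : ℝ, 0 < δ ∧ ∀ p ∈ L, ∀ t : ℝ, δ < t → dil t p ∈ S := by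
  refine hL.induction_on (p := fun K => ∃ δ : ℝ, 0 < δ ∧ ∀ p ∈ K, ∀ t : ℝ, δ < t → dil t p ∈ S)
    ⟨1, one_pos, by simp⟩ ?_ ?_ ?_
  · rintro s t hst ⟨δ, hδ, H⟩
    exact ⟨δ, hδ, fun p hp => H p (hst hp)⟩
  · rintro s t ⟨δ, hδ, H⟩ ⟨δ', hδ', H'⟩
    refine ⟨max δ δ', lt_max_of_lt_left hδ, ?_⟩
    rintro p (hp | hp) a ha
    · exact H p hp a ((le_max_left _ _).trans_lt ha)
    · exact H' p hp a ((le_max_right _ _).trans_lt ha)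
  · intro p hp
    obtain ⟨N, hN, δ, hδ, H⟩ := mem_dirInf.1 (h p hp)
    exact ⟨N, mem_nhdsWithin_of_mem_nhds hN, δ, hδ, H⟩

lemma isWedge_of_mem_dirInf {V W : Set (Coord n)} (hW : W ⊆ V) (h : ∀ p ∈ V, W ∈ dirInf p) :
    IsWedge V W := by
  refine ⟨hW, ?_⟩
  rintro K ⟨L, hL, hKL, hLV⟩
  obtain ⟨δ, hδ, H⟩ := exists_forall_dil_mem hL fun p hp => h p (hLV hp)
  exact ⟨δ, hδ, fun p hp => H p (hKL hp)⟩

/-! ### Growth and decay along `dirInf` -/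

/-- Infra-exponential growth. -/
def Infra {E : Type*} [Norm E] (l : Filter (Coord n)) (G : Coord n → E) : Prop :=
  ∀ h : ℝ, 0 < h → G =O[l] fun x => Real.exp (h * ‖x.2‖)

/-- Exponential decay. -/
def Dec {E : Type*} [Norm E] (l : Filter (Coord n)) (G : Coord n → E) : Prop :=
  ∃ h : ℝ, 0 < h ∧ G =O[l] fun x => Real.exp (-h * ‖x.2‖)

lemma exp_decay_isBigO {l : Filter (Coord n)} {h h' : ℝ} (hh : h' ≤ h) :
    (fun x : Coord n => Real.exp (-h * ‖x.2‖)) =O[l] fun x => Real.exp (-h' * ‖x.2‖) := by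
  refine IsBigO.of_bound 1 (Eventually.of_forall fun x => ?_)
  rw [one_mul, Real.norm_eq_abs, Real.norm_eq_abs, Real.abs_exp, Real.abs_exp]
  gcongr

section NormedGroup

variable {E E' : Type*} [NormedAddCommGroup E] [NormedAddCommGroup E'] {l : Filter (Coord n)}

lemma Dec.infra {G : Coord n → E} (h : Dec l G) : Infra l G := by
  obtain ⟨k, hk, H⟩ := h
  intro h hh
  refine H.trans ?_
  simpa using exp_decay_isBigO (l := l) (h := k) (h' := -h) (by linarith)

lemma Dec.add {F G : Coord n → E} (hF : Dec l F) (hG : Dec l G) :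
    Dec l (fun x => F x + G x) := by
  obtain ⟨a, ha, HF⟩ := hF
  obtain ⟨b, hb, HG⟩ := hG
  exact ⟨min a b, lt_min ha hb, (HF.trans (exp_decay_isBigO (min_le_left _ _))).add
    (HG.trans (exp_decay_isBigO (min_le_right _ _)))⟩

lemma dec_zero : Dec l (fun _ => (0 : E)) := ⟨1, one_pos, isBigO_zero _ _⟩

lemma Dec.sum {ι : Type*} (s : Finset ι) {F : ι → Coord n → E} (hF : ∀ i ∈ s, Dec l (F i)) :
    Dec l (fun x => ∑ i ∈ s, F i x) := by
  classical
  induction s using Finset.induction_on with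
  | empty => simpa using dec_zero
  | insert i s hi ih =>
    simp only [Finset.sum_insert hi]
    exact (hF i (by simp)).add (ih fun j hj => hF j (by simp [hj]))

lemma Dec.of_isBigO {F : Coord n → E} {G : Coord n → E'} (hG : Dec l G) (h : F =O[l] G) :
    Dec l F := by
  obtain ⟨a, ha, H⟩ := hG
  exact ⟨a, ha, h.trans H⟩

lemma Infra.add {F G : Coord n → E} (hF : Infra l F) (hG : Infra l G) :
    Infra l (fun x => F x + G x) := fun h hh => (hF h hh).add (hG h hh)

/-- Half of the decay rate is spent on absorbing the growth of the second factor. -/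
lemma Dec.mul_infra {F G : Coord n → ℝ} (hF : Dec l F) (hG : Infra l G) :
    Dec l (fun x => F x * G x) := by
  obtain ⟨a, ha, H⟩ := hF
  refine ⟨a / 2, by positivity, (H.mul (hG (a / 2) (by positivity))).congr_right fun x => ?_⟩
  rw [← Real.exp_add]
  ring_nf

end NormedGroup

/-- Every point of an open cone lies in an open relatively compact cone. -/
lemma exists_relCptCone {V : Set (Coord n)} (hV : IsOpen V) (hc : IsCone V) {p : Coord n}
    (hp : p ∈ V) : ∃ V', IsOpen V' ∧ RelCptCone V' V ∧ p ∈ V' := by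
  obtain ⟨L, hL, hpL, hLV⟩ := exists_compact_subset hV hp
  refine ⟨{x | ∃ q ∈ interior L, ∃ t : ℝ, 0 < t ∧ x = dil t q},
    isOpen_dil_image isOpen_interior le_rfl, ⟨?_, interior L, ⟨L, hL, interior_subset, hLV⟩, rfl⟩,
    p, hpL, 1, one_pos, (dil_one p).symm⟩
  rintro _ ⟨q, hq, t, ht, rfl⟩
  exact hc q (hLV (interior_subset hq)) t ht

/-- Uniform bounds on the truncated cone over a compact set, from bounds along all its
directions. -/
lemma exists_bound_of_isBigO {L W : Set (Coord n)} (hL : IsCompact L) {δ : ℝ}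
    (hδ : ∀ p ∈ L, ∀ t : ℝ, δ ≤ t → dil t p ∈ W) {E : Type*} [NormedAddCommGroup E]
    {G : Coord n → E} (hG : ContinuousOn G W) {h : ℝ}
    (H : ∀ p ∈ L, G =O[dirInf p] fun x => Real.exp (h * ‖x.2‖)) :
    ∃ C : ℝ, 0 < C ∧ ∀ p ∈ L, ∀ t : ℝ, δ ≤ t →
      ‖G (dil t p)‖ ≤ C * Real.exp (h * ‖(dil t p).2‖) := by
  obtain ⟨C₁, δ₁, H₁⟩ : ∃ C δ₁ : ℝ, ∀ p ∈ L, ∀ t : ℝ, δ₁ < t →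
      ‖G (dil t p)‖ ≤ C * Real.exp (h * ‖(dil t p).2‖) := by
    refine hL.induction_on (p := fun K => ∃ C δ₁ : ℝ, ∀ p ∈ K, ∀ t : ℝ, δ₁ < t →
      ‖G (dil t p)‖ ≤ C * Real.exp (h * ‖(dil t p).2‖)) ⟨0, 0, by simp⟩ ?_ ?_ ?_
    · rintro s t hst ⟨C, δ, H⟩
      exact ⟨C, δ, fun p hp => H p (hst hp)⟩
    · rintro s t ⟨C, δ, H⟩ ⟨C', δ', H'⟩
      refine ⟨max C C', max δ δ', ?_⟩
      rintro p (hp | hp) a ha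
      · exact (H p hp a ((le_max_left _ _).trans_lt ha)).trans (by gcongr; exact le_max_left _ _)
      · exact (H' p hp a ((le_max_right _ _).trans_lt ha)).trans
          (by gcongr; exact le_max_right _ _)
    · intro p hp
      obtain ⟨C, hC⟩ := (H p hp).bound
      obtain ⟨N, hN, δ₁, -, H⟩ := eventually_dirInf.1 hC
      refine ⟨N, mem_nhdsWithin_of_mem_nhds hN, C, δ₁, fun q hq t ht => ?_⟩
      simpa using H q hq t ht
  -- For the remaining parameters, from `δ` up to the threshold `δ₁`, the dilates stay in a compact
  -- part of `W`, where the continuous quotient by the exponential is bounded.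
  have hK : IsCompact ((fun a : ℝ × Coord n => dil a.1 a.2) '' (Icc δ (max δ δ₁) ×ˢ L)) :=
    (isCompact_Icc.prod hL).image continuous_dil_uncurry
  have hq : ContinuousOn (fun x => ‖G x‖ * Real.exp (-(h * ‖x.2‖)))
      ((fun a : ℝ × Coord n => dil a.1 a.2) '' (Icc δ (max δ δ₁) ×ˢ L)) := by
    refine ContinuousOn.mul (hG.mono ?_).norm (by fun_prop)
    rintro _ ⟨a, ha, rfl⟩
    exact hδ a.2 ha.2 a.1 ha.1.1
  obtain ⟨C₂, H₂⟩ := (hK.bddAbove_image hq)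
  refine ⟨max 1 (max C₁ C₂), by positivity, fun p hp t ht => ?_⟩
  rcases lt_or_ge δ₁ t with h₁ | h₁
  · refine (H₁ p hp t h₁).trans ?_
    gcongr
    exact (le_max_left _ _).trans (le_max_right _ _)
  · have : ‖G (dil t p)‖ * Real.exp (-(h * ‖(dil t p).2‖)) ≤ C₂ :=
      H₂ ⟨_, ⟨(t, p), ⟨⟨ht, h₁.trans (le_max_right _ _)⟩, hp⟩, rfl⟩, rfl⟩
    rw [Real.exp_neg, ← div_eq_mul_inv, div_le_iff₀ (Real.exp_pos _)] at this
    refine this.trans ?_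
    gcongr
    exact (le_max_right _ _).trans (le_max_right _ _)

/-- The decay rate can be chosen uniformly over a compact set of directions. -/
lemma exists_uniform_decay {L : Set (Coord n)} (hL : IsCompact L) {E : Type*}
    [NormedAddCommGroup E] {G : Coord n → E} (H : ∀ p ∈ L, Dec (dirInf p) G) :
    ∃ h : ℝ, 0 < h ∧ ∀ p ∈ L, G =O[dirInf p] fun x => Real.exp (-h * ‖x.2‖) := by
  refine hL.induction_on (p := fun K => ∃ h : ℝ, 0 < h ∧ ∀ p ∈ K,
    G =O[dirInf p] fun x => Real.exp (-h * ‖x.2‖)) ⟨1, one_pos, by simp⟩ ?_ ?_ ?_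
  · rintro s t hst ⟨h, hh, H⟩
    exact ⟨h, hh, fun p hp => H p (hst hp)⟩
  · rintro s t ⟨h, hh, H⟩ ⟨h', hh', H'⟩
    refine ⟨min h h', lt_min hh hh', ?_⟩
    rintro p (hp | hp)
    · exact (H p hp).trans (exp_decay_isBigO (min_le_left _ _))
    · exact (H' p hp).trans (exp_decay_isBigO (min_le_right _ _))
  · intro p hp
    obtain ⟨h, hh, H⟩ := H p hp
    obtain ⟨C, hC⟩ := H.bound
    obtain ⟨N, hN, δ, hδ, H⟩ := eventually_dirInf.1 hC
    -- An open neighbourhood is a neighbourhood of each of its points, so the rate found at `p`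
    -- serves all directions near `p`.
    obtain ⟨N', hN', ho, hpN⟩ := mem_nhds_iff.1 hN
    exact ⟨N', mem_nhdsWithin_of_mem_nhds (ho.mem_nhds hpN), h, hh, fun q hq =>
      IsBigO.of_bound C (eventually_dirInf.2 ⟨N', ho.mem_nhds hq, δ, hδ, fun x hx =>
        H x (hN' hx)⟩)⟩

end Symb

/-! ### From bounds along directions to uniform bounds on wedges. -/

namespace Symb

open Filter Asymptotics

variable {n : ℕ}

/-- In a wedge `W` of type `V` there are, for every relatively compact cone `V'` of `V`, wedges of
type `V'` on which the bounds along the directions of `V` are uniform. -/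
lemma exists_wedge_bounds {V W V' : Set (Coord n)} (hV : ∀ p ∈ V, p.2 ≠ 0)
    (hw : IsWedge V W) (hV' : RelCptCone V' V) :
    ∃ W' ⊆ W, IsWedge V' W' ∧
      (∀ G : Coord n → ℂ, ContinuousOn G W → (∀ p ∈ V, Infra (dirInf p) G) →
        ∀ h : ℝ, 0 < h → ∃ C : ℝ, 0 < C ∧ ∀ p ∈ W', ‖G p‖ ≤ C * Real.exp (h * ‖p.2‖)) ∧
      (∀ G : Coord n → ℂ, ContinuousOn G W → (∀ p ∈ V, Dec (dirInf p) G) →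
        ∃ h : ℝ, 0 < h ∧ ∃ C : ℝ, 0 < C ∧ ∀ p ∈ W', ‖G p‖ ≤ C * Real.exp (-h * ‖p.2‖)) := by
  obtain ⟨hsub, K, ⟨L, hL, hKL, hLV⟩, rfl⟩ := hV'
  obtain ⟨δ, hδ, H⟩ := hw.2 L ⟨L, hL, subset_rfl, hLV⟩
  have H' : ∀ p ∈ L, ∀ t : ℝ, δ + 1 ≤ t → dil t p ∈ W := fun p hp t ht => H p hp t (by linarith)
  -- The threshold `δ + 1` allows the closed condition `δ + 1 ≤ t`, as needed for the compactness
  -- argument in `exists_bound_of_isBigO`, while `H` requires `δ < t`.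
  refine ⟨{x | ∃ p ∈ K, ∃ t : ℝ, δ + 1 ≤ t ∧ x = dil t p}, ?_, ⟨?_, ?_⟩, ?_, ?_⟩
  · rintro _ ⟨p, hp, t, ht, rfl⟩
    exact H' p (hKL hp) t ht
  · rintro _ ⟨p, hp, t, ht, rfl⟩
    exact ⟨p, hp, t, by linarith, rfl⟩
  · rintro K' ⟨L', hL', hKL', hLV'⟩
    obtain ⟨M, hM⟩ := (hL.image continuous_snd).isBounded.exists_norm_le
    have hM' : ∀ p ∈ L, ‖p.2‖ ≤ M := fun p hp => hM _ ⟨p, hp, rfl⟩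
    rcases K'.eq_empty_or_nonempty with rfl | ⟨x₀, hx₀⟩
    · exact ⟨1, one_pos, by simp⟩
    obtain ⟨x₁, hx₁, hmin⟩ := hL'.exists_isMinOn ⟨x₀, hKL' hx₀⟩
      (continuous_snd.norm.continuousOn)
    have hm : 0 < ‖x₁.2‖ := norm_pos_iff.2 (hV _ (hsub (hLV' hx₁)))
    have hMpos : 0 < M := by
      obtain ⟨p, hp, -⟩ := hLV' hx₁
      exact (norm_pos_iff.2 (hV p (hLV (hKL hp)))).trans_le (hM' p (hKL hp))
    -- A point of `L'` is `dil s p` with `p ∈ K`, and `s‖p.2‖` is at least the minimum `‖x₁.2‖` of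
    -- the fibre norm on `L'`, while `‖p.2‖ ≤ M`. So `s ≥ ‖x₁.2‖ / M`, and this `t` forces `t * s ≥
    -- δ + 1`. The minimum is positive because `V` avoids the zero section.
    refine ⟨(δ + 1) * M / ‖x₁.2‖, by positivity, fun x hx t ht => ?_⟩
    obtain ⟨p, hp, s, hs, rfl⟩ := hLV' (hKL' hx)
    have ht0 : 0 < t := lt_trans (by positivity) ht
    refine ⟨p, hp, t * s, ?_, dil_dil t s p⟩
    have h1 : ‖x₁.2‖ ≤ s * ‖p.2‖ := by
      rw [← norm_dil_snd hs.le]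
      exact hmin (hKL' hx)
    have h2 : s * ‖p.2‖ ≤ s * M := by gcongr; exact hM' p (hKL hp)
    rw [div_lt_iff₀ hm] at ht
    have h3 : t * ‖x₁.2‖ ≤ t * (s * M) := by gcongr; exact h1.trans h2
    by_contra! hlt
    have : t * s * M ≤ (δ + 1) * M := by gcongr
    nlinarith
  · intro G hG hI h hh
    obtain ⟨C, hC, HC⟩ := exists_bound_of_isBigO hL H' hG (h := h) fun p hp => hI p (hLV hp) h hh
    refine ⟨C, hC, ?_⟩
    rintro _ ⟨p, hp, t, ht, rfl⟩
    exact HC p (hKL hp) t ht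
  · intro G hG hD
    obtain ⟨h, hh, HD⟩ := exists_uniform_decay hL fun p hp => hD p (hLV hp)
    obtain ⟨C, hC, HC⟩ := exists_bound_of_isBigO hL H' hG (h := -h) HD
    refine ⟨h, hh, C, hC, ?_⟩
    rintro _ ⟨p, hp, t, ht, rfl⟩
    exact HC p (hKL hp) t ht

lemma infra_of_bounds {l : Filter (Coord n)} {W : Set (Coord n)} (hW : W ∈ l) {G : Coord n → ℂ}
    (H : ∀ h : ℝ, 0 < h → ∃ C : ℝ, 0 < C ∧ ∀ p ∈ W, ‖G p‖ ≤ C * Real.exp (h * ‖p.2‖)) :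
    Infra l G := by
  intro h hh
  obtain ⟨C, -, HC⟩ := H h hh
  refine IsBigO.of_bound C ?_
  filter_upwards [hW] with x hx
  simpa using HC x hx

lemma dec_of_bounds {l : Filter (Coord n)} {W : Set (Coord n)} (hW : W ∈ l) {G : Coord n → ℂ}
    (H : ∃ h : ℝ, 0 < h ∧ ∃ C : ℝ, 0 < C ∧ ∀ p ∈ W, ‖G p‖ ≤ C * Real.exp (-h * ‖p.2‖)) :
    Dec l G := by
  obtain ⟨h, hh, C, -, HC⟩ := H
  refine ⟨h, hh, IsBigO.of_bound C ?_⟩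
  filter_upwards [hW] with x hx
  simpa using HC x hx

/-! ### Germs at infinity -/

/-- `F` is holomorphic near the direction `p` at infinity. -/
def HolGerm (p : Coord n) (F : Coord n → ℂ) : Prop :=
  ∃ W, IsOpen W ∧ W ∈ dirInf p ∧ DifferentiableOn ℂ F W

/-- `F` is smooth, and holomorphic in `ζ`, near the direction `p` at infinity. -/
def SmoothHoloGerm (p : Coord n) (F : Coord n → ℂ) : Prop :=
  ∃ W, IsOpen W ∧ W ∈ dirInf p ∧ SmoothHolo W F

/-- `F` is a null-symbol of `C^∞`-type near the direction `p`. -/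
def NullGerm (p : Coord n) (F : Coord n → ℂ) : Prop :=
  SmoothHoloGerm p F ∧ ∀ α β, Dec (dirInf p) (mixed α β F)

/-- Holomorphy is a local condition, so the union of all open sets on which `F` is holomorphic is a
single domain that serves every direction. -/
lemma exists_wedge_holo {V : Set (Coord n)} (ho : IsOpen V) (hc : IsCone V) {F : Coord n → ℂ}
    (h : ∀ p ∈ V, HolGerm p F) : ∃ W, IsOpen W ∧ IsWedge V W ∧ DifferentiableOn ℂ F W := by
  refine ⟨V ∩ ⋃₀ {W | IsOpen W ∧ DifferentiableOn ℂ F W},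
    ho.inter (isOpen_sUnion fun W hW => hW.1),
    isWedge_of_mem_dirInf inter_subset_left fun p hp => inter_mem (hc.mem_dirInf ho hp) ?_, ?_⟩
  · obtain ⟨W, hW, hWp, hd⟩ := h p hp
    exact mem_of_superset hWp (subset_sUnion_of_mem ⟨hW, hd⟩)
  · rintro x ⟨-, W, ⟨hW, hd⟩, hx⟩
    exact (hd.differentiableAt (hW.mem_nhds hx)).differentiableWithinAt

lemma exists_wedge_smoothHolo {V : Set (Coord n)} (ho : IsOpen V) (hc : IsCone V)
    {F : Coord n → ℂ} (h : ∀ p ∈ V, SmoothHoloGerm p F) :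
    ∃ W, IsOpen W ∧ IsWedge V W ∧ SmoothHolo W F := by
  refine ⟨V ∩ ⋃₀ {W | IsOpen W ∧ SmoothHolo W F},
    ho.inter (isOpen_sUnion fun W hW => hW.1),
    isWedge_of_mem_dirInf inter_subset_left fun p hp => inter_mem (hc.mem_dirInf ho hp) ?_,
    ⟨?_, ?_⟩⟩
  · obtain ⟨W, hW, hWp, hd⟩ := h p hp
    exact mem_of_superset hWp (subset_sUnion_of_mem ⟨hW, hd⟩)
  · rintro x ⟨-, W, ⟨hW, hd⟩, hx⟩
    exact (hd.1.contDiffAt (hW.mem_nhds hx)).contDiffWithinAt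
  · rintro x ⟨-, W, ⟨hW, hd⟩, hx⟩
    exact hd.2 x hx

/-- Every direction lies in some open relatively compact cone, which gives the local statement;
conversely compactness makes the local bounds uniform. From here on wedges enter only through the
filters `dirInf p`. -/
lemma isSymbol_iff {V : Set (Coord n)} (ho : IsOpen V) (hc : IsCone V) (hV : ∀ p ∈ V, p.2 ≠ 0)
    {F : Coord n → ℂ} :
    IsSymbol V F ↔ ∀ p ∈ V, HolGerm p F ∧ Infra (dirInf p) F := by
  constructor
  · rintro ⟨W, hW⟩ p hp
    obtain ⟨V', hV', hr, hpV'⟩ := exists_relCptCone ho hc hp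
    obtain ⟨W', -, hw', H⟩ := hW.growth V' hV' hr
    exact ⟨⟨W, hW.isOpen, hW.wedge.mem_dirInf ho hp, hW.holo⟩,
      infra_of_bounds (hw'.mem_dirInf hV' hpV') H⟩
  · intro h
    obtain ⟨W, hW, hw, hd⟩ := exists_wedge_holo ho hc fun p hp => (h p hp).1
    refine ⟨W, hW, hw, hd, fun V' _ hr => ?_⟩
    obtain ⟨W', hW', hw', H, -⟩ := exists_wedge_bounds hV hw hr
    exact ⟨W', hW', hw', H F hd.continuousOn fun p hp => (h p hp).2⟩

lemma isNull_iff {V : Set (Coord n)} (ho : IsOpen V) (hc : IsCone V) (hV : ∀ p ∈ V, p.2 ≠ 0)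
    {F : Coord n → ℂ} :
    IsNull V F ↔ ∀ p ∈ V, HolGerm p F ∧ Dec (dirInf p) F := by
  constructor
  · rintro ⟨W, hW, hN⟩ p hp
    obtain ⟨V', hV', hr, hpV'⟩ := exists_relCptCone ho hc hp
    obtain ⟨W', -, hw', H⟩ := hN V' hV' hr
    exact ⟨⟨W, hW.isOpen, hW.wedge.mem_dirInf ho hp, hW.holo⟩,
      dec_of_bounds (hw'.mem_dirInf hV' hpV') H⟩
  · intro h
    obtain ⟨W, hW⟩ := (isSymbol_iff ho hc hV).2 fun p hp => ⟨(h p hp).1, (h p hp).2.infra⟩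
    refine ⟨W, hW, fun V' _ hr => ?_⟩
    obtain ⟨W', hW', hw', -, H⟩ := exists_wedge_bounds hV hW.wedge hr
    exact ⟨W', hW', hw', H F hW.holo.continuousOn fun p hp => (h p hp).2⟩

lemma isNullInf_iff {V : Set (Coord n)} (ho : IsOpen V) (hc : IsCone V) (hV : ∀ p ∈ V, p.2 ≠ 0)
    {F : Coord n → ℂ} : IsNullInf V F ↔ ∀ p ∈ V, NullGerm p F := by
  constructor
  · rintro ⟨W, hW, hw, hs, hN⟩ p hp
    obtain ⟨V', hV', hr, hpV'⟩ := exists_relCptCone ho hc hp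
    obtain ⟨W', -, hw', H⟩ := hN V' hV' hr
    exact ⟨⟨W, hW, hw.mem_dirInf ho hp, hs⟩,
      fun α β => dec_of_bounds (hw'.mem_dirInf hV' hpV') (H α β)⟩
  · intro h
    obtain ⟨W, hW, hw, hs⟩ := exists_wedge_smoothHolo ho hc fun p hp => (h p hp).1
    refine ⟨W, hW, hw, hs, fun V' _ hr => ?_⟩
    obtain ⟨W', hW', hw', -, H⟩ := exists_wedge_bounds hV hw hr
    exact ⟨W', hW', hw', fun α β => H _ ((localOp_mixed α β).smooth W F hW hs.1).continuousOn
      fun p hp => (h p hp).2 α β⟩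

lemma isSymbolInf_iff {V : Set (Coord n)} (ho : IsOpen V) (hc : IsCone V)
    (hV : ∀ p ∈ V, p.2 ≠ 0) {F : Coord n → ℂ} :
    IsSymbolInf V F ↔ ∀ p ∈ V, SmoothHoloGerm p F ∧
      (∀ α β, Infra (dirInf p) (mixed α β F)) ∧ ∀ j, NullGerm p (dzbar j F) := by
  constructor
  · rintro ⟨⟨W, hW, hw, hs, hN⟩, hj⟩ p hp
    obtain ⟨V', hV', hr, hpV'⟩ := exists_relCptCone ho hc hp
    obtain ⟨W', -, hw', H⟩ := hN V' hV' hr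
    exact ⟨⟨W, hW, hw.mem_dirInf ho hp, hs⟩,
      fun α β => infra_of_bounds (hw'.mem_dirInf hV' hpV') (H α β),
      fun j => (isNullInf_iff ho hc hV).1 (hj j) p hp⟩
  · intro h
    obtain ⟨W, hW, hw, hs⟩ := exists_wedge_smoothHolo ho hc fun p hp => (h p hp).1
    refine ⟨⟨W, hW, hw, hs, fun V' _ hr => ?_⟩,
      fun j => (isNullInf_iff ho hc hV).2 fun p hp => (h p hp).2.2 j⟩
    obtain ⟨W', hW', hw', H, -⟩ := exists_wedge_bounds hV hw hr
    exact ⟨W', hW', hw', fun α β => H _ ((localOp_mixed α β).smooth W F hW hs.1).continuousOn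
      fun p hp => (h p hp).2.1 α β⟩

end Symb

namespace Symb

open Filter Asymptotics

variable {n : ℕ}

/-! ### Holomorphic functions of several variables -/

section Holomorphic

variable {E : Type*} [NormedAddCommGroup E] [NormedSpace ℂ E]

lemma fderiv_apply_eq_deriv_line {F : E → ℂ} {x : E} (hF : DifferentiableAt ℂ F x) (v : E) :
    fderiv ℂ F x v = deriv (fun s : ℂ => F (x + s • v)) 0 := by
  have hl : HasDerivAt (fun s : ℂ => x + s • v) v 0 := by
    simpa using ((hasDerivAt_id (0 : ℂ)).smul_const v).const_add x
  have hF' : HasFDerivAt F (fderiv ℂ F x) (x + (0 : ℂ) • v) := by simpa using hF.hasFDerivAt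
  exact (hF'.comp_hasDerivAt 0 hl).deriv.symm

lemma differentiableOn_line {F : E → ℂ} {W : Set E} (hW : IsOpen W)
    (hF : DifferentiableOn ℂ F W) (x v : E) :
    DifferentiableOn ℂ (fun s : ℂ => F (x + s • v)) {s | x + s • v ∈ W} := fun s hs =>
  ((hF.differentiableAt (hW.mem_nhds hs)).comp s
    (by fun_prop : DifferentiableAt ℂ (fun s : ℂ => x + s • v) s)).differentiableWithinAt

/-- The `+ 1` lets one radius formula serve all `v`, including `v = 0`. -/
lemma add_smul_mem_closedBall {x v : E} {s : ℂ} {ε : ℝ} (hs : ‖s‖ ≤ ε / (‖v‖ + 1)) :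
    x + s • v ∈ Metric.closedBall x ε := by
  rw [mem_closedBall_iff_norm, add_sub_cancel_left, norm_smul]
  have h1 : 0 < ‖v‖ + 1 := by positivity
  rw [le_div_iff₀ h1] at hs
  nlinarith [norm_nonneg s]

/-- Cauchy's estimate for directional derivatives. -/
lemma norm_deriv_line_le {F : E → ℂ} {x v : E} {ε M : ℝ} (hε : 0 < ε)
    (hd : ∀ s : ℂ, ‖s‖ ≤ ε / (‖v‖ + 1) → DifferentiableAt ℂ (fun s : ℂ => F (x + s • v)) s)
    (hM : ∀ y ∈ Metric.closedBall x ε, ‖F y‖ ≤ M) :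
    ‖deriv (fun s : ℂ => F (x + s • v)) 0‖ ≤ M / (ε / (‖v‖ + 1)) := by
  have hR : 0 < ε / (‖v‖ + 1) := by positivity
  refine Complex.norm_deriv_le_of_forall_mem_sphere_norm_le hR
    (DifferentiableOn.diffContOnCl fun s hs => ?_) fun s hs => hM _ (add_smul_mem_closedBall ?_)
  · rw [closure_ball _ hR.ne'] at hs
    exact (hd s (by simpa using hs)).differentiableWithinAt
  · exact (by simpa using hs : ‖s‖ = _).le

variable [FiniteDimensional ℂ E]

/-- The directional derivative is Cauchy's integral over a circle of fixed radius in the line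
through `x`; there `x` enters only through the values of `F`, so one may differentiate under the
integral sign. -/
lemma differentiableOn_fderiv_apply {F : E → ℂ} {W : Set E} (hW : IsOpen W)
    (hF : DifferentiableOn ℂ F W) (v : E) :
    DifferentiableOn ℂ (fun x => fderiv ℂ F x v) W := by
  borelize E
  have : ProperSpace E := FiniteDimensional.proper ℂ E
  intro x₀ hx₀
  obtain ⟨ρ, hρ, hρW⟩ := Metric.nhds_basis_closedBall.mem_iff.1 (hW.mem_nhds hx₀)
  obtain ⟨M, hM⟩ := (isCompact_closedBall x₀ ρ).exists_bound_of_continuousOn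
    (hF.continuousOn.mono hρW)
  -- Three steps of length `ε` must fit into the ball: from `x₀` to `x`, from `x` to the circle, and
  -- from a point of the circle to the discs on which Cauchy's estimate bounds the derivative.
  set ε := ρ / 3 with hε
  have hε0 : 0 < ε := by positivity
  set R := ε / (‖v‖ + 1) with hR
  have hR0 : 0 < R := by positivity
  have hsub : ∀ x ∈ Metric.ball x₀ ε, Metric.closedBall x ε ⊆ Metric.closedBall x₀ (2 * ε) := by
    intro x hx
    refine Metric.closedBall_subset_closedBall' ?_
    rw [Metric.mem_ball] at hx
    linarith
  have hsub' : ∀ y ∈ Metric.closedBall x₀ (2 * ε), Metric.closedBall y ε ⊆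
      Metric.closedBall x₀ ρ := by
    intro y hy
    refine Metric.closedBall_subset_closedBall' ?_
    rw [Metric.mem_closedBall] at hy
    linarith
  have hmem : ∀ y ∈ Metric.closedBall x₀ (2 * ε), y ∈ W := fun y hy =>
    hρW (hsub' y hy (Metric.mem_closedBall_self hε0.le))
  have hM0 : 0 ≤ M := (norm_nonneg _).trans (hM x₀ (Metric.mem_closedBall_self hρ.le))
  -- The operator norm is tested on vectors with `1 ≤ ‖u‖ < 2`; there `‖u‖ + 1 ≤ 3`, which accounts
  -- for the factor 3.
  have hbound : ∀ y ∈ Metric.closedBall x₀ (2 * ε), ‖fderiv ℂ F y‖ ≤ M * 3 / ε := by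
    intro y hy
    refine ContinuousLinearMap.opNorm_le_of_shell (ε := 2) (c := (2 : ℂ)) two_pos (by positivity)
      (by simp) fun u hu hu2 => ?_
    rw [fderiv_apply_eq_deriv_line (hF.differentiableAt (hW.mem_nhds (hmem y hy)))]
    have hu1 : 1 ≤ ‖u‖ := by simpa using hu
    refine (norm_deriv_line_le hε0 (fun s hs => ?_) fun z hz => hM z (hsub' y hy hz)).trans ?_
    · have : y + s • u ∈ W := hρW (hsub' y hy (add_smul_mem_closedBall hs))
      exact (differentiableOn_line hW hF y u).differentiableAt
        ((hW.preimage (by fun_prop : Continuous fun s : ℂ => y + s • u)).mem_nhds this)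
    · rw [div_div_eq_mul_div, div_mul_eq_mul_div, mul_assoc]
      gcongr
      linarith
  have hcirc : ∀ x ∈ Metric.ball x₀ ε, ∀ θ : ℝ, x + circleMap 0 R θ • v ∈
      Metric.closedBall x₀ (2 * ε) := fun x hx θ =>
    hsub x hx (add_smul_mem_closedBall (by
      rw [norm_circleMap_zero, abs_of_pos hR0]))
  have hval : ∀ x ∈ Metric.ball x₀ ε, fderiv ℂ F x v =
      (2 * Real.pi * Complex.I : ℂ)⁻¹ • ∫ θ in (0 : ℝ)..2 * Real.pi,
        (deriv (circleMap 0 R) θ * ((circleMap 0 R θ) ^ 2)⁻¹) • F (x + circleMap 0 R θ • v) := by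
    intro x hx
    have hxW : x ∈ W := hmem x (hsub x hx (Metric.mem_closedBall_self hε0.le))
    have hopen : IsOpen {s : ℂ | x + s • v ∈ W} :=
      hW.preimage (by fun_prop : Continuous fun s : ℂ => x + s • v)
    rw [fderiv_apply_eq_deriv_line (hF.differentiableAt (hW.mem_nhds hxW)),
      ← Complex.cderiv_eq_deriv hopen (differentiableOn_line hW hF x v) hR0]
    · simp only [Complex.cderiv, circleIntegral, sub_zero, smul_smul]
    · intro s hs
      exact hmem _ (hsub x hx (add_smul_mem_closedBall (by simpa using hs)))
  have hcoef : Continuous fun θ : ℝ =>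
      deriv (circleMap 0 R) θ * ((circleMap 0 R θ) ^ 2)⁻¹ := by
    simp only [deriv_circleMap]
    refine Continuous.mul (by fun_prop) (Continuous.inv₀ (by fun_prop) fun θ => ?_)
    exact pow_ne_zero 2 (circleMap_ne_center hR0.ne')
  have hcont : ∀ x ∈ Metric.ball x₀ ε, Continuous fun θ : ℝ =>
      (deriv (circleMap 0 R) θ * ((circleMap 0 R θ) ^ 2)⁻¹) • F (x + circleMap 0 R θ • v) := by
    intro x hx
    refine hcoef.smul (hF.continuousOn.comp_continuous (by fun_prop) fun θ =>
      hmem _ (hcirc x hx θ))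
  have key := intervalIntegral.hasFDerivAt_integral_of_dominated_of_fderiv_le
    (μ := MeasureTheory.volume) (a := 0) (b := 2 * Real.pi) (s := Metric.ball x₀ ε) (x₀ := x₀)
    (𝕜 := ℂ)
    (F := fun x θ => (deriv (circleMap 0 R) θ * ((circleMap 0 R θ) ^ 2)⁻¹) •
      F (x + circleMap 0 R θ • v))
    (F' := fun x θ => (deriv (circleMap 0 R) θ * ((circleMap 0 R θ) ^ 2)⁻¹) •
      fderiv ℂ F (x + circleMap 0 R θ • v))
    (bound := fun θ => ‖deriv (circleMap 0 R) θ * ((circleMap 0 R θ) ^ 2)⁻¹‖ * (M * 3 / ε))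
    (Metric.ball_mem_nhds x₀ hε0)
    (by
      filter_upwards [Metric.ball_mem_nhds x₀ hε0] with x hx
      exact (hcont x hx).aestronglyMeasurable)
    ((hcont x₀ (Metric.mem_ball_self hε0)).intervalIntegrable _ _)
    (by
      -- The derivative is not yet known to be continuous, but every Fréchet derivative is
      -- measurable, and this suffices.
      refine (hcoef.measurable.smul ((measurable_fderiv ℂ F).comp ?_)).aestronglyMeasurable
      exact (by fun_prop : Continuous fun θ : ℝ => x₀ + circleMap 0 R θ • v).measurable)
    (Eventually.of_forall fun θ _ x hx => by
      rw [norm_smul]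
      gcongr
      exact hbound _ (hcirc x hx θ))
    ((hcoef.norm.mul continuous_const).intervalIntegrable _ _)
    (Eventually.of_forall fun θ _ x hx => by
      have h1 := (hF.differentiableAt (hW.mem_nhds (hmem _ (hcirc x hx θ)))).hasFDerivAt
      have h2 : HasFDerivAt (fun x : E => x + circleMap 0 R θ • v)
        (ContinuousLinearMap.id ℂ E) x := (hasFDerivAt_id x).add_const _
      exact (h1.comp x h2).const_smul (deriv (circleMap 0 R) θ * ((circleMap 0 R θ) ^ 2)⁻¹))
  have hd := (key.differentiableAt.const_smul ((2 * Real.pi * Complex.I : ℂ)⁻¹))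
  refine (hd.congr_of_eventuallyEq ?_).differentiableWithinAt
  filter_upwards [Metric.ball_mem_nhds x₀ hε0] with x hx
  exact hval x hx

/-- The derivative of a function, recovered from its directional derivatives. -/
lemma fderiv_eq_sum_basis {𝕜 G : Type*} [RCLike 𝕜] [NormedAddCommGroup G] [NormedSpace 𝕜 G]
    [FiniteDimensional 𝕜 G] {H : Type*} [NormedAddCommGroup H] [NormedSpace 𝕜 H] {ι : Type*}
    [Fintype ι] (b : Module.Basis ι 𝕜 G) (F : G → H) :
    fderiv 𝕜 F = fun x => ∑ i, ContinuousLinearMap.smulRightL 𝕜 G H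
      (LinearMap.toContinuousLinearMap (b.coord i)) (fderiv 𝕜 F x (b i)) := by
  funext x
  ext v
  conv_lhs => rw [← b.sum_repr v, map_sum]
  simp [-Module.Basis.sum_repr]

/-- Induction on the order: `fderiv` is a fixed linear combination of directional derivatives, which
are holomorphic again. -/
lemma contDiffOn_of_differentiableOn {F : E → ℂ} {W : Set E} (hW : IsOpen W)
    (hF : DifferentiableOn ℂ F W) : ContDiffOn ℂ ∞ F W := by
  rw [contDiffOn_infty]
  intro k
  induction k generalizing F with
  | zero => exact contDiffOn_zero.2 hF.continuousOn
  | succ k ih =>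
    push_cast
    rw [contDiffOn_succ_iff_fderiv_of_isOpen hW]
    refine ⟨hF, by simp, ?_⟩
    rw [fderiv_eq_sum_basis (Module.finBasis ℂ E) F]
    refine ContDiffOn.sum fun i _ => ?_
    exact (ContinuousLinearMap.contDiff _).comp_contDiffOn
      (ih (differentiableOn_fderiv_apply hW hF _))

/-- A real differentiable function with complex linear derivative is complex differentiable. -/
lemma differentiableAt_of_map_I_smul {G : Type*} [NormedAddCommGroup G] [NormedSpace ℂ G]
    {F : G → ℂ} {x : G} (hF : DifferentiableAt ℝ F x)
    (h : ∀ v, fderiv ℝ F x (Complex.I • v) = Complex.I * fderiv ℝ F x v) :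
    DifferentiableAt ℂ F x := by
  refine (differentiableAt_iff_restrictScalars ℝ hF).2
    ⟨{ toFun := fderiv ℝ F x, map_add' := map_add _, map_smul' := fun c v => ?_,
       cont := (fderiv ℝ F x).cont }, rfl⟩
  have e : c • v = c.re • v + c.im • (Complex.I • v) := by
    conv_lhs => rw [← Complex.re_add_im c, add_smul, mul_smul]
    rfl
  rw [e, map_add, map_smul, map_smul, h]
  simp only [RingHom.id_apply, smul_eq_mul, Complex.real_smul]
  conv_rhs => rw [← Complex.re_add_im c]
  ring

end Holomorphic

end Symb

namespace Symb

open Filter Asymptotics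

variable {n : ℕ}

/-! ### First order operators with constant coefficients -/

/-- The derivative in the direction of `v`. -/
def dirDeriv (v : Coord n) (F : Coord n → ℂ) (p : Coord n) : ℂ := fderiv ℝ F p v

/-- A combination of two directional derivatives. -/
def combDeriv (a b : ℂ) (v w : Coord n) (F : Coord n → ℂ) (p : Coord n) : ℂ :=
  a * fderiv ℝ F p v + b * fderiv ℝ F p w

lemma dirDeriv_eq (v : Coord n) : dirDeriv v = combDeriv 1 0 v v := by
  funext F p
  simp [dirDeriv, combDeriv]

lemma dz_eq (j : Fin n) : dz j = combDeriv (1 / 2) (-(1 / 2 * Complex.I))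
    (EuclideanSpace.single j 1, 0) (EuclideanSpace.single j Complex.I, 0) := by
  funext F p
  simp only [dz, combDeriv]
  ring

lemma dzbar_eq (j : Fin n) : dzbar j = combDeriv (1 / 2) (1 / 2 * Complex.I)
    (EuclideanSpace.single j 1, 0) (EuclideanSpace.single j Complex.I, 0) := by
  funext F p
  simp only [dzbar, combDeriv]
  ring

lemma localOp_combDeriv (a b : ℂ) (v w : Coord n) : LocalOp (combDeriv a b v w) where
  smooth W F hW hF := (contDiffOn_const.mul (contDiffOn_fderiv_apply hW hF _)).add
    (contDiffOn_const.mul (contDiffOn_fderiv_apply hW hF _))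
  congr W F G hW h p hp := by simp only [combDeriv, fderiv_congr_on hW h hp]
  add W F G hW hF hG p hp := by
    simp only [combDeriv, fderiv_add_on hW hF hG hp, Pi.add_apply, add_apply]
    ring
  neg F := by
    funext p
    simp only [combDeriv, fderiv_neg, Pi.neg_apply, neg_apply]
    ring

lemma fderiv_combDeriv {W : Set (Coord n)} {F : Coord n → ℂ} (hW : IsOpen W)
    (hF : ContDiffOn ℝ ∞ F W) {p : Coord n} (hp : p ∈ W) (a b : ℂ) (v w u : Coord n) :
    fderiv ℝ (combDeriv a b v w F) p u =
      a * fderiv ℝ (fderiv ℝ F) p u v + b * fderiv ℝ (fderiv ℝ F) p u w := by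
  have hd : DifferentiableAt ℝ (fderiv ℝ F) p :=
    ((hF.fderiv_of_isOpen hW (m := ∞) (by simp)).contDiffAt (hW.mem_nhds hp)).differentiableAt
      (by simp)
  have h1 : ∀ v, HasFDerivAt (fun q => fderiv ℝ F q v)
      ((fderiv ℝ (fderiv ℝ F) p).flip v) p := fun v => by
    simpa using hd.hasFDerivAt.clm_apply (hasFDerivAt_const v p)
  have h2 := ((h1 v).const_mul a).add ((h1 w).const_mul b)
  have : fderiv ℝ (combDeriv a b v w F) p = _ := h2.fderiv
  rw [this]
  simp

/-- Two operators commute on smooth functions. -/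
def CommOps (P Q : (Coord n → ℂ) → (Coord n → ℂ)) : Prop :=
  ∀ W F, IsOpen W → ContDiffOn ℝ ∞ F W → EqOn (P (Q F)) (Q (P F)) W

/-- This is the symmetry of the second derivative. The family contains `dz`, `dzbar`, the
directional derivatives and the Cauchy–Riemann operators in `ζ`, so all commutations needed later
are instances. -/
lemma commOps_combDeriv (a b c d : ℂ) (v w v' w' : Coord n) :
    CommOps (combDeriv a b v w) (combDeriv c d v' w') := by
  intro W F hW hF p hp
  have hs := (hF.contDiffAt (hW.mem_nhds hp)).isSymmSndFDerivAt
    (by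
      rw [minSmoothness_of_isRCLikeNormedField]
      exact WithTop.coe_le_coe.2 (le_top : (2 : ℕ∞) ≤ ⊤))
  rw [combDeriv, combDeriv]
  simp only [fderiv_combDeriv hW hF hp]
  rw [hs v v', hs v w', hs w v', hs w w']
  ring

lemma CommOps.comp {P Q R : (Coord n → ℂ) → (Coord n → ℂ)} (hQ : LocalOp Q)
    (hR : LocalOp R) (h₁ : CommOps P Q) (h₂ : CommOps P R) :
    CommOps P (fun F => Q (R F)) := fun W F hW hF =>
  (h₁ W (R F) hW (hR.smooth W F hW hF)).trans (hQ.congr W _ _ hW (h₂ W F hW hF))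

lemma CommOps.iterate {P Q : (Coord n → ℂ) → (Coord n → ℂ)} (hQ : LocalOp Q)
    (h : CommOps P Q) (k : ℕ) : CommOps P (fun F => Q^[k] F) := by
  induction k with
  | zero => exact fun W F _ _ => eqOn_refl _ _
  | succ k ih =>
    simp only [Function.iterate_succ_apply']
    exact CommOps.comp hQ (hQ.iterate k) h ih

lemma CommOps.foldr {P : (Coord n → ℂ) → (Coord n → ℂ)}
    {d : Fin n → (Coord n → ℂ) → (Coord n → ℂ)} (hd : ∀ j, LocalOp (d j))
    (h : ∀ j, CommOps P (d j)) (α : Fin n → ℕ) (l : List (Fin n)) :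
    CommOps P (fun F => l.foldr (fun j G => (d j)^[α j] G) F) ∧
      LocalOp (fun F => l.foldr (fun j G => (d j)^[α j] G) F) := by
  induction l with
  | nil => exact ⟨fun W F _ _ => eqOn_refl _ _, LocalOp.id⟩
  | cons j l ih => exact ⟨CommOps.comp ((hd j).iterate (α j)) ih.2
      ((h j).iterate (hd j) (α j)) ih.1, ((hd j).iterate (α j)).comp ih.2⟩

lemma CommOps.multi {P : (Coord n → ℂ) → (Coord n → ℂ)}
    {d : Fin n → (Coord n → ℂ) → (Coord n → ℂ)} (hd : ∀ j, LocalOp (d j))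
    (h : ∀ j, CommOps P (d j)) (α : Fin n → ℕ) : CommOps P (Symb.multi d α) :=
  (CommOps.foldr hd h α (List.finRange n)).1

lemma foldr_update_of_notMem {d : Fin n → (Coord n → ℂ) → (Coord n → ℂ)} {α α' : Fin n → ℕ}
    (l : List (Fin n)) (h : ∀ i ∈ l, α i = α' i) (F : Coord n → ℂ) :
    l.foldr (fun j G => (d j)^[α j] G) F = l.foldr (fun j G => (d j)^[α' j] G) F := by
  induction l with
  | nil => rfl
  | cons i l ih =>
    simp only [List.foldr_cons]
    rw [ih fun k hk => h k (by simp [hk]), h i (by simp)]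

/-- Raising one exponent of a multi-index. -/
lemma multi_add_single {d : Fin n → (Coord n → ℂ) → (Coord n → ℂ)} (hd : ∀ j, LocalOp (d j))
    (h : ∀ i j, CommOps (d i) (d j)) (α : Fin n → ℕ) (j : Fin n) {W : Set (Coord n)}
    {F : Coord n → ℂ} (hW : IsOpen W) (hF : ContDiffOn ℝ ∞ F W) :
    EqOn (multi d α (d j F)) (multi d (α + Pi.single j 1) F) W := by
  -- The innermost `d j` is moved outwards through the composition until it meets the power of `d
  -- j`, which occurs exactly once because the list has no duplicates.
  have key : ∀ l : List (Fin n), l.Nodup → j ∈ l →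
      EqOn (l.foldr (fun j G => (d j)^[α j] G) (d j F))
        (l.foldr (fun i G => (d i)^[(α + Pi.single j 1 : Fin n → ℕ) i] G) F) W := by
    intro l
    induction l with
    | nil => simp
    | cons i l ih =>
      intro hn hj
      rw [List.nodup_cons] at hn
      simp only [List.foldr_cons]
      by_cases hij : i = j
      · subst hij
        rw [foldr_update_of_notMem (α := α + Pi.single i 1) (α' := α) l (fun k hk => by
          have : k ≠ i := fun e => hn.1 (e ▸ hk)
          simp [this])]
        have hc := (CommOps.foldr hd (h i) α l).1 W F hW hF
        have h2 := ((hd i).iterate (α i)).congr W _ _ hW hc.symm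
        refine h2.trans ?_
        rw [Pi.add_apply, Pi.single_eq_same, Function.iterate_succ_apply]
        exact eqOn_refl _ _
      · have hj' : j ∈ l := by simpa [Ne.symm hij] using hj
        have h2 := ((hd i).iterate (α i)).congr W _ _ hW (ih hn.2 hj')
        refine h2.trans ?_
        rw [Pi.add_apply, Pi.single_eq_of_ne hij, add_zero]
        exact eqOn_refl _ _
  exact key _ (List.nodup_finRange n) (List.mem_finRange j)

lemma mixed_dzbar (α β : Fin n → ℕ) (j : Fin n) {W : Set (Coord n)} {F : Coord n → ℂ}
    (hW : IsOpen W) (hF : ContDiffOn ℝ ∞ F W) :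
    EqOn (mixed α β (dzbar j F)) (mixed α (β + Pi.single j 1) F) W :=
  (LocalOp.multi localOp_dz α).congr W _ _ hW
    (multi_add_single localOp_dzbar (fun i j => by
      rw [dzbar_eq, dzbar_eq]; exact commOps_combDeriv _ _ _ _ _ _ _ _) β j hW hF)

lemma mixed_dz (α β : Fin n → ℕ) (j : Fin n) {W : Set (Coord n)} {F : Coord n → ℂ}
    (hW : IsOpen W) (hF : ContDiffOn ℝ ∞ F W) :
    EqOn (mixed α β (dz j F)) (mixed (α + Pi.single j 1) β F) W := by
  have h1 : CommOps (dz j) (multi (n := n) dzbar β) := CommOps.multi localOp_dzbar (fun i => by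
    rw [dzbar_eq, dz_eq]; exact commOps_combDeriv _ _ _ _ _ _ _ _) β
  have h2 := (LocalOp.multi localOp_dz α).congr W _ _ hW (h1 W F hW hF).symm
  exact h2.trans (multi_add_single localOp_dz (fun i j => by
      rw [dz_eq, dz_eq]; exact commOps_combDeriv _ _ _ _ _ _ _ _) α j hW
        ((LocalOp.multi localOp_dzbar β).smooth W F hW hF))

lemma commOps_combDeriv_mixed (a b : ℂ) (v w : Coord n) (α β : Fin n → ℕ) :
    CommOps (combDeriv a b v w) (mixed α β) := by
  refine CommOps.comp (Q := multi dz α) (R := multi dzbar β)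
    (LocalOp.multi localOp_dz α) (LocalOp.multi localOp_dzbar β)
    (CommOps.multi localOp_dz (fun j => ?_) α) (CommOps.multi localOp_dzbar (fun j => ?_) β)
  · rw [dz_eq]; exact commOps_combDeriv _ _ _ _ _ _ _ _
  · rw [dzbar_eq]; exact commOps_combDeriv _ _ _ _ _ _ _ _

/-! ### Holomorphy in `ζ` as a differential equation -/

lemma fderiv_snd_apply {F : Coord n → ℂ} {p : Coord n} (hF : DifferentiableAt ℝ F p)
    (η : CnDual n) : fderiv ℝ (fun ζ : CnDual n => F (p.1, ζ)) p.2 η = fderiv ℝ F p (0, η) := by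
  have h1 : HasFDerivAt (fun ζ : CnDual n => (p.1, ζ))
      (ContinuousLinearMap.inr ℝ (Cn n) (CnDual n)) p.2 := hasFDerivAt_prodMk_right p.1 p.2
  have h2 : HasFDerivAt F (fderiv ℝ F p) (p.1, p.2) := hF.hasFDerivAt
  have h3 : fderiv ℝ (fun ζ : CnDual n => F (p.1, ζ)) p.2 = _ := (h2.comp p.2 h1).fderiv
  rw [h3]
  simp

/-- As a system of equations with constant coefficients, holomorphy in `ζ` passes to everything that
commutes with such operators: derivatives here, Cauchy transforms later. -/
lemma smoothHolo_iff {W : Set (Coord n)} (hW : IsOpen W) {F : Coord n → ℂ} :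
    SmoothHolo W F ↔ ContDiffOn ℝ ∞ F W ∧ ∀ η : CnDual n,
      EqOn (combDeriv 1 (-Complex.I) (0, Complex.I • η) (0, η) F) 0 W := by
  constructor
  · rintro ⟨hs, hh⟩
    refine ⟨hs, fun η p hp => ?_⟩
    have hd : DifferentiableAt ℝ F p :=
      (hs.contDiffAt (hW.mem_nhds hp)).differentiableAt (by simp)
    have h1 := (hh p hp).fderiv_restrictScalars ℝ
    rw [combDeriv, ← fderiv_snd_apply hd, ← fderiv_snd_apply hd, h1]
    simp
  · rintro ⟨hs, hh⟩
    refine ⟨hs, fun p hp => ?_⟩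
    have hd : DifferentiableAt ℝ F p :=
      (hs.contDiffAt (hW.mem_nhds hp)).differentiableAt (by simp)
    refine differentiableAt_of_map_I_smul ?_ fun η => ?_
    · have hF : DifferentiableAt ℝ F (p.1, p.2) := hd
      exact hF.comp p.2 (by fun_prop : DifferentiableAt ℝ (fun ζ : CnDual n => (p.1, ζ)) p.2)
    · rw [fderiv_snd_apply hd, fderiv_snd_apply hd]
      have := hh η hp
      simp only [combDeriv, Pi.zero_apply] at this
      linear_combination this

lemma SmoothHolo.combDeriv {W : Set (Coord n)} (hW : IsOpen W) {F : Coord n → ℂ}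
    (hF : SmoothHolo W F) (a b : ℂ) (v w : Coord n) :
    SmoothHolo W (Symb.combDeriv a b v w F) := by
  rw [smoothHolo_iff hW] at hF ⊢
  have hl := localOp_combDeriv a b v w
  refine ⟨hl.smooth W F hW hF.1, fun η => ?_⟩
  refine (commOps_combDeriv _ _ _ _ _ _ _ _ W F hW hF.1).trans ?_
  exact (hl.congr W _ _ hW (hF.2 η)).trans (by rw [hl.zero]; exact eqOn_refl _ _)

lemma multi_induction {d : Fin n → (Coord n → ℂ) → (Coord n → ℂ)} {Q : (Coord n → ℂ) → Prop}
    (hd : ∀ j F, Q F → Q (d j F)) (α : Fin n → ℕ) {F : Coord n → ℂ} (hF : Q F) :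
    Q (multi d α F) := by
  unfold Symb.multi
  induction List.finRange n with
  | nil => exact hF
  | cons j l ih =>
    simp only [List.foldr_cons]
    induction α j with
    | zero => exact ih
    | succ k ihk =>
      rw [Function.iterate_succ_apply']
      exact hd j _ ihk

/-- A property that is preserved by all `combDeriv a b v w` is preserved by `mixed α β`. -/
lemma mixed_induction {Q : (Coord n → ℂ) → Prop}
    (hd : ∀ a b v w F, Q F → Q (combDeriv a b v w F)) (α β : Fin n → ℕ) {F : Coord n → ℂ}
    (hF : Q F) : Q (mixed α β F) :=
  multi_induction (fun j F h => by rw [dz_eq]; exact hd _ _ _ _ F h) α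
    (multi_induction (fun j F h => by rw [dzbar_eq]; exact hd _ _ _ _ F h) β hF)

lemma SmoothHolo.mixed {W : Set (Coord n)} (hW : IsOpen W) {F : Coord n → ℂ}
    (hF : SmoothHolo W F) (α β : Fin n → ℕ) : SmoothHolo W (Symb.mixed α β F) :=
  mixed_induction (fun _ _ _ _ _ h => h.combDeriv hW _ _ _ _) α β hF

/-! ### Cauchy's estimates at infinity -/

lemma dirDeriv_eq_deriv_line {F : Coord n → ℂ} {x v : Coord n} (hF : DifferentiableAt ℝ F x)
    (hd : DifferentiableAt ℂ (fun s : ℂ => F (x + s • v)) 0) :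
    dirDeriv v F x = deriv (fun s : ℂ => F (x + s • v)) 0 := by
  have hl : HasDerivAt (fun s : ℝ => x + (s : ℂ) • v) v 0 := by
    have := ((hasDerivAt_id (0 : ℝ)).smul_const v).const_add x
    rw [one_smul] at this
    exact this
  have hF' : HasFDerivAt F (fderiv ℝ F x) (x + ((0 : ℝ) : ℂ) • v) := by
    have h0 : ((0 : ℝ) : ℂ) • v = 0 := zero_smul ℂ v
    rw [h0, add_zero]
    exact hF.hasFDerivAt
  have h1 := hF'.comp_hasDerivAt 0 hl
  have h2 : HasDerivAt (fun s : ℂ => F (x + s • v)) (deriv (fun s : ℂ => F (x + s • v)) 0)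
    ((0 : ℝ) : ℂ) := by simpa using hd.hasDerivAt
  exact h1.unique h2.comp_ofReal

/-- Cauchy's estimate on discs of a fixed radius `ε`: there `exp (a|ζ|)` changes by a factor of at
most `exp (|a|ε)`, so the exponent `a` is kept, whatever its sign. Only holomorphy along the lines
in the direction `v` is used, so the lemma covers holomorphic functions as well as functions
holomorphic only in `ζ`. -/
lemma dirDeriv_isBigO {p : Coord n} {W : Set (Coord n)} (hW : IsOpen W) (hWp : W ∈ dirInf p)
    {F : Coord n → ℂ} (hF : DifferentiableOn ℝ F W) {v : Coord n}
    (hd : ∀ x ∈ W, DifferentiableAt ℂ (fun s : ℂ => F (x + s • v)) 0) {a : ℝ}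
    (H : F =O[dirInf p] fun x => Real.exp (a * ‖x.2‖)) :
    dirDeriv v F =O[dirInf p] fun x => Real.exp (a * ‖x.2‖) := by
  obtain ⟨C, hC, HC⟩ := H.exists_pos
  rw [IsBigOWith] at HC
  obtain ⟨ε, hε, hball⟩ := exists_closedBall_subset_dirInf (inter_mem hWp HC)
  refine IsBigO.of_bound (C * Real.exp (|a| * ε) / (ε / (‖v‖ + 1))) ?_
  filter_upwards [hball] with x hx
  have hxW : x ∈ W := (hx (Metric.mem_closedBall_self hε.le)).1
  have hdx : ∀ s : ℂ, ‖s‖ ≤ ε / (‖v‖ + 1) →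
      DifferentiableAt ℂ (fun s : ℂ => F (x + s • v)) s := by
    intro s hs
    have h1 := hd (x + s • v) (hx (add_smul_mem_closedBall hs)).1
    have h2 : DifferentiableAt ℂ (fun s : ℂ => F (x + s • v)) (s - s + s) := by
      have h3 : (fun s' : ℂ => F (x + s' • v)) =
          (fun s' : ℂ => F (x + s • v + s' • v)) ∘ (fun s' => s' - s) := by
        funext s'
        simp only [Function.comp_apply]
        congr 1
        module
      rw [h3]
      refine DifferentiableAt.comp _ ?_ (by fun_prop)
      simpa using h1
    simpa using h2
  rw [dirDeriv_eq_deriv_line (hF.differentiableAt (hW.mem_nhds hxW)) (hd x hxW)]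
  have hM : ∀ y ∈ Metric.closedBall x ε, ‖F y‖ ≤ C * Real.exp (|a| * ε) *
      Real.exp (a * ‖x.2‖) := by
    intro y hy
    have h1 : ‖F y‖ ≤ C * ‖Real.exp (a * ‖y.2‖)‖ := (hx hy).2
    rw [Real.norm_eq_abs, Real.abs_exp] at h1
    refine h1.trans ?_
    rw [mul_assoc, ← Real.exp_add]
    gcongr
    have h2 : |‖y.2‖ - ‖x.2‖| ≤ ε := by
      refine (abs_norm_sub_norm_le _ _).trans ?_
      rw [Metric.mem_closedBall, Prod.dist_eq, max_le_iff, dist_eq_norm y.2] at hy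
      exact hy.2
    have h3 : |a * (‖y.2‖ - ‖x.2‖)| ≤ |a| * ε := by
      rw [abs_mul]; gcongr
    have h4 := (abs_le.1 h3).2
    linarith
  refine (norm_deriv_line_le hε hdx hM).trans (le_of_eq ?_)
  rw [Real.norm_eq_abs, Real.abs_exp]
  ring

lemma SmoothHolo.differentiableAt_line {W : Set (Coord n)} {F : Coord n → ℂ}
    (hF : SmoothHolo W F) (η : CnDual n) {x : Coord n} (hx : x ∈ W) :
    DifferentiableAt ℂ (fun s : ℂ => F (x + s • (0, η))) 0 := by
  have h1 : DifferentiableAt ℂ (fun ζ : CnDual n => F (x.1, ζ)) (x.2 + (0 : ℂ) • η) := by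
    have h0 : (0 : ℂ) • η = 0 := zero_smul ℂ η
    rw [h0, add_zero]
    exact hF.2 x hx
  have h2 := h1.comp (0 : ℂ)
    (by fun_prop : DifferentiableAt ℂ (fun s : ℂ => x.2 + s • η) 0)
  refine h2.congr_of_eventuallyEq (Eventually.of_forall fun s => ?_)
  simp only [Function.comp_apply]
  congr 1
  refine Prod.ext ?_ rfl
  simp

end Symb

namespace Symb

open Filter Asymptotics

variable {n : ℕ} {p : Coord n} {F G : Coord n → ℂ}

lemma Dec.congr' {l : Filter (Coord n)} {E : Type*} [NormedAddCommGroup E] {F G : Coord n → E}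
    (hF : Dec l F) (h : F =ᶠ[l] G) : Dec l G :=
  hF.of_isBigO h.symm.isBigO

lemma multi_zero (d : Fin n → (Coord n → ℂ) → (Coord n → ℂ)) (F : Coord n → ℂ) :
    multi d 0 F = F := by
  unfold multi
  induction List.finRange n with
  | nil => rfl
  | cons j l ih => exact ih

lemma mixed_zero (F : Coord n → ℂ) : mixed 0 0 F = F := by
  rw [mixed, multi_zero, multi_zero]

lemma commOps_const_mul_combDeriv (c a b : ℂ) (v w : Coord n) :
    CommOps (fun F x => c * F x) (combDeriv a b v w) := by
  intro W F hW hF x hx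
  have hd : DifferentiableAt ℝ F x :=
    (hF.contDiffAt (hW.mem_nhds hx)).differentiableAt (by simp)
  have : fderiv ℝ (fun y => c * F y) x = c • fderiv ℝ F x := (hd.hasFDerivAt.const_mul c).fderiv
  simp only [combDeriv, this, smul_apply, smul_eq_mul]
  ring

lemma mixed_const_mul (c : ℂ) (α β : Fin n → ℕ) {W : Set (Coord n)} (hW : IsOpen W)
    (hF : ContDiffOn ℝ ∞ F W) :
    EqOn (mixed α β fun x => c * F x) (fun x => c * mixed α β F x) W := by
  refine EqOn.symm (CommOps.comp (P := fun F x => c * F x) (Q := multi dz α) (R := multi dzbar β)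
    (LocalOp.multi localOp_dz α) (LocalOp.multi localOp_dzbar β)
    (CommOps.multi localOp_dz (fun j => ?_) α) (CommOps.multi localOp_dzbar (fun j => ?_) β)
    W F hW hF)
  · rw [dz_eq]; exact commOps_const_mul_combDeriv _ _ _ _ _
  · rw [dzbar_eq]; exact commOps_const_mul_combDeriv _ _ _ _ _

/-! ### Null germs -/

lemma SmoothHoloGerm.add (hF : SmoothHoloGerm p F) (hG : SmoothHoloGerm p G) :
    SmoothHoloGerm p (F + G) := by
  obtain ⟨W₁, o₁, m₁, s₁⟩ := hF
  obtain ⟨W₂, o₂, m₂, s₂⟩ := hG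
  exact ⟨W₁ ∩ W₂, o₁.inter o₂, inter_mem m₁ m₂,
    (s₁.mono inter_subset_left).add (s₂.mono inter_subset_right)⟩

lemma SmoothHoloGerm.combDeriv (hF : SmoothHoloGerm p F) (a b : ℂ) (v w : Coord n) :
    SmoothHoloGerm p (combDeriv a b v w F) := by
  obtain ⟨W, o, m, s⟩ := hF
  exact ⟨W, o, m, s.combDeriv o _ _ _ _⟩

lemma NullGerm.add (hF : NullGerm p F) (hG : NullGerm p G) : NullGerm p (F + G) := by
  refine ⟨hF.1.add hG.1, fun α β => ((hF.2 α β).add (hG.2 α β)).congr' ?_⟩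
  obtain ⟨W₁, o₁, m₁, s₁⟩ := hF.1
  obtain ⟨W₂, o₂, m₂, s₂⟩ := hG.1
  filter_upwards [inter_mem m₁ m₂] with x hx
  exact ((localOp_mixed α β).add (W₁ ∩ W₂) F G (o₁.inter o₂) (s₁.1.mono inter_subset_left)
    (s₂.1.mono inter_subset_right) hx).symm

lemma NullGerm.neg (hF : NullGerm p F) : NullGerm p (-F) := by
  obtain ⟨⟨W, o, m, s⟩, h⟩ := hF
  refine ⟨⟨W, o, m, s.neg⟩, fun α β => (h α β).of_isBigO ?_⟩
  rw [(localOp_mixed α β).neg]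
  exact (isBigO_refl _ _).neg_left

lemma NullGerm.const_mul (c : ℂ) (hF : NullGerm p F) : NullGerm p (fun x => c * F x) := by
  obtain ⟨⟨W, o, m, s⟩, h⟩ := hF
  refine ⟨⟨W, o, m, contDiffOn_const.mul s.1, fun q hq => (s.2 q hq).const_mul c⟩,
    fun α β => ((h α β).of_isBigO ((isBigO_refl _ _).const_mul_left c)).congr' ?_⟩
  filter_upwards [m] with x hx
  exact (mixed_const_mul c α β o s.1 hx).symm

lemma nullGerm_zero (p : Coord n) : NullGerm p 0 := by
  refine ⟨⟨univ, isOpen_univ, univ_mem, contDiffOn_const, fun q _ => differentiableAt_const 0⟩,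
    fun α β => ?_⟩
  rw [(localOp_mixed α β).zero]
  exact dec_zero

lemma NullGerm.sum {ι : Type*} (s : Finset ι) {f : ι → Coord n → ℂ}
    (h : ∀ i ∈ s, NullGerm p (f i)) : NullGerm p (∑ i ∈ s, f i) :=
  Finset.sum_induction f (NullGerm p) (fun _ _ => NullGerm.add) (nullGerm_zero p) h

lemma NullGerm.dzbar (hF : NullGerm p F) (j : Fin n) : NullGerm p (dzbar j F) := by
  refine ⟨by rw [dzbar_eq]; exact hF.1.combDeriv _ _ _ _, fun α β => ?_⟩
  obtain ⟨W, o, m, s⟩ := hF.1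
  refine (hF.2 α (β + Pi.single j 1)).congr' ?_
  filter_upwards [m] with x hx
  exact (mixed_dzbar α β j o s.1 hx).symm

lemma NullGerm.dz (hF : NullGerm p F) (j : Fin n) : NullGerm p (dz j F) := by
  refine ⟨by rw [dz_eq]; exact hF.1.combDeriv _ _ _ _, fun α β => ?_⟩
  obtain ⟨W, o, m, s⟩ := hF.1
  refine (hF.2 (α + Pi.single j 1) β).congr' ?_
  filter_upwards [m] with x hx
  exact (mixed_dz α β j o s.1 hx).symm

/-- The definition of a null germ controls derivatives in `z` and `z̄` only. Those in `ζ` come from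
Cauchy's estimate, applied to `mixed α β F`, which is still holomorphic in `ζ`. -/
lemma NullGerm.dirDeriv_snd (hF : NullGerm p F) (η : CnDual n) :
    NullGerm p (dirDeriv (0, η) F) := by
  refine ⟨by rw [dirDeriv_eq]; exact hF.1.combDeriv _ _ _ _, fun α β => ?_⟩
  obtain ⟨W, o, m, s⟩ := hF.1
  obtain ⟨h, hh, H⟩ := hF.2 α β
  have sm := s.mixed o α β
  have := dirDeriv_isBigO (v := (0, η)) o m (sm.1.differentiableOn (by simp))
    (fun x hx => sm.differentiableAt_line η hx) H
  refine Dec.congr' ⟨h, hh, this⟩ ?_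
  filter_upwards [m] with x hx
  rw [dirDeriv_eq]
  exact commOps_combDeriv_mixed _ _ _ _ α β W F o s.1 hx

/-- Wirtinger's decomposition. It reduces stability under all real directional derivatives to
stability under `dz`, `dzbar` and the derivatives along the fibres. -/
lemma dirDeriv_eq_sum (a : Cn n) (η : CnDual n) (F : Coord n → ℂ) :
    dirDeriv (a, η) F = (∑ j, ((fun x => a j * dz j F x) +
      fun x => (starRingEnd ℂ) (a j) * dzbar j F x)) + dirDeriv (0, η) F := by
  funext x
  have ha : ((a, η) : Coord n) = ∑ j, ((a j).re • ((EuclideanSpace.single j 1, 0) : Coord n) +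
      (a j).im • ((EuclideanSpace.single j Complex.I, 0) : Coord n)) + (0, η) := by
    refine Prod.ext ?_ ?_
    · ext i
      simp only [Prod.fst_add, Prod.fst_sum, Prod.smul_mk, add_zero, PiLp.add_apply,
        WithLp.ofLp_sum, Finset.sum_apply, PiLp.smul_apply]
      rw [Finset.sum_eq_single i]
      · simp
      · intro b _ hb
        simp [Ne.symm hb]
      · simp
    · have hz : ∀ r : ℝ, r • (0 : CnDual n) = 0 := fun r => by ext; simp
      rw [Prod.snd_add, Prod.snd_sum, Finset.sum_eq_zero, zero_add]
      exact fun j _ => (congrArg₂ (· + ·) (hz _) (hz _)).trans (add_zero _)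
  simp only [dirDeriv, Pi.add_apply, Finset.sum_apply]
  conv_lhs => rw [ha, map_add, map_sum]
  congr 1
  refine Finset.sum_congr rfl fun j _ => ?_
  rw [map_add, map_smul, map_smul, dz, dzbar]
  have hI := Complex.I_sq
  conv_rhs => rw [← Complex.re_add_im (a j)]
  simp only [Complex.real_smul, map_add, map_mul, Complex.conj_ofReal, Complex.conj_I]
  linear_combination (((a j).im : ℂ) * fderiv ℝ F x (EuclideanSpace.single j Complex.I, 0)) * hI

lemma NullGerm.dirDeriv (hF : NullGerm p F) (v : Coord n) : NullGerm p (dirDeriv v F) := by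
  obtain ⟨a, η⟩ := v
  rw [dirDeriv_eq_sum]
  exact (NullGerm.sum _ fun j _ => ((hF.dz j).const_mul _).add ((hF.dzbar j).const_mul _)).add
    (hF.dirDeriv_snd η)

/-! ### Decay of all derivatives -/

/-- All derivatives of `F` decay exponentially in the direction `p`. -/
def AllDec {E : Type*} [NormedAddCommGroup E] [NormedSpace ℝ E] (l : Filter (Coord n))
    (F : Coord n → E) : Prop :=
  ∀ k : ℕ, Dec l (fun x => ‖iteratedFDeriv ℝ k F x‖)

lemma norm_iteratedFDeriv_nonneg {E : Type*} [NormedAddCommGroup E] [NormedSpace ℝ E] (F : E → ℂ)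
    (k : ℕ) (x : E) : 0 ≤ ‖iteratedFDeriv ℝ k F x‖ := norm_nonneg _

/-- Expanding `fderiv` in a basis lowers the order by one at the cost of finitely many directional
derivatives. The directions and constants do not depend on `F`, which permits induction on the
order. -/
lemma exists_norm_iteratedFDeriv_succ_le (E : Type*) [NormedAddCommGroup E] [NormedSpace ℝ E]
    [FiniteDimensional ℝ E] (k : ℕ) :
    ∃ (ι : Type) (_ : Fintype ι) (b : ι → E) (c : ι → ℝ),
      ∀ (W : Set E) (F : E → ℂ), IsOpen W → ContDiffOn ℝ ∞ F W → ∀ x ∈ W,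
        ‖iteratedFDeriv ℝ (k + 1) F x‖ ≤
          ∑ i, c i * ‖iteratedFDeriv ℝ k (fun y => fderiv ℝ F y (b i)) x‖ := by
  let b := Module.finBasis ℝ E
  let L := fun i => ContinuousLinearMap.smulRightL ℝ E ℂ
      (LinearMap.toContinuousLinearMap (b.coord i))
  refine ⟨_, inferInstance, b, fun i => ‖L i‖, fun W F hW hF x hx => ?_⟩
  have hs : ∀ i, ContDiffAt ℝ ∞ (fun y => fderiv ℝ F y (b i)) x := fun i =>
    ((hF.fderiv_of_isOpen hW (by simp)).clm_apply contDiffOn_const).contDiffAt (hW.mem_nhds hx)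
  have hk : (k : ℕ∞ω) ≤ ∞ := by exact_mod_cast le_top
  have e : fderiv ℝ F = ∑ i, (L i ∘ fun y => fderiv ℝ F y (b i)) := by
    refine (fderiv_eq_sum_basis b F).trans ?_
    funext y
    simp [L]
  rw [← norm_iteratedFDeriv_fderiv]
  conv_lhs => rw [e]
  rw [iteratedFDeriv_sum_apply fun i _ =>
    (((L i).contDiff.contDiffAt (n := ∞)).comp x (hs i)).of_le hk]
  refine (norm_sum_le _ _).trans (Finset.sum_le_sum fun i _ => ?_)
  exact (L i).norm_iteratedFDeriv_comp_left (hs i) hk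

lemma exists_norm_iteratedFDeriv_comb_le {E : Type*} [NormedAddCommGroup E] [NormedSpace ℝ E]
    (a b : ℂ) (v w : E) :
    ∃ c : ℝ, ∀ (k : ℕ) (W : Set E) (F : E → ℂ), IsOpen W → ContDiffOn ℝ ∞ F W →
      ∀ x ∈ W, ‖iteratedFDeriv ℝ k (fun y => a * fderiv ℝ F y v + b * fderiv ℝ F y w) x‖ ≤
        c * ‖iteratedFDeriv ℝ (k + 1) F x‖ := by
  let L : (E →L[ℝ] ℂ) →L[ℝ] ℂ :=
    (ContinuousLinearMap.mul ℝ ℂ a).comp (ContinuousLinearMap.apply ℝ ℂ v) +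
      (ContinuousLinearMap.mul ℝ ℂ b).comp (ContinuousLinearMap.apply ℝ ℂ w)
  refine ⟨‖L‖, fun k W F hW hF x hx => ?_⟩
  have hk : (k : ℕ∞ω) ≤ ∞ := by exact_mod_cast le_top
  rw [← norm_iteratedFDeriv_fderiv]
  exact L.norm_iteratedFDeriv_comp_left ((hF.fderiv_of_isOpen hW (m := ∞)
    (by simp)).contDiffAt (hW.mem_nhds hx)) hk

/-- Induction on the order, for all null germs at once, because they are stable under every
directional derivative. -/
lemma NullGerm.allDec (hF : NullGerm p F) : AllDec (dirInf p) F := by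
  intro k
  induction k generalizing F with
  | zero =>
    have h0 := hF.2 0 0
    rw [mixed_zero] at h0
    simpa only [norm_iteratedFDeriv_zero] using h0.of_isBigO (isBigO_refl F _).norm_left
  | succ k ih =>
    obtain ⟨ι, hι, b, c, H⟩ := exists_norm_iteratedFDeriv_succ_le (Coord n) k
    obtain ⟨W, o, m, s⟩ := hF.1
    have hsum := Dec.sum Finset.univ (F := fun i x => c i *
      ‖iteratedFDeriv ℝ k (Symb.dirDeriv (b i) F) x‖) fun i _ =>
        (ih (hF.dirDeriv (b i))).of_isBigO ((isBigO_refl _ _).const_mul_left _)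
    refine hsum.of_isBigO (IsBigO.of_bound 1 ?_)
    filter_upwards [m] with x hx
    rw [one_mul]
    exact (Real.norm_of_nonneg (norm_iteratedFDeriv_nonneg _ _ _)).le.trans
      ((H W F o s.1 x hx).trans (le_abs_self _))

lemma norm_le_mul_norm_of_nonneg {a b c : ℝ} (ha : 0 ≤ a) (hb : 0 ≤ b) (h : a ≤ c * b) :
    ‖a‖ ≤ c * ‖b‖ := by
  rwa [Real.norm_of_nonneg ha, Real.norm_of_nonneg hb]

/-- The decay of all real derivatives no longer singles out the operators `∂/∂z_j` and `∂/∂z̄_j` of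
one coordinate system, and is the form that the chain rule can transport. -/
lemma nullGerm_iff : NullGerm p F ↔ SmoothHoloGerm p F ∧ AllDec (dirInf p) F := by
  refine ⟨fun h => ⟨h.1, h.allDec⟩, fun h => ⟨h.1, fun α β => ?_⟩⟩
  have key : SmoothHoloGerm p (mixed α β F) ∧ AllDec (dirInf p) (mixed α β F) := by
    refine mixed_induction (Q := fun F => SmoothHoloGerm p F ∧ AllDec (dirInf p) F)
      (fun a b v w F hF => ⟨hF.1.combDeriv _ _ _ _, fun k => ?_⟩) α β h
    obtain ⟨c, hc⟩ := exists_norm_iteratedFDeriv_comb_le a b v w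
    obtain ⟨W, o, m, s⟩ := hF.1
    refine (hF.2 (k + 1)).of_isBigO (IsBigO.of_bound c ?_)
    filter_upwards [m] with x hx
    exact norm_le_mul_norm_of_nonneg (norm_iteratedFDeriv_nonneg _ _ _)
      (norm_iteratedFDeriv_nonneg _ _ _) (hc k W F o s.1 x hx)
  have h0 := key.2 0
  simp only [norm_iteratedFDeriv_zero] at h0
  exact h0.of_isBigO (isBigO_refl _ _).norm_right

/-! ### Holomorphic germs -/

lemma differentiableOn_combDeriv {W : Set (Coord n)} (hW : IsOpen W)
    (hF : DifferentiableOn ℂ F W) (a b : ℂ) (v w : Coord n) :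
    DifferentiableOn ℂ (combDeriv a b v w F) W := by
  have h : ∀ v : Coord n, DifferentiableOn ℂ (fun x => fderiv ℝ F x v) W := fun v => by
    refine (differentiableOn_fderiv_apply hW hF v).congr fun x hx => ?_
    rw [(hF.differentiableAt (hW.mem_nhds hx)).fderiv_restrictScalars ℝ]
    rfl
  exact ((h v).const_mul a).add ((h w).const_mul b)

lemma smoothHolo_of_differentiableOn {W : Set (Coord n)} (hW : IsOpen W)
    (hF : DifferentiableOn ℂ F W) : SmoothHolo W F := by
  refine ⟨(contDiffOn_of_differentiableOn hW hF).restrict_scalars ℝ, fun x hx => ?_⟩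
  have h : DifferentiableAt ℂ F (x.1, x.2) := hF.differentiableAt (hW.mem_nhds hx)
  exact h.comp x.2 (by fun_prop : DifferentiableAt ℂ (fun ζ : CnDual n => (x.1, ζ)) x.2)

lemma HolGerm.smoothHoloGerm (hF : HolGerm p F) : SmoothHoloGerm p F := by
  obtain ⟨W, o, m, h⟩ := hF
  exact ⟨W, o, m, smoothHolo_of_differentiableOn o h⟩

lemma HolGerm.combDeriv (hF : HolGerm p F) (a b : ℂ) (v w : Coord n) :
    HolGerm p (combDeriv a b v w F) := by
  obtain ⟨W, o, m, h⟩ := hF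
  exact ⟨W, o, m, differentiableOn_combDeriv o h a b v w⟩

/-- The exponent `c` may have either sign, so that growth and decay are treated together. -/
lemma HolGerm.combDeriv_isBigO (hF : HolGerm p F) {c : ℝ}
    (H : F =O[dirInf p] fun x => Real.exp (c * ‖x.2‖)) (a b : ℂ) (v w : Coord n) :
    Symb.combDeriv a b v w F =O[dirInf p] fun x => Real.exp (c * ‖x.2‖) := by
  obtain ⟨W, o, m, h⟩ := hF
  have key : ∀ v, Symb.dirDeriv v F =O[dirInf p] fun x => Real.exp (c * ‖x.2‖) := fun v =>
    dirDeriv_isBigO o m (h.restrictScalars ℝ) (fun x hx =>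
      (differentiableOn_line o h x v).differentiableAt
      ((o.preimage (by fun_prop : Continuous fun s : ℂ => x + s • v)).mem_nhds (by
        have h0 : (0 : ℂ) • v = 0 := zero_smul ℂ v
        rw [mem_preimage, h0, add_zero]
        exact hx))) H
  exact ((key v).const_mul_left a).add ((key w).const_mul_left b)

lemma HolGerm.mixed_isBigO (hF : HolGerm p F) {c : ℝ}
    (H : F =O[dirInf p] fun x => Real.exp (c * ‖x.2‖)) (α β : Fin n → ℕ) :
    mixed α β F =O[dirInf p] fun x => Real.exp (c * ‖x.2‖) :=
  (mixed_induction (Q := fun F => HolGerm p F ∧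
    F =O[dirInf p] fun x => Real.exp (c * ‖x.2‖)) (fun a b v w _ h =>
      ⟨h.1.combDeriv a b v w, h.1.combDeriv_isBigO h.2 a b v w⟩) α β ⟨hF, H⟩).2

/-- Cauchy's estimates do not lose the rate, so one rate serves all `α`, `β`. -/
lemma HolGerm.nullGerm (hF : HolGerm p F) (h : Dec (dirInf p) F) : NullGerm p F := by
  obtain ⟨c, hc, H⟩ := h
  exact ⟨hF.smoothHoloGerm, fun α β => ⟨c, hc, hF.mixed_isBigO H α β⟩⟩

lemma dzbar_eq_zero {W : Set (Coord n)} (hW : IsOpen W) (hF : DifferentiableOn ℂ F W)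
    (j : Fin n) : EqOn (dzbar j F) 0 W := by
  intro x hx
  have e : ((EuclideanSpace.single j Complex.I, 0) : Coord n) =
      Complex.I • (EuclideanSpace.single j 1, 0) := by
    refine Prod.ext ?_ (by ext; simp : (0 : CnDual n) = Complex.I • (0 : CnDual n))
    ext i
    by_cases h : i = j <;> simp [h]
  rw [dzbar, (hF.differentiableAt (hW.mem_nhds hx)).fderiv_restrictScalars ℝ, e]
  have hI := Complex.I_sq
  simp only [ContinuousLinearMap.coe_restrictScalars', map_smul, smul_eq_mul, Pi.zero_apply]
  linear_combination (1 / 2 * fderiv ℂ F x (EuclideanSpace.single j 1, 0)) * hI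

lemma HolGerm.nullGerm_dzbar (hF : HolGerm p F) (j : Fin n) : NullGerm p (Symb.dzbar j F) := by
  refine HolGerm.nullGerm (by rw [dzbar_eq]; exact hF.combDeriv _ _ _ _) ?_
  obtain ⟨W, o, m, h⟩ := hF
  refine (dec_zero (E := ℂ)).congr' ?_
  filter_upwards [m] with x hx
  exact (dzbar_eq_zero o h j hx).symm

/-! ### Comparison of the two kinds of symbols in one chart. -/

section Inclusions

variable {V : Set (Coord n)} (ho : IsOpen V) (hc : IsCone V) (hV : ∀ p ∈ V, p.2 ≠ 0)

include ho hc hV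

lemma IsSymbol.isSymbolInf (h : IsSymbol V F) : IsSymbolInf V F := by
  rw [isSymbol_iff ho hc hV] at h
  exact (isSymbolInf_iff ho hc hV).2 fun p hp => ⟨(h p hp).1.smoothHoloGerm,
    fun α β c hc => (h p hp).1.mixed_isBigO ((h p hp).2 c hc) α β,
    fun j => (h p hp).1.nullGerm_dzbar j⟩

lemma IsNull.isNullInf (h : IsNull V F) : IsNullInf V F := by
  rw [isNull_iff ho hc hV] at h
  exact (isNullInf_iff ho hc hV).2 fun p hp => (h p hp).1.nullGerm (h p hp).2

/-- Only the estimate with `α = β = 0` is used; this is the injectivity of `ι`. -/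
lemma IsSymbol.isNull_of_isNullInf (h : IsSymbol V F) (h' : IsNullInf V F) : IsNull V F := by
  rw [isSymbol_iff ho hc hV] at h
  rw [isNullInf_iff ho hc hV] at h'
  refine (isNull_iff ho hc hV).2 fun p hp => ⟨(h p hp).1, ?_⟩
  have := (h' p hp).2 0 0
  rwa [mixed_zero] at this

end Inclusions

end Symb

namespace Symb

open Filter Asymptotics

variable {n : ℕ}

/-! ### Bounds for derivatives of composite functions -/

section Abstract

variable {E E' : Type*} [NormedAddCommGroup E] [NormedSpace ℝ E] [NormedAddCommGroup E']
  [NormedSpace ℝ E']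

/-- The Faà di Bruno estimate, for functions that are smooth only on open sets. -/
lemma norm_iteratedFDeriv_comp_le_of_isOpen {g : E' → ℂ} {f : E → E'} {s : Set E} {t : Set E'}
    (hs : IsOpen s) (ht : IsOpen t) (hg : ContDiffOn ℝ ∞ g t) (hf : ContDiffOn ℝ ∞ f s) {x : E}
    (hx : x ∈ s) (hfx : f x ∈ t) {k : ℕ} {C D : ℝ}
    (hC : ∀ i ≤ k, ‖iteratedFDeriv ℝ i g (f x)‖ ≤ C)
    (hD : ∀ i, 1 ≤ i → i ≤ k → ‖iteratedFDeriv ℝ i f x‖ ≤ D ^ i) :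
    ‖iteratedFDeriv ℝ k (g ∘ f) x‖ ≤ k.factorial * C * D ^ k := by
  have ho : IsOpen (s ∩ f ⁻¹' t) := hf.continuousOn.isOpen_inter_preimage hs ht
  have hxo : x ∈ s ∩ f ⁻¹' t := ⟨hx, hfx⟩
  rw [← iteratedFDerivWithin_of_isOpen k ho hxo]
  refine norm_iteratedFDerivWithin_comp_le hg (hf.mono inter_subset_left)
    (by exact_mod_cast le_top) ht.uniqueDiffOn ho.uniqueDiffOn (fun y hy => hy.2) hxo
    (fun i hi => ?_) fun i h1 hi => ?_
  · rw [iteratedFDerivWithin_of_isOpen i ht hfx]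
    exact hC i hi
  · rw [iteratedFDerivWithin_of_isOpen i ho hxo]
    exact hD i h1 hi

/-- Meant for maps that commute with dilations, with `A = dilCLM t` and `B = dilCLM t⁻¹`: the
derivatives at a far point are controlled by those at a point of a bounded region. -/
lemma norm_iteratedFDeriv_le_of_conj {f : E → E'} {s : Set E} (hs : IsOpen s)
    (hf : ContDiffOn ℝ ∞ f s) (A : E' →L[ℝ] E') (B : E →L[ℝ] E) (hAB : f = A ∘ (f ∘ B)) {x : E}
    (hx : B x ∈ s) (k : ℕ) :
    ‖iteratedFDeriv ℝ k f x‖ ≤ ‖A‖ * (‖iteratedFDeriv ℝ k f (B x)‖ * ‖B‖ ^ k) := by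
  have hk : (k : ℕ∞ω) ≤ ∞ := by exact_mod_cast le_top
  have ho : IsOpen (B ⁻¹' s) := hs.preimage B.continuous
  have hcomp : ContDiffAt ℝ ∞ (f ∘ B) x :=
    (hf.contDiffAt (hs.mem_nhds hx)).comp x B.contDiff.contDiffAt
  conv_lhs => rw [hAB]
  refine (A.norm_iteratedFDeriv_comp_left hcomp hk).trans ?_
  gcongr
  rw [← iteratedFDerivWithin_of_isOpen k ho hx,
    B.iteratedFDerivWithin_comp_right hf hs.uniqueDiffOn ho.uniqueDiffOn hx hk,
    iteratedFDerivWithin_of_isOpen k hs hx]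
  refine (ContinuousMultilinearMap.norm_compContinuousLinearMap_le _ _).trans ?_
  simp

lemma exists_iteratedFDeriv_bound {f : E → E'} {s : Set E} (hs : IsOpen s)
    (hf : ContDiffOn ℝ ∞ f s) {x : E} (hx : x ∈ s) (k : ℕ) :
    ∃ M : ℝ, 0 ≤ M ∧ ∀ᶠ y in 𝓝 x, ∀ i ≤ k, ‖iteratedFDeriv ℝ i f y‖ ≤ M := by
  have h : ∀ i : ℕ, ∃ M : ℝ, 0 ≤ M ∧ ∀ᶠ y in 𝓝 x, ‖iteratedFDeriv ℝ i f y‖ ≤ M := by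
    intro i
    have hc : ContinuousAt (fun y => ‖iteratedFDeriv ℝ i f y‖) x := by
      have h1 : ContinuousOn (iteratedFDerivWithin ℝ i f s) s :=
        hf.continuousOn_iteratedFDerivWithin (by exact_mod_cast le_top) hs.uniqueDiffOn
      have h2 : ContinuousOn (iteratedFDeriv ℝ i f) s :=
        h1.congr fun y hy => (iteratedFDerivWithin_of_isOpen i hs hy).symm
      exact (h2.continuousAt (hs.mem_nhds hx)).norm
    refine ⟨‖iteratedFDeriv ℝ i f x‖ + 1, by positivity, ?_⟩
    exact (hc.eventually_lt continuousAt_const (lt_add_one _)).mono fun y hy => hy.le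
  choose M hM H using h
  refine ⟨∑ i ∈ Finset.range (k + 1), M i, Finset.sum_nonneg fun i _ => hM i, ?_⟩
  have := (Finset.eventually_all (Finset.range (k + 1))).2 fun i _ => H i
  filter_upwards [this] with y hy i hi
  have hi' : i ∈ Finset.range (k + 1) := Finset.mem_range.2 (by omega)
  exact (hy i hi').trans (Finset.single_le_sum (f := M) (fun j _ => hM j) hi')

lemma norm_iteratedFDeriv_mul_le_of_isOpen {f g : E → ℂ} {s : Set E} (hs : IsOpen s)
    (hf : ContDiffOn ℝ ∞ f s) (hg : ContDiffOn ℝ ∞ g s) {x : E} (hx : x ∈ s) (k : ℕ) :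
    ‖iteratedFDeriv ℝ k (fun y => f y * g y) x‖ ≤ ∑ i ∈ Finset.range (k + 1),
      (k.choose i : ℝ) * ‖iteratedFDeriv ℝ i f x‖ * ‖iteratedFDeriv ℝ (k - i) g x‖ := by
  have := norm_iteratedFDerivWithin_mul_le hf hg hs.uniqueDiffOn hx
    (n := k) (by exact_mod_cast le_top)
  simpa only [iteratedFDerivWithin_of_isOpen _ hs hx] using this

end Abstract

lemma Infra.mul {l : Filter (Coord n)} {F G : Coord n → ℝ} (hF : Infra l F) (hG : Infra l G) :
    Infra l (fun x => F x * G x) := by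
  intro h hh
  refine ((hF (h / 2) (by positivity)).mul (hG (h / 2) (by positivity))).congr_right fun x => ?_
  rw [← Real.exp_add]
  ring_nf

lemma infra_one_add_mul_norm (l : Filter (Coord n)) {M : ℝ} (hM : 0 ≤ M) :
    Infra l (fun x : Coord n => 1 + M * ‖x.2‖) := by
  intro h hh
  -- The constant makes `1 + M r` at most a multiple of `1 + h r`, which is bounded by `exp (h r)`.
  refine IsBigO.of_bound (max 1 (M / h)) (Eventually.of_forall fun x => ?_)
  rw [Real.norm_of_nonneg (by positivity), Real.norm_of_nonneg (by positivity)]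
  have h1 := Real.add_one_le_exp (h * ‖x.2‖)
  have h2 : M * ‖x.2‖ ≤ max 1 (M / h) * (h * ‖x.2‖) := by
    rw [← mul_assoc]
    gcongr
    calc M = M / h * h := by field_simp
      _ ≤ _ := by gcongr; exact le_max_right _ _
  have h3 : (1 : ℝ) ≤ max 1 (M / h) := le_max_left _ _
  calc 1 + M * ‖x.2‖ ≤ max 1 (M / h) * (h * ‖x.2‖ + 1) := by linarith
    _ ≤ _ := by gcongr

lemma infra_pow {l : Filter (Coord n)} {F : Coord n → ℝ} (hF : Infra l F) (k : ℕ) :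
    Infra l (fun x => F x ^ k) := by
  induction k with
  | zero => simpa using infra_one_add_mul_norm l le_rfl
  | succ k ih =>
    simp only [pow_succ]
    exact ih.mul hF

/-! ### Changes of canonical coordinates -/

/-- The map `(z; ζ) ↦ (φ(z); ζ ∘ B(z))`. -/
def cotMap (φ : Cn n → Cn n) (B : Cn n → (Cn n →L[ℂ] Cn n)) (q : Coord n) : Coord n :=
  (φ q.1, q.2.comp (B q.1))

/-- The fibre dilation as a linear map. -/
def dilCLM (t : ℝ) : Coord n →L[ℝ] Coord n :=
  (ContinuousLinearMap.fst ℝ (Cn n) (CnDual n)).prod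
    (t • ContinuousLinearMap.snd ℝ (Cn n) (CnDual n))

lemma dilCLM_apply (t : ℝ) (q : Coord n) : dilCLM t q = dil t q := rfl

lemma norm_dilCLM_le {t C : ℝ} (hC : 1 ≤ C) (ht : |t| ≤ C) :
    ‖(dilCLM t : Coord n →L[ℝ] Coord n)‖ ≤ C := by
  refine ContinuousLinearMap.opNorm_le_bound _ (by linarith) fun q => ?_
  rw [dilCLM_apply, Prod.norm_def, max_le_iff]
  constructor
  · calc ‖q.1‖ ≤ 1 * ‖q‖ := by rw [one_mul]; exact norm_fst_le q
      _ ≤ _ := by gcongr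
  · calc ‖(dil t q).2‖ = |t| * ‖q.2‖ := by simp [dil, norm_smul]
      _ ≤ _ := by gcongr; exact norm_snd_le q

section CotMap

variable {φ : Cn n → Cn n} {B : Cn n → (Cn n →L[ℂ] Cn n)} {U : Set (Cn n)} {p : Coord n}

/-- Homogeneity in the fibres is what makes coordinate changes compatible with cones, with `dirInf`
and with `|ζ|` up to constants. -/
lemma cotMap_dil (t : ℝ) (q : Coord n) : cotMap φ B (dil t q) = dil t (cotMap φ B q) :=
  Prod.ext rfl (ContinuousLinearMap.smul_comp _ _ _)

lemma contDiffOn_cotMap (hφ : ContDiffOn ℂ ∞ φ U) (hB : ContDiffOn ℂ ∞ B U) :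
    ContDiffOn ℂ ∞ (cotMap φ B) (U ×ˢ univ) := by
  refine ContDiffOn.prodMk (hφ.comp contDiffOn_fst fun q hq => hq.1) ?_
  exact contDiffOn_snd.clm_comp (hB.comp contDiffOn_fst fun q hq => hq.1)

end CotMap

end Symb

/-! ### Invariance of growth, decay and germs under changes of canonical coordinates. -/

namespace Symb

open Filter Asymptotics

variable {n : ℕ} {φ : Cn n → Cn n} {B : Cn n → (Cn n →L[ℂ] Cn n)} {U : Set (Cn n)} {p : Coord n}
  {F : Coord n → ℂ}

lemma tendsto_cotMap (hc : ContinuousAt (cotMap φ B) p) :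
    Tendsto (cotMap φ B) (dirInf p) (dirInf (cotMap φ B p)) := by
  intro S hS
  obtain ⟨N, hN, δ, hδ, H⟩ := mem_dirInf.1 hS
  refine mem_dirInf.2 ⟨_, hc hN, δ, hδ, fun q hq t ht => ?_⟩
  rw [mem_preimage, cotMap_dil]
  exact H _ hq t ht

/-- The ratio of the two fibre norms is invariant under dilations and continuous and positive at
`p`, so bounds near `p` propagate to infinity. -/
lemma exists_cotMap_norm_bounds (hc : ContinuousAt (cotMap φ B) p) (hp : p.2 ≠ 0)
    (hp' : (cotMap φ B p).2 ≠ 0) :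
    ∃ c C : ℝ, 0 < c ∧ 0 < C ∧ ∀ᶠ x in dirInf p,
      c * ‖x.2‖ ≤ ‖(cotMap φ B x).2‖ ∧ ‖(cotMap φ B x).2‖ ≤ C * ‖x.2‖ := by
  have h1 : Tendsto (fun q : Coord n => ‖q.2‖) (𝓝 p) (𝓝 ‖p.2‖) := continuous_snd.norm.tendsto p
  have h2 : Tendsto (fun q => ‖(cotMap φ B q).2‖) (𝓝 p) (𝓝 ‖(cotMap φ B p).2‖) :=
    (continuous_snd.norm.tendsto _).comp hc
  have a : 0 < ‖p.2‖ := norm_pos_iff.2 hp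
  have b : 0 < ‖(cotMap φ B p).2‖ := norm_pos_iff.2 hp'
  have h3 := h2.div h1 a.ne'
  have hr : 0 < ‖(cotMap φ B p).2‖ / ‖p.2‖ := by positivity
  have h4 := (h3.eventually (lt_mem_nhds (half_lt_self hr))).and
    ((h3.eventually (gt_mem_nhds (lt_add_one _))).and (h1.eventually (lt_mem_nhds a)))
  refine ⟨‖(cotMap φ B p).2‖ / ‖p.2‖ / 2, ‖(cotMap φ B p).2‖ / ‖p.2‖ + 1, by positivity,
    by positivity, eventually_dirInf.2 ⟨_, h4, 1, one_pos, fun q hq t ht => ?_⟩⟩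
  obtain ⟨hq1, hq2, hq3⟩ := hq
  have ht0 : 0 < t := one_pos.trans ht
  simp only [Pi.div_apply] at hq1 hq2
  rw [lt_div_iff₀ hq3] at hq1
  rw [div_lt_iff₀ hq3] at hq2
  rw [cotMap_dil, norm_dil_snd ht0.le, norm_dil_snd ht0.le]
  constructor <;> nlinarith

lemma Infra.comp_cotMap {E : Type*} [NormedAddCommGroup E] {F : Coord n → E}
    (hc : ContinuousAt (cotMap φ B) p) (hp : p.2 ≠ 0)
    (hp' : (cotMap φ B p).2 ≠ 0) (hF : Infra (dirInf (cotMap φ B p)) F) :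
    Infra (dirInf p) (fun x => F (cotMap φ B x)) := by
  obtain ⟨c, C, hc0, hC, H⟩ := exists_cotMap_norm_bounds hc hp hp'
  intro h hh
  refine ((hF (h / C) (by positivity)).comp_tendsto (tendsto_cotMap hc)).trans
    (IsBigO.of_bound 1 ?_)
  filter_upwards [H] with x hx
  simp only [Function.comp_apply, Real.norm_eq_abs, Real.abs_exp, one_mul]
  refine Real.exp_le_exp.2 ?_
  calc h / C * ‖(cotMap φ B x).2‖ ≤ h / C * (C * ‖x.2‖) := by gcongr; exact hx.2
    _ = h * ‖x.2‖ := by field_simp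

lemma Dec.comp_cotMap {E : Type*} [NormedAddCommGroup E] {F : Coord n → E}
    (hc : ContinuousAt (cotMap φ B) p) (hp : p.2 ≠ 0)
    (hp' : (cotMap φ B p).2 ≠ 0) (hF : Dec (dirInf (cotMap φ B p)) F) :
    Dec (dirInf p) (fun x => F (cotMap φ B x)) := by
  obtain ⟨c, C, hc0, hC, H⟩ := exists_cotMap_norm_bounds hc hp hp'
  obtain ⟨h, hh, hF⟩ := hF
  refine ⟨h * c, by positivity, (hF.comp_tendsto (tendsto_cotMap hc)).trans
    (IsBigO.of_bound 1 ?_)⟩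
  filter_upwards [H] with x hx
  simp only [Function.comp_apply, Real.norm_eq_abs, Real.abs_exp, one_mul]
  refine Real.exp_le_exp.2 ?_
  calc -h * ‖(cotMap φ B x).2‖ ≤ -h * (c * ‖x.2‖) :=
        mul_le_mul_of_nonpos_left hx.1 (by linarith)
    _ = -(h * c) * ‖x.2‖ := by ring

lemma prod_univ_mem_dirInf (hU : IsOpen U) (hpU : p.1 ∈ U) :
    (U ×ˢ univ : Set (Coord n)) ∈ dirInf p :=
  mem_dirInf.2 ⟨U ×ˢ univ, (hU.prod isOpen_univ).mem_nhds ⟨hpU, trivial⟩, 1, one_pos,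
    fun _ hq _ _ => ⟨hq.1, trivial⟩⟩

section Smooth

variable (hU : IsOpen U) (hpU : p.1 ∈ U) (hφ : ContDiffOn ℂ ∞ φ U) (hB : ContDiffOn ℂ ∞ B U)

include hU hpU hφ hB

lemma continuousAt_cotMap : ContinuousAt (cotMap φ B) p :=
  (contDiffOn_cotMap hφ hB).continuousOn.continuousAt
    ((hU.prod isOpen_univ).mem_nhds ⟨hpU, trivial⟩)

lemma exists_isOpen_mapsTo_cotMap {W : Set (Coord n)} (hW : IsOpen W)
    (hWp : W ∈ dirInf (cotMap φ B p)) :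
    IsOpen ((U ×ˢ univ) ∩ cotMap φ B ⁻¹' W) ∧ (U ×ˢ univ) ∩ cotMap φ B ⁻¹' W ∈ dirInf p :=
  ⟨(contDiffOn_cotMap hφ hB).continuousOn.isOpen_inter_preimage (hU.prod isOpen_univ) hW,
    inter_mem (prod_univ_mem_dirInf hU hpU)
      (tendsto_cotMap (continuousAt_cotMap hU hpU hφ hB) hWp)⟩

lemma HolGerm.comp_cotMap (hF : HolGerm (cotMap φ B p) F) :
    HolGerm p (fun x => F (cotMap φ B x)) := by
  obtain ⟨W, o, m, h⟩ := hF
  obtain ⟨o', m'⟩ := exists_isOpen_mapsTo_cotMap hU hpU hφ hB o m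
  exact ⟨_, o', m', h.comp (((contDiffOn_cotMap hφ hB).differentiableOn (by simp)).mono
    inter_subset_left) fun x hx => hx.2⟩

lemma SmoothHoloGerm.comp_cotMap (hF : SmoothHoloGerm (cotMap φ B p) F) :
    SmoothHoloGerm p (fun x => F (cotMap φ B x)) := by
  obtain ⟨W, o, m, h⟩ := hF
  obtain ⟨o', m'⟩ := exists_isOpen_mapsTo_cotMap hU hpU hφ hB o m
  refine ⟨_, o', m', h.1.comp (((contDiffOn_cotMap hφ hB).restrict_scalars ℝ).mono
    inter_subset_left) fun x hx => hx.2, fun x hx => ?_⟩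
  have h1 : DifferentiableAt ℂ (fun ζ : CnDual n => F (φ x.1, ζ)) (x.2.comp (B x.1)) :=
    h.2 _ hx.2
  have h2 : DifferentiableAt ℂ (fun ζ : CnDual n => ζ.comp (B x.1)) x.2 :=
    differentiableAt_id.clm_comp (differentiableAt_const _)
  exact DifferentiableAt.comp (g := fun ζ : CnDual n => F (φ x.1, ζ)) x.2 h1 h2

/-- The derivatives of a change of canonical coordinates grow at most linearly. -/
lemma exists_iteratedFDeriv_cotMap_le (hp : p.2 ≠ 0) (k : ℕ) :
    ∃ M : ℝ, 0 ≤ M ∧ ∀ᶠ x in dirInf p, ∀ i ≤ k,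
      ‖iteratedFDeriv ℝ i (cotMap φ B) x‖ ≤ M * ‖x.2‖ := by
  have ho := hU.prod (isOpen_univ (X := CnDual n))
  have hs := (contDiffOn_cotMap hφ hB).restrict_scalars ℝ
  obtain ⟨M, hM, H⟩ := exists_iteratedFDeriv_bound ho hs (x := p) ⟨hpU, trivial⟩ k
  have h1 : Tendsto (fun q : Coord n => ‖q.2‖) (𝓝 p) (𝓝 ‖p.2‖) := continuous_snd.norm.tendsto p
  have a : 0 < ‖p.2‖ := norm_pos_iff.2 hp
  refine ⟨M / (‖p.2‖ / 2), by positivity, eventually_dirInf.2 ⟨_, (H.and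
    ((h1.eventually (lt_mem_nhds (half_lt_self a))).and (ho.mem_nhds ⟨hpU, trivial⟩))), 1,
    one_pos, fun q hq t ht i hi => ?_⟩⟩
  obtain ⟨hq1, hq2, hq3⟩ := hq
  have ht0 : 0 < t := one_pos.trans ht
  -- By homogeneity the map is its own conjugate under `dil t`. The outer dilation contributes a
  -- factor `t` and the inner one at most 1, and `t` is comparable to `‖(dil t q).2‖` because `‖q.2‖
  -- > ‖p.2‖ / 2`.
  have e : cotMap φ B = (dilCLM t : Coord n →L[ℝ] Coord n) ∘ (cotMap φ B ∘
      (dilCLM t⁻¹ : Coord n →L[ℝ] Coord n)) := by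
    funext x
    simp only [Function.comp_apply, dilCLM_apply, ← cotMap_dil, dil_dil_inv ht0.ne']
  have hx : (dilCLM t⁻¹ : Coord n →L[ℝ] Coord n) (dil t q) = q := by
    rw [dilCLM_apply, dil_inv_dil ht0.ne']
  have h2 := norm_iteratedFDeriv_le_of_conj ho hs (dilCLM t) (dilCLM t⁻¹) e (x := dil t q)
    (by rw [hx]; exact hq3) i
  rw [hx] at h2
  have h3 : ‖(dilCLM t : Coord n →L[ℝ] Coord n)‖ ≤ t :=
    norm_dilCLM_le ht.le (abs_of_pos ht0).le
  have h4 : ‖(dilCLM t⁻¹ : Coord n →L[ℝ] Coord n)‖ ≤ 1 :=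
    norm_dilCLM_le le_rfl (by
      rw [abs_of_pos (inv_pos.2 ht0)]; exact inv_le_one_of_one_le₀ ht.le)
  have h5 : ‖iteratedFDeriv ℝ i (cotMap φ B) (dil t q)‖ ≤ t * (M * 1) := by
    refine h2.trans ?_
    gcongr
    · exact hq1 i hi
    · exact pow_le_one₀ (norm_nonneg _) h4
  refine h5.trans ?_
  rw [norm_dil_snd ht0.le, div_mul_eq_mul_div, le_div_iff₀ (by positivity)]
  have h6 : t * M * (‖p.2‖ / 2) ≤ t * M * ‖q.2‖ := by gcongr
  linarith

/-- By Faà di Bruno the derivatives of the composite are bounded by decaying derivatives of `F`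
times a power of `1 + M|ζ|`; such a polynomial factor costs only part of the rate. -/
lemma NullGerm.comp_cotMap (hp : p.2 ≠ 0) (hp' : (cotMap φ B p).2 ≠ 0)
    (hF : NullGerm (cotMap φ B p) F) : NullGerm p (fun x => F (cotMap φ B x)) := by
  rw [nullGerm_iff] at hF ⊢
  have hc := continuousAt_cotMap hU hpU hφ hB
  refine ⟨hF.1.comp_cotMap hU hpU hφ hB, fun k => ?_⟩
  obtain ⟨M, hM, H⟩ := exists_iteratedFDeriv_cotMap_le hU hpU hφ hB hp k
  obtain ⟨W, o, m, s⟩ := hF.1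
  obtain ⟨o', m'⟩ := exists_isOpen_mapsTo_cotMap hU hpU hφ hB o m
  have hsum := Dec.sum (Finset.range (k + 1)) fun i _ => (hF.2 i).comp_cotMap hc hp hp'
  have hdec := hsum.mul_infra (infra_pow (infra_one_add_mul_norm (dirInf p) hM) k)
  refine hdec.of_isBigO (IsBigO.of_bound k.factorial ?_)
  filter_upwards [H, m'] with x hx hxm
  have hnn : 0 ≤ ∑ i ∈ Finset.range (k + 1), ‖iteratedFDeriv ℝ i F (cotMap φ B x)‖ :=
    Finset.sum_nonneg fun i _ => norm_iteratedFDeriv_nonneg _ _ _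
  have hbase : 1 ≤ 1 + M * ‖x.2‖ := le_add_of_nonneg_right (by positivity)
  refine norm_le_mul_norm_of_nonneg (norm_iteratedFDeriv_nonneg _ _ _)
    (mul_nonneg hnn (by positivity)) ?_
  rw [← mul_assoc]
  refine norm_iteratedFDeriv_comp_le_of_isOpen (hU.prod isOpen_univ) o s.1
    ((contDiffOn_cotMap hφ hB).restrict_scalars ℝ) hxm.1 hxm.2 (fun i hi => ?_)
    fun i h1 hi => ?_
  · exact Finset.single_le_sum
      (f := fun i => ‖iteratedFDeriv ℝ i F (cotMap φ B x)‖)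
      (fun j _ => norm_iteratedFDeriv_nonneg _ _ _) (Finset.mem_range.2 (by omega))
  -- The summand 1 makes the base at least 1, so that it is bounded by its own `i`-th power for `i ≥
  -- 1`, the form required by the estimate for composites.
  · refine (hx i hi).trans ((le_add_of_nonneg_left zero_le_one).trans ?_)
    exact le_self_pow₀ hbase (by omega)

end Smooth

end Symb

namespace Symb

open Filter MeasureTheory

/-! ### The Cauchy–Pompeiu formula -/

/-- The singularity has order 1, less than the real dimension 2 of the plane. -/
lemma locallyIntegrable_inv : LocallyIntegrable (fun w : ℂ => w⁻¹) := by
  refine locallyIntegrable_of_norm_le_rpow (C := 1) (α := 1) (by simp) (by simp)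
    (Eventually.of_forall fun w => ?_) (Measurable.aestronglyMeasurable (by fun_prop))
  rw [norm_inv, Real.rpow_neg_one, one_mul]

lemma integrableOn_polar {g : ℝ × ℝ → ℂ} (hg : Continuous g) {ρ : ℝ}
    (h : ∀ r θ, ρ < r → g (r, θ) = 0) :
    IntegrableOn g (Ioi 0 ×ˢ Ioo (-Real.pi) Real.pi) := by
  have h1 : IntegrableOn g (Icc 0 ρ ×ˢ Icc (-Real.pi) Real.pi) :=
    hg.continuousOn.integrableOn_compact (isCompact_Icc.prod isCompact_Icc)
  refine h1.of_forall_sdiff_eq_zero (measurableSet_Ioi.prod measurableSet_Ioo) ?_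
  rintro ⟨r, θ⟩ ⟨⟨hr, hθ⟩, hn⟩
  refine h r θ (not_le.1 fun hle => hn ⟨⟨le_of_lt hr, hle⟩, ⟨hθ.1.le, hθ.2.le⟩⟩)

/-- The Cauchy–Pompeiu formula for functions with compact support. -/
theorem integral_inv_mul_dbar {f : ℂ → ℂ} (hf : ContDiff ℝ 1 f) (hc : HasCompactSupport f) :
    ∫ w : ℂ, w⁻¹ * (fderiv ℝ f w 1 + Complex.I * fderiv ℝ f w Complex.I) =
      -(2 * Real.pi) * f 0 := by
  let e : ℝ → ℂ := fun θ => Real.cos θ + Real.sin θ * Complex.I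
  have he : Continuous e := by fun_prop
  have hne : ∀ θ, ‖e θ‖ = 1 := fun θ => by
    simp only [e]
    rw [Complex.ofReal_cos, Complex.ofReal_sin, ← Complex.exp_mul_I,
      Complex.norm_exp_ofReal_mul_I]
  have hder : ∀ θ, HasDerivAt e (Complex.I * e θ) θ := fun θ => by
    have h1 := (Real.hasDerivAt_cos θ).ofReal_comp
    have h2 := ((Real.hasDerivAt_sin θ).ofReal_comp).mul_const Complex.I
    have h3 := h1.add h2
    have h4 : Complex.I * e θ = ((-Real.sin θ : ℝ) : ℂ) + (Real.cos θ : ℝ) * Complex.I := by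
      have hI := Complex.I_sq
      simp only [e]
      push_cast
      linear_combination (Complex.sin θ) * hI
    rw [h4]
    exact h3
  have hfd : Continuous (fderiv ℝ f) := hf.continuous_fderiv (by simp)
  have hdf : ∀ w, HasFDerivAt f (fderiv ℝ f w) w := fun w =>
    (hf.differentiable (by simp) w).hasFDerivAt
  obtain ⟨ρ, hρ⟩ : ∃ ρ : ℝ, ∀ w : ℂ, ρ < ‖w‖ → w ∉ tsupport f := by
    obtain ⟨ρ, hρ⟩ := hc.isCompact.isBounded.exists_norm_le
    exact ⟨ρ, fun w hw hw' => (hρ w hw').not_gt hw⟩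
  have hf0 : ∀ w : ℂ, ρ < ‖w‖ → f w = 0 := fun w hw => image_eq_zero_of_notMem_tsupport (hρ w hw)
  have hfd0 : ∀ w : ℂ, ρ < ‖w‖ → fderiv ℝ f w = 0 := fun w hw =>
    image_eq_zero_of_notMem_tsupport fun h => hρ w hw (tsupport_fderiv_subset ℝ h)
  have hnorm : ∀ r θ, ρ < r → ρ < ‖(r : ℂ) * e θ‖ := fun r θ hr => by
    rw [norm_mul, hne, mul_one, Complex.norm_real]
    exact hr.trans_le (Real.le_norm_self r)
  -- In polar coordinates the area factor `r` cancels the singularity of `w⁻¹`, and the integrand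
  -- becomes `g₁ + i g₂`. Here `g₁` is the radial derivative of `f (r e(θ))`, with integral `-f 0`
  -- along each ray, and `r g₂` is its angular derivative.
  let g₁ : ℝ × ℝ → ℂ := fun q => fderiv ℝ f (q.1 * e q.2) (e q.2)
  let g₂ : ℝ × ℝ → ℂ := fun q => fderiv ℝ f (q.1 * e q.2) (Complex.I * e q.2)
  have hg₁ : Continuous g₁ := (hfd.comp (by fun_prop)).clm_apply (by fun_prop)
  have hg₂ : Continuous g₂ := (hfd.comp (by fun_prop)).clm_apply (by fun_prop)
  have hi₁ : IntegrableOn g₁ (Ioi 0 ×ˢ Ioo (-Real.pi) Real.pi) :=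
    integrableOn_polar hg₁ (ρ := ρ) fun r θ hr => by simp [g₁, hfd0 _ (hnorm r θ hr)]
  have hi₂ : IntegrableOn g₂ (Ioi 0 ×ˢ Ioo (-Real.pi) Real.pi) :=
    integrableOn_polar hg₂ (ρ := ρ) fun r θ hr => by simp [g₂, hfd0 _ (hnorm r θ hr)]
  have hradial : ∀ θ : ℝ, ∫ r in Ioi (0 : ℝ), g₁ (r, θ) = -f 0 := by
    intro θ
    have hd : ∀ r ∈ Ici (0 : ℝ), HasDerivAt (fun r : ℝ => f (r * e θ)) (g₁ (r, θ)) r := by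
      intro r _
      have h1 : HasDerivAt (fun r : ℝ => (r : ℂ) * e θ) (e θ) r := by
        simpa using (Complex.ofRealCLM.hasDerivAt (x := r)).mul_const (e θ)
      exact (hdf _).comp_hasDerivAt r h1
    have hint : IntegrableOn (fun r => g₁ (r, θ)) (Ioi 0) := by
      have h1 : IntegrableOn (fun r => g₁ (r, θ)) (Icc 0 ρ) :=
        (hg₁.comp (by fun_prop)).continuousOn.integrableOn_compact isCompact_Icc
      refine h1.of_forall_sdiff_eq_zero measurableSet_Ioi ?_
      rintro r ⟨hr, hn⟩
      have : ρ < r := not_le.1 fun hle => hn ⟨le_of_lt hr, hle⟩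
      simp [g₁, hfd0 _ (hnorm r θ this)]
    have hlim : Tendsto (fun r : ℝ => f (r * e θ)) atTop (𝓝 0) := by
      refine tendsto_const_nhds.congr' ?_
      filter_upwards [Ioi_mem_atTop ρ] with r hr
      exact (hf0 _ (hnorm r θ hr)).symm
    rw [integral_Ioi_of_hasDerivAt_of_tendsto' hd hint hlim]
    simp
  -- Over a full period the integral of the angular derivative vanishes, and `r ≠ 0` can be divided
  -- out.
  have hangular : ∀ r ∈ Ioi (0 : ℝ), ∫ θ in Ioo (-Real.pi) Real.pi, g₂ (r, θ) = 0 := by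
    intro r hr
    have hr0 : (r : ℂ) ≠ 0 := by exact_mod_cast (ne_of_gt hr)
    have hd : ∀ θ ∈ uIcc (-Real.pi) Real.pi,
        HasDerivAt (fun θ : ℝ => f (r * e θ)) (r * g₂ (r, θ)) θ := by
      intro θ _
      have h1 := (hdf (r * e θ)).comp_hasDerivAt θ ((hder θ).const_mul (r : ℂ))
      have h2 : fderiv ℝ f (r * e θ) (r * (Complex.I * e θ)) = r * g₂ (r, θ) := by
        have h3 := (fderiv ℝ f (r * e θ)).map_smul r (Complex.I * e θ)
        simpa [g₂, Complex.real_smul] using h3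
      rw [h2] at h1
      exact h1
    have hcont : Continuous fun θ => r * g₂ (r, θ) := by
      have := hg₂.comp (by fun_prop : Continuous fun θ : ℝ => (r, θ))
      exact continuous_const.mul this
    have h1 := intervalIntegral.integral_eq_sub_of_hasDerivAt hd (hcont.intervalIntegrable _ _)
    rw [intervalIntegral.integral_const_mul] at h1
    have h2 : f (r * e Real.pi) - f (r * e (-Real.pi)) = 0 := by simp [e]
    rw [h2, mul_eq_zero] at h1
    have h3 := h1.resolve_left hr0
    rwa [intervalIntegral.integral_of_le (by linarith [Real.pi_pos]),
      integral_Ioc_eq_integral_Ioo] at h3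
  rw [← Complex.integral_comp_polarCoord_symm, polarCoord_target]
  have hpt : ∀ q ∈ Ioi (0 : ℝ) ×ˢ Ioo (-Real.pi) Real.pi,
      q.1 • ((Complex.polarCoord.symm q)⁻¹ * (fderiv ℝ f (Complex.polarCoord.symm q) 1 +
        Complex.I * fderiv ℝ f (Complex.polarCoord.symm q) Complex.I)) =
      g₁ q + Complex.I * g₂ q := by
    rintro ⟨r, θ⟩ ⟨hr, -⟩
    have hr0 : (r : ℂ) ≠ 0 := by exact_mod_cast (ne_of_gt hr)
    have hsymm : Complex.polarCoord.symm (r, θ) = r * e θ := Complex.polarCoord_symm_apply _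
    simp only [hsymm, g₁, g₂]
    have e1 : ∀ A : ℂ →L[ℝ] ℂ, A (e θ) = Real.cos θ * A 1 + Real.sin θ * A Complex.I := fun A => by
      have : e θ = Real.cos θ • (1 : ℂ) + Real.sin θ • Complex.I := by
        simp [e, Complex.real_smul]
      rw [this, map_add, map_smul, map_smul, Complex.real_smul, Complex.real_smul]
    have e2 : ∀ A : ℂ →L[ℝ] ℂ, A (Complex.I * e θ) =
        Real.cos θ * A Complex.I - Real.sin θ * A 1 := fun A => by
      have : Complex.I * e θ = Real.cos θ • Complex.I - Real.sin θ • (1 : ℂ) := by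
        have hI := Complex.I_sq
        simp only [e, Complex.real_smul]
        linear_combination (Real.sin θ : ℂ) * hI
      rw [this, map_sub, map_smul, map_smul, Complex.real_smul, Complex.real_smul]
    rw [e1, e2, Complex.real_smul]
    have hinv : (r * e θ)⁻¹ = (r : ℂ)⁻¹ * (Real.cos θ - Real.sin θ * Complex.I) := by
      rw [mul_inv]
      congr 1
      refine inv_eq_of_mul_eq_one_right ?_
      have hI := Complex.I_sq
      have hcs : (Real.cos θ : ℂ) ^ 2 + (Real.sin θ : ℂ) ^ 2 = 1 := by
        exact_mod_cast Real.cos_sq_add_sin_sq θ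
      simp only [e]
      linear_combination hcs - (Real.sin θ : ℂ) ^ 2 * hI
    rw [hinv]
    have hI := Complex.I_sq
    field_simp
    linear_combination (-(Real.sin θ : ℂ) * fderiv ℝ f (r * e θ) Complex.I) * hI
  rw [setIntegral_congr_fun (measurableSet_Ioi.prod measurableSet_Ioo) hpt,
    integral_add hi₁ (hi₂.const_mul _), integral_const_mul]
  have hs₂ : ∫ q in Ioi (0 : ℝ) ×ˢ Ioo (-Real.pi) Real.pi, g₂ q = 0 := by
    rw [Measure.volume_eq_prod, setIntegral_prod _ (by rwa [← Measure.volume_eq_prod]),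
      setIntegral_congr_fun measurableSet_Ioi hangular]
    simp
  have hs₁ : ∫ q in Ioi (0 : ℝ) ×ˢ Ioo (-Real.pi) Real.pi, g₁ q = -(2 * Real.pi) * f 0 := by
    rw [Measure.volume_eq_prod, ← Measure.prod_restrict, integral_prod_symm _ (by
      rwa [Measure.prod_restrict, ← Measure.volume_eq_prod])]
    simp only [hradial]
    rw [setIntegral_const]
    simp only [Measure.real, Real.volume_Ioo, Complex.real_smul]
    rw [ENNReal.toReal_ofReal (by linarith [Real.pi_pos])]
    push_cast
    ring
  rw [hs₁, hs₂]
  ring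

end Symb

namespace Symb

open Filter MeasureTheory
open scoped Convolution

/-! ### The Cauchy transform along a complex line -/

section CauchyTransform

variable {E : Type*} [NormedAddCommGroup E] [NormedSpace ℝ E]

/-- The Cauchy transform of `ψ` along the plane that is parametrized by `a`. -/
def cauchyTransform (a : ℂ →L[ℝ] E) (ψ : E → ℂ) (p : E) : ℂ :=
  (Real.pi : ℂ)⁻¹ * ∫ w : ℂ, w⁻¹ * ψ (p - a w)

/-- `ψ` is smooth on an open set that is invariant under translation by the range of `a`, and
supported in `‖l - c‖ ≤ ρ`, where `l` is a coordinate on the range of `a`. -/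
structure TubeSupported (a : ℂ →L[ℝ] E) (l : E →L[ℝ] ℂ) (Ω : Set E) (c : ℂ) (ρ : ℝ)
    (ψ : E → ℂ) : Prop where
  coord : ∀ w, l (a w) = w
  isOpen : IsOpen Ω
  add_mem : ∀ p ∈ Ω, ∀ w, p + a w ∈ Ω
  smooth : ContDiffOn ℝ ∞ ψ Ω
  support : ∀ p ∈ Ω, ρ < ‖l p - c‖ → ψ p = 0

variable {a : ℂ →L[ℝ] E} {l : E →L[ℝ] ℂ} {Ω : Set E} {c : ℂ} {ρ : ℝ} {ψ : E → ℂ}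

namespace TubeSupported

lemma sub_mem (h : TubeSupported a l Ω c ρ ψ) {p : E} (hp : p ∈ Ω) (w : ℂ) : p - a w ∈ Ω := by
  have := h.add_mem p hp (-w)
  rwa [map_neg, ← sub_eq_add_neg] at this

lemma fderiv_apply (h : TubeSupported a l Ω c ρ ψ) (v : E) :
    TubeSupported a l Ω c ρ (fun p => fderiv ℝ ψ p v) where
  coord := h.coord
  isOpen := h.isOpen
  add_mem := h.add_mem
  smooth := (h.smooth.fderiv_of_isOpen h.isOpen (by simp)).clm_apply contDiffOn_const
  support p hp hl := by
    have ho : IsOpen (Ω ∩ {p | ρ < ‖l p - c‖}) :=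
      h.isOpen.inter (isOpen_lt continuous_const (by fun_prop))
    have : ψ =ᶠ[𝓝 p] fun _ => 0 := by
      filter_upwards [ho.mem_nhds ⟨hp, hl⟩] with q hq
      exact h.support q hq.1 hq.2
    rw [this.fderiv_eq]
    simp

lemma eq_zero (h : TubeSupported a l Ω c ρ ψ) {p : E} (hp : p ∈ Ω) {w : ℂ} {M : ℝ}
    (hM : ‖l p - c‖ ≤ M) (hw : M + ρ < ‖w‖) : ψ (p + a w) = 0 := by
  refine h.support _ (h.add_mem p hp w) ?_
  rw [map_add, h.coord]
  have h1 : ‖w‖ ≤ ‖l p + w - c‖ + ‖l p - c‖ := by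
    calc ‖w‖ = ‖(l p + w - c) - (l p - c)‖ := by congr 1; ring
      _ ≤ _ := norm_sub_le _ _
  linarith

variable (h : TubeSupported a l Ω c ρ ψ)

include h

/-- The set on which the supports in the direction of `a` are uniformly bounded. -/
lemma param_setup (M : ℝ) :
    IsOpen (Ω ∩ {p | ‖l p - c‖ < M}) ∧
    (∀ p w, p ∈ Ω ∩ {p | ‖l p - c‖ < M} → w ∉ Metric.closedBall (0 : ℂ) (M + ρ) →
      ψ (p + a w) = 0) ∧
    ContDiffOn ℝ ∞ (fun q : E × ℂ => ψ (q.1 + a q.2)) ((Ω ∩ {p | ‖l p - c‖ < M}) ×ˢ univ) := by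
  refine ⟨h.isOpen.inter (isOpen_lt (by fun_prop) continuous_const), fun p w hp hw => ?_, ?_⟩
  · exact h.eq_zero hp.1 (le_of_lt hp.2) (by simpa using hw)
  · exact h.smooth.comp (ContDiff.contDiffOn (by fun_prop)) fun q hq => h.add_mem _ hq.1.1 _

/-- The transform is the convolution of `w⁻¹` with `w ↦ ψ (p + a w)`, taken at 0 and depending on
the parameter `p`. The kernel is locally integrable and the supports are locally uniformly bounded
in `p`, so the dependence on `p` is smooth. -/
lemma contDiffOn_cauchyTransform : ContDiffOn ℝ ∞ (cauchyTransform a ψ) Ω := by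
  intro p hp
  obtain ⟨ho, h0, hs⟩ := h.param_setup (‖l p - c‖ + 1)
  have key := contDiffOn_convolution_right_with_param_comp (n := ⊤) (μ := volume)
    (ContinuousLinearMap.mul ℝ ℂ) (v := fun _ : E => (0 : ℂ)) contDiffOn_const
    (f := fun w : ℂ => w⁻¹) (g := fun p w => ψ (p + a w)) ho (isCompact_closedBall _ _) h0
    locallyIntegrable_inv hs
  have hp' : p ∈ Ω ∩ {q | ‖l q - c‖ < ‖l p - c‖ + 1} := ⟨hp, lt_add_one ‖l p - c‖⟩
  have h1 := (contDiffOn_const (c := (Real.pi : ℂ)⁻¹)).mul key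
  refine ((h1.contDiffAt (ho.mem_nhds hp')).congr_of_eventuallyEq
    (Eventually.of_forall fun q => ?_)).contDiffWithinAt
  simp [cauchyTransform, convolution_def, sub_eq_add_neg]

/-- In the convolution all derivatives fall on `ψ`, none on the singular kernel. -/
lemma fderiv_cauchyTransform {p : E} (hp : p ∈ Ω) (v : E) :
    fderiv ℝ (cauchyTransform a ψ) p v = cauchyTransform a (fun q => fderiv ℝ ψ q v) p := by
  obtain ⟨ho, h0, hs⟩ := h.param_setup (‖l p - c‖ + 1)
  have hp' : p ∈ Ω ∩ {q | ‖l q - c‖ < ‖l p - c‖ + 1} := ⟨hp, lt_add_one ‖l p - c‖⟩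
  have hs1 : ContDiffOn ℝ 1 (↿fun (p : E) (w : ℂ) => ψ (p + a w))
      ((Ω ∩ {q | ‖l q - c‖ < ‖l p - c‖ + 1}) ×ˢ univ) := hs.of_le (by exact_mod_cast le_top)
  have key := hasFDerivAt_convolution_right_with_param (μ := volume)
    (ContinuousLinearMap.mul ℝ ℂ)
    (f := fun w : ℂ => w⁻¹) (g := fun p w => ψ (p + a w)) ho (isCompact_closedBall _ _) h0
    locallyIntegrable_inv hs1 (p, 0) hp'
  have hin : HasFDerivAt (fun p : E => (p, (0 : ℂ))) (ContinuousLinearMap.inl ℝ E ℂ) p :=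
    hasFDerivAt_prodMk_left p 0
  have h1 := (key.comp p hin).const_mul (Real.pi : ℂ)⁻¹
  have h2 : HasFDerivAt (cauchyTransform a ψ) _ p := h1.congr_of_eventuallyEq
    (Eventually.of_forall fun q => by simp [cauchyTransform, convolution_def, sub_eq_add_neg])
  have hder : ∀ w : ℂ, fderiv ℝ (↿fun (p : E) (w : ℂ) => ψ (p + a w)) (p, w) (v, 0) =
      fderiv ℝ ψ (p + a w) v := by
    intro w
    have hd : HasFDerivAt ψ (fderiv ℝ ψ (p + a w)) (p + a w) :=
      ((h.smooth.contDiffAt (h.isOpen.mem_nhds (h.add_mem p hp w))).differentiableAt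
        (by simp)).hasFDerivAt
    have hl : HasFDerivAt (fun q : E × ℂ => q.1 + a q.2)
        (ContinuousLinearMap.fst ℝ E ℂ + a.comp (ContinuousLinearMap.snd ℝ E ℂ)) (p, w) :=
      hasFDerivAt_fst.add (a.hasFDerivAt.comp (p, w) hasFDerivAt_snd)
    have h3 := (HasFDerivAt.comp (p, w) (f := fun q : E × ℂ => q.1 + a q.2) hd hl).fderiv
    have h4 : fderiv ℝ (↿fun (p : E) (w : ℂ) => ψ (p + a w)) (p, w) = _ := h3
    rw [h4]
    simp
  rw [h2.fderiv]
  simp only [smul_apply, ContinuousLinearMap.comp_apply,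
    ContinuousLinearMap.inl_apply, smul_eq_mul, cauchyTransform]
  congr 1
  have hcont : Continuous fun w : ℂ => fderiv ℝ (↿fun (p : E) (w : ℂ) => ψ (p + a w)) (p, w) := by
    have h5 := (hs.fderiv_of_isOpen (ho.prod isOpen_univ) (m := ∞) (by simp)).continuousOn
    exact h5.comp_continuous (by fun_prop) fun w => ⟨hp', trivial⟩
  have hcs : HasCompactSupport
      fun w : ℂ => fderiv ℝ (↿fun (p : E) (w : ℂ) => ψ (p + a w)) (p, w) := by
    refine HasCompactSupport.intro (isCompact_closedBall (0 : ℂ) (‖l p - c‖ + 1 + ρ))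
      fun w hw => ?_
    have ho2 : IsOpen ((Ω ∩ {q | ‖l q - c‖ < ‖l p - c‖ + 1}) ×ˢ
        (Metric.closedBall (0 : ℂ) (‖l p - c‖ + 1 + ρ))ᶜ) :=
      ho.prod Metric.isClosed_closedBall.isOpen_compl
    have : (↿fun (p : E) (w : ℂ) => ψ (p + a w)) =ᶠ[𝓝 (p, w)] fun _ => 0 := by
      filter_upwards [ho2.mem_nhds ⟨hp', hw⟩] with q hq
      exact h0 q.1 q.2 hq.1 hq.2
    rw [this.fderiv_eq]
    simp
  rw [convolution_precompR_apply _ locallyIntegrable_inv hcs hcont, convolution_def]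
  refine integral_congr_ae (Eventually.of_forall fun w => ?_)
  simp only [hder, zero_sub, map_neg, ← sub_eq_add_neg, ContinuousLinearMap.mul_apply']

/-- For such `p` the integrand vanishes outside the disc of radius `2ρ`, so the constant depends
neither on `p` nor on `ψ`. -/
lemma norm_cauchyTransform_le {p : E} (hp : p ∈ Ω) (hl : ‖l p - c‖ ≤ ρ) {m : ℝ}
    (hm : ∀ w, ‖ψ (p - a w)‖ ≤ m) :
    ‖cauchyTransform a ψ p‖ ≤
      Real.pi⁻¹ * (∫ w in Metric.closedBall (0 : ℂ) (ρ + ρ), ‖w⁻¹‖) * m := by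
  have hi : IntegrableOn (fun w : ℂ => ‖w⁻¹‖) (Metric.closedBall (0 : ℂ) (ρ + ρ)) :=
    (locallyIntegrable_inv.integrableOn_isCompact (isCompact_closedBall _ _)).norm
  rw [cauchyTransform, norm_mul, norm_inv, Complex.norm_real, Real.norm_of_nonneg Real.pi_pos.le,
    mul_assoc]
  gcongr
  rw [← integral_mul_const, ← integral_indicator Metric.isClosed_closedBall.measurableSet]
  refine norm_integral_le_of_norm_le (IntegrableOn.integrable_indicator (hi.mul_const m)
    Metric.isClosed_closedBall.measurableSet) (Eventually.of_forall fun w => ?_)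
  by_cases hw : w ∈ Metric.closedBall (0 : ℂ) (ρ + ρ)
  · rw [indicator_of_mem hw, norm_mul]
    gcongr
    exact hm w
  · rw [indicator_of_notMem hw]
    have h1 := h.eq_zero (w := -w) hp hl (by simpa using hw)
    rw [map_neg, ← sub_eq_add_neg] at h1
    rw [h1]
    simp

/-- The Cauchy transform inverts the Cauchy–Riemann operator. -/
lemma dbar_cauchyTransform {p : E} (hp : p ∈ Ω) :
    (1 / 2 : ℂ) * (fderiv ℝ (cauchyTransform a ψ) p (a 1) +
      Complex.I * fderiv ℝ (cauchyTransform a ψ) p (a Complex.I)) = ψ p := by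
  let f : ℂ → ℂ := fun w => ψ (p - a w)
  have hf : ContDiff ℝ ∞ f := by
    rw [← contDiffOn_univ]
    exact h.smooth.comp (ContDiff.contDiffOn (by fun_prop)) fun w _ => h.sub_mem hp w
  have hc : HasCompactSupport f := by
    refine HasCompactSupport.intro (isCompact_closedBall (0 : ℂ) (‖l p - c‖ + ρ)) fun w hw => ?_
    have h1 := h.eq_zero (w := -w) hp le_rfl (by simpa using hw)
    rwa [map_neg, ← sub_eq_add_neg] at h1
  have hder : ∀ w u, fderiv ℝ f w u = -fderiv ℝ ψ (p - a w) (a u) := by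
    intro w u
    have hd : HasFDerivAt ψ (fderiv ℝ ψ (p - a w)) (p - a w) :=
      ((h.smooth.contDiffAt (h.isOpen.mem_nhds (h.sub_mem hp w))).differentiableAt
        (by simp)).hasFDerivAt
    have h2 : HasFDerivAt (fun w => p - a w) (-a) w := a.hasFDerivAt.const_sub p
    have h3 : fderiv ℝ f w = _ := (hd.comp w h2).fderiv
    rw [h3]
    simp
  have hint : ∀ v, Integrable fun w : ℂ => w⁻¹ * fderiv ℝ ψ (p - a w) v := by
    intro v
    have h4 := h.fderiv_apply v
    have hc1 : Continuous fun w : ℂ => fderiv ℝ ψ (p - a w) v :=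
      h4.smooth.continuousOn.comp_continuous (by fun_prop) fun w => h.sub_mem hp w
    have hcs : HasCompactSupport fun w : ℂ => fderiv ℝ ψ (p - a w) v := by
      refine HasCompactSupport.intro (isCompact_closedBall (0 : ℂ) (‖l p - c‖ + ρ))
        fun w hw => ?_
      have h1 := h4.eq_zero (w := -w) hp le_rfl (by simpa using hw)
      rwa [map_neg, ← sub_eq_add_neg] at h1
    exact locallyIntegrable_inv.integrable_smul_right_of_hasCompactSupport hc1 hcs
  -- The formula is applied to the slice `w ↦ ψ (p - a w)`; the sign in the argument cancels the
  -- sign of `-(2π)`.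
  have key := integral_inv_mul_dbar (hf.of_le (by exact_mod_cast le_top)) hc
  have e1 : ∀ w : ℂ, w⁻¹ * (fderiv ℝ f w 1 + Complex.I * fderiv ℝ f w Complex.I) =
      -(w⁻¹ * fderiv ℝ ψ (p - a w) (a 1)) -
        Complex.I * (w⁻¹ * fderiv ℝ ψ (p - a w) (a Complex.I)) := by
    intro w
    rw [hder, hder]
    ring
  simp only [e1] at key
  rw [integral_sub (hint _).fun_neg ((hint _).const_mul _), integral_neg, integral_const_mul] at key
  rw [h.fderiv_cauchyTransform hp, h.fderiv_cauchyTransform hp, cauchyTransform, cauchyTransform]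
  have hpi : (Real.pi : ℂ) ≠ 0 := by exact_mod_cast Real.pi_ne_zero
  have hf0 : f 0 = ψ p := by simp [f]
  rw [hf0] at key
  have hinv : (Real.pi : ℂ)⁻¹ * Real.pi = 1 := inv_mul_cancel₀ hpi
  linear_combination (-(1 / 2) * (Real.pi : ℂ)⁻¹) * key + ψ p * hinv

end TubeSupported

end CauchyTransform

end Symb

namespace Symb

open Filter Asymptotics MeasureTheory

variable {n : ℕ}

/-! ### Uniform decay on open sets -/

lemma Dec.mono {E : Type*} [NormedAddCommGroup E] {l l' : Filter (Coord n)} {F : Coord n → E}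
    (h : Dec l F) (hl : l' ≤ l) : Dec l' F := by
  obtain ⟨a, ha, H⟩ := h
  exact ⟨a, ha, H.mono hl⟩

/-- `F` is smooth and holomorphic in `ζ` on `S`, and its derivatives decay exponentially. -/
structure UnifNull (S : Set (Coord n)) (F : Coord n → ℂ) : Prop where
  smoothHolo : SmoothHolo S F
  allDec : AllDec (𝓟 S) F

section Abstract

variable {E : Type*} [NormedAddCommGroup E] [NormedSpace ℝ E]

lemma norm_iteratedFDeriv_add_le {F G : E → ℂ} {S : Set E} (hS : IsOpen S)
    (hF : ContDiffOn ℝ ∞ F S) (hG : ContDiffOn ℝ ∞ G S) {x : E} (hx : x ∈ S) (k : ℕ) :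
    ‖iteratedFDeriv ℝ k (F + G) x‖ ≤ ‖iteratedFDeriv ℝ k F x‖ + ‖iteratedFDeriv ℝ k G x‖ := by
  have hk : (k : ℕ∞ω) ≤ ∞ := by exact_mod_cast le_top
  rw [iteratedFDeriv_add_apply ((hF.contDiffAt (hS.mem_nhds hx)).of_le hk)
    ((hG.contDiffAt (hS.mem_nhds hx)).of_le hk)]
  exact norm_add_le _ _

lemma norm_iteratedFDeriv_neg (F : E → ℂ) (k : ℕ) (x : E) :
    ‖iteratedFDeriv ℝ k (-F) x‖ = ‖iteratedFDeriv ℝ k F x‖ := by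
  rw [iteratedFDeriv_neg, Pi.neg_apply, norm_neg]

lemma norm_iteratedFDeriv_congr {F G : E → ℂ} {S : Set E} (hS : IsOpen S) (h : EqOn F G S)
    {x : E} (hx : x ∈ S) (k : ℕ) : ‖iteratedFDeriv ℝ k F x‖ = ‖iteratedFDeriv ℝ k G x‖ := by
  rw [← iteratedFDerivWithin_of_isOpen k hS hx, ← iteratedFDerivWithin_of_isOpen k hS hx,
    iteratedFDerivWithin_congr h hx]

lemma norm_iteratedFDeriv_eq_zero {F : E → ℂ} {S : Set E} (hS : IsOpen S) (h : EqOn F 0 S)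
    {x : E} (hx : x ∈ S) (k : ℕ) : ‖iteratedFDeriv ℝ k F x‖ = 0 := by
  rw [norm_iteratedFDeriv_congr hS h hx, iteratedFDeriv_zero]
  simp

lemma exists_norm_iteratedFDeriv_cutoff_le {χ : ℂ → ℂ} (hχ : ContDiff ℝ ∞ χ)
    (hc : HasCompactSupport χ) (l : E →L[ℝ] ℂ) (k : ℕ) :
    ∃ C : ℝ, ∀ x, ‖iteratedFDeriv ℝ k (χ ∘ l) x‖ ≤ C := by
  have hk : (k : ℕ∞ω) ≤ ∞ := by exact_mod_cast le_top
  obtain ⟨C, hC⟩ := (hc.iteratedFDeriv (𝕜 := ℝ) k).exists_bound_of_continuous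
    (hχ.continuous_iteratedFDeriv hk)
  refine ⟨C * ‖l‖ ^ k, fun x => ?_⟩
  rw [l.iteratedFDeriv_comp_right hχ x hk]
  refine (ContinuousMultilinearMap.norm_compContinuousLinearMap_le _ _).trans ?_
  simp only [Finset.prod_const, Finset.card_univ, Fintype.card_fin]
  gcongr
  exact hC _

end Abstract

namespace UnifNull

variable {S : Set (Coord n)} {F G : Coord n → ℂ}

lemma mono {S' : Set (Coord n)} (h : UnifNull S F) (hS : S' ⊆ S) : UnifNull S' F :=
  ⟨h.1.mono hS, fun k => (h.2 k).mono (principal_mono.2 hS)⟩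

lemma add (hS : IsOpen S) (hF : UnifNull S F) (hG : UnifNull S G) : UnifNull S (F + G) := by
  refine ⟨hF.1.add hG.1, fun k => ((hF.2 k).add (hG.2 k)).of_isBigO (IsBigO.of_bound 1 ?_)⟩
  refine eventually_principal.2 fun x hx => ?_
  exact norm_le_mul_norm_of_nonneg (norm_iteratedFDeriv_nonneg _ _ _)
    (add_nonneg (norm_iteratedFDeriv_nonneg _ _ _) (norm_iteratedFDeriv_nonneg _ _ _))
    (by rw [one_mul]; exact norm_iteratedFDeriv_add_le hS hF.1.1 hG.1.1 hx k)

lemma neg (hF : UnifNull S F) : UnifNull S (-F) := by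
  refine ⟨hF.1.neg, fun k => ?_⟩
  have h := hF.2 k
  simp only [← norm_iteratedFDeriv_neg F] at h
  exact h

lemma combDeriv (hS : IsOpen S) (hF : UnifNull S F) (a b : ℂ) (v w : Coord n) :
    UnifNull S (combDeriv a b v w F) := by
  refine ⟨hF.1.combDeriv hS _ _ _ _, fun k => ?_⟩
  obtain ⟨c, hc⟩ := exists_norm_iteratedFDeriv_comb_le a b v w
  refine (hF.2 (k + 1)).of_isBigO (IsBigO.of_bound c (eventually_principal.2 fun x hx => ?_))
  exact norm_le_mul_norm_of_nonneg (norm_iteratedFDeriv_nonneg _ _ _)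
    (norm_iteratedFDeriv_nonneg _ _ _) (hc k S F hS hF.1.1 x hx)

lemma dzbar (hS : IsOpen S) (hF : UnifNull S F) (j : Fin n) : UnifNull S (Symb.dzbar j F) := by
  rw [dzbar_eq]
  exact hF.combDeriv hS _ _ _ _

lemma congr (hS : IsOpen S) (hF : UnifNull S F) (h : EqOn F G S) : UnifNull S G := by
  refine ⟨hF.1.congr hS h, fun k => (hF.2 k).congr' (eventually_principal.2 fun x hx => ?_)⟩
  exact norm_iteratedFDeriv_congr hS h hx k

lemma nullGerm {p : Coord n} (hS : IsOpen S) (hp : S ∈ dirInf p) (h : UnifNull S F) :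
    NullGerm p F :=
  nullGerm_iff.2 ⟨⟨S, hS, hp, h.1⟩, fun k => (h.2 k).mono (le_principal_iff.2 hp)⟩

end UnifNull

/-! ### Solving `∂u/∂z̄_k = G` -/

/-- The complex line in the direction of `z_k`. -/
def lineMap (k : Fin n) : ℂ →L[ℝ] Coord n :=
  (ContinuousLinearMap.toSpanSingleton ℂ
    ((EuclideanSpace.single k 1, 0) : Coord n)).restrictScalars ℝ

/-- The coordinate `z_k`. -/
def coordMap (k : Fin n) : Coord n →L[ℝ] ℂ :=
  ((EuclideanSpace.proj k : Cn n →L[ℂ] ℂ).comp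
    (ContinuousLinearMap.fst ℂ (Cn n) (CnDual n))).restrictScalars ℝ

lemma coordMap_apply (k : Fin n) (p : Coord n) : coordMap k p = p.1 k := rfl

lemma lineMap_apply (k : Fin n) (w : ℂ) : lineMap k w = (EuclideanSpace.single k w, 0) := by
  refine Prod.ext ?_ (by ext; simp [lineMap])
  ext i
  by_cases h : i = k <;> simp [lineMap, h]

lemma coordMap_lineMap (k : Fin n) (w : ℂ) : coordMap k (lineMap k w) = w := by
  rw [lineMap_apply, coordMap_apply]
  simp

lemma dzbar_cauchyTransform {k : Fin n} {Ω : Set (Coord n)} {c : ℂ} {ρ : ℝ} {ψ : Coord n → ℂ}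
    (h : TubeSupported (lineMap k) (coordMap k) Ω c ρ ψ) :
    EqOn (dzbar k (cauchyTransform (lineMap k) ψ)) ψ Ω := by
  intro p hp
  rw [← h.dbar_cauchyTransform hp, lineMap_apply, lineMap_apply, dzbar]

lemma cauchyTransform_const_mul {k : Fin n} {Ω : Set (Coord n)} {ψ₁ ψ₂ : Coord n → ℂ} {b : ℂ}
    {p : Coord n} (hΩ : ∀ w, p - lineMap k w ∈ Ω) (h : ∀ q ∈ Ω, ψ₁ q = b * ψ₂ q) :
    cauchyTransform (lineMap k) ψ₁ p = b * cauchyTransform (lineMap k) ψ₂ p := by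
  have e : ∀ w : ℂ, w⁻¹ * ψ₁ (p - lineMap k w) = b * (w⁻¹ * ψ₂ (p - lineMap k w)) := fun w => by
    rw [h _ (hΩ w)]
    ring
  simp only [cauchyTransform, e, integral_const_mul]
  ring

/-- An equation `∂_v ψ + b ∂_w ψ = 0` is inherited by the Cauchy transform. -/
lemma combDeriv_cauchyTransform_eq_zero {k : Fin n} {Ω : Set (Coord n)} {c : ℂ} {ρ : ℝ}
    {ψ : Coord n → ℂ} (h : TubeSupported (lineMap k) (coordMap k) Ω c ρ ψ) {a b : ℂ} (ha : a ≠ 0)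
    {v w : Coord n} (h0 : EqOn (combDeriv a b v w ψ) 0 Ω) :
    EqOn (combDeriv a b v w (cauchyTransform (lineMap k) ψ)) 0 Ω := by
  intro p hp
  -- Solving the equation for one of the two derivatives reduces the claim to pulling a constant out
  -- of an integral, for which no integrability is needed.
  have h1 : cauchyTransform (lineMap k) (fun q => fderiv ℝ ψ q v) p =
      (-(b / a)) * cauchyTransform (lineMap k) (fun q => fderiv ℝ ψ q w) p := by
    refine cauchyTransform_const_mul (fun w => h.sub_mem hp w) fun q hq => ?_
    have h2 := h0 hq
    simp only [combDeriv, Pi.zero_apply] at h2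
    field_simp
    linear_combination h2
  rw [combDeriv, h.fderiv_cauchyTransform hp, h.fderiv_cauchyTransform hp, h1, Pi.zero_apply]
  field_simp
  ring

/-- The integration moves only `z_k`, so `|ζ|` and the decaying weight are constant along it; this
settles order zero. Higher orders follow because derivatives commute with the transform. -/
lemma dec_iteratedFDeriv_cauchyTransform {k : Fin n} {Ω S : Set (Coord n)} {c : ℂ} {ρ : ℝ}
    (hSΩ : S ⊆ Ω) (hS : ∀ p ∈ S, ‖coordMap k p - c‖ ≤ ρ) (m : ℕ) {ψ : Coord n → ℂ}
    (h : TubeSupported (lineMap k) (coordMap k) Ω c ρ ψ) (hψ : AllDec (𝓟 Ω) ψ) :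
    Dec (𝓟 S) (fun x => ‖iteratedFDeriv ℝ m (cauchyTransform (lineMap k) ψ) x‖) := by
  induction m generalizing ψ with
  | zero =>
    have h0 := hψ 0
    simp only [norm_iteratedFDeriv_zero] at h0 ⊢
    obtain ⟨d, hd, H⟩ := h0
    obtain ⟨C, hC⟩ := isBigO_principal.1 H
    refine ⟨d, hd, isBigO_principal.2
      ⟨Real.pi⁻¹ * (∫ w in Metric.closedBall (0 : ℂ) (ρ + ρ), ‖w⁻¹‖) * C, fun p hp => ?_⟩⟩
    rw [norm_norm, mul_assoc]
    refine h.norm_cauchyTransform_le (hSΩ hp) (hS p hp) fun w => ?_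
    have h1 := hC _ (h.sub_mem (hSΩ hp) w)
    have h2 : (p - lineMap k w).2 = p.2 := by
      rw [lineMap_apply]
      exact sub_zero p.2
    rwa [norm_norm, h2] at h1
  | succ m ih =>
    obtain ⟨ι, hι, b, d, H⟩ := exists_norm_iteratedFDeriv_succ_le (Coord n) m
    have hall : ∀ v, AllDec (𝓟 Ω) (fun q => fderiv ℝ ψ q v) := by
      intro v i
      obtain ⟨e, he⟩ := exists_norm_iteratedFDeriv_comb_le 1 0 v v
      refine (hψ (i + 1)).of_isBigO (IsBigO.of_bound e (eventually_principal.2 fun x hx => ?_))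
      have h1 := he i Ω ψ h.isOpen h.smooth x hx
      simp only [one_mul, zero_mul, add_zero] at h1
      exact norm_le_mul_norm_of_nonneg (norm_iteratedFDeriv_nonneg _ _ _)
        (norm_iteratedFDeriv_nonneg _ _ _) h1
    have hsum := Dec.sum Finset.univ (l := 𝓟 S) (F := fun i x => d i *
      ‖iteratedFDeriv ℝ m (cauchyTransform (lineMap k) fun q => fderiv ℝ ψ q (b i)) x‖) fun i _ =>
        (ih (h.fderiv_apply (b i)) (hall (b i))).of_isBigO ((isBigO_refl _ _).const_mul_left _)
    refine hsum.of_isBigO (IsBigO.of_bound 1 (eventually_principal.2 fun x hx => ?_))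
    rw [one_mul]
    refine (Real.norm_of_nonneg (norm_iteratedFDeriv_nonneg _ _ _)).le.trans
      (((H Ω _ h.isOpen h.contDiffOn_cauchyTransform x (hSΩ hx)).trans (le_of_eq ?_)).trans
        (le_abs_self _))
    refine Finset.sum_congr rfl fun i _ => ?_
    rw [norm_iteratedFDeriv_congr h.isOpen
      (fun q hq => h.fderiv_cauchyTransform hq (b i)) (hSΩ hx)]

end Symb

namespace Symb

open Filter Asymptotics

variable {n : ℕ}

/-! ### Cutting off in one variable -/

/-- The outer radius is kept strictly below `r`, so that a product with the cutoff can be extended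
by zero past the boundary of the polydisc. -/
lemma exists_cutoff (c : ℂ) {r : ℝ} (hr : 0 < r) :
    ∃ χ : ℂ → ℂ, ContDiff ℝ ∞ χ ∧ HasCompactSupport χ ∧ (∀ w, ‖w - c‖ < r / 2 → χ w = 1) ∧
      ∀ w, 3 / 4 * r < ‖w - c‖ → χ w = 0 := by
  let f : ContDiffBump c := ⟨r / 2, 3 / 4 * r, by positivity, by linarith⟩
  refine ⟨fun w => (f w : ℂ), Complex.ofRealCLM.contDiff.comp f.contDiff, ?_, fun w hw => ?_,
    fun w hw => ?_⟩
  · exact f.hasCompactSupport.comp_left (g := Complex.ofReal) Complex.ofReal_zero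
  · beta_reduce
    rw [f.one_of_mem_closedBall (by rw [mem_closedBall_iff_norm]; exact hw.le), Complex.ofReal_one]
  · beta_reduce
    rw [f.zero_of_le_dist (by rw [dist_eq_norm]; exact hw.le), Complex.ofReal_zero]

lemma Dec.sup {E : Type*} [NormedAddCommGroup E] {l l' : Filter (Coord n)} {F : Coord n → E}
    (h : Dec l F) (h' : Dec l' F) : Dec (l ⊔ l') F := by
  obtain ⟨a, ha, H⟩ := h
  obtain ⟨b, hb, H'⟩ := h'
  exact ⟨min a b, lt_min ha hb, (H.trans (exp_decay_isBigO (min_le_left _ _))).sup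
    (H'.trans (exp_decay_isBigO (min_le_right _ _)))⟩

/-- The product of a polydisc and a set of covectors. -/
def polyTube (z₀ : Cn n) (r : ℝ) (T : Set (CnDual n)) : Set (Coord n) :=
  {p | (∀ j, ‖p.1 j - z₀ j‖ < r) ∧ p.2 ∈ T}

/-- The product of a cylinder in the direction of `z_k` and a set of covectors. -/
def cylTube (k : Fin n) (z₀ : Cn n) (r : ℝ) (T : Set (CnDual n)) : Set (Coord n) :=
  {p | (∀ j, j ≠ k → ‖p.1 j - z₀ j‖ < r) ∧ p.2 ∈ T}

section Tubes

variable {z₀ : Cn n} {r : ℝ} {T : Set (CnDual n)}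

lemma isOpen_polyTube (hT : IsOpen T) : IsOpen (polyTube z₀ r T) := by
  have : polyTube z₀ r T = (⋂ j, {p : Coord n | ‖p.1 j - z₀ j‖ < r}) ∩ Prod.snd ⁻¹' T := by
    ext p
    simp [polyTube]
  rw [this]
  exact (isOpen_iInter_of_finite fun j => isOpen_lt (by fun_prop) continuous_const).inter
    (hT.preimage continuous_snd)

lemma isOpen_cylTube (k : Fin n) (hT : IsOpen T) : IsOpen (cylTube k z₀ r T) := by
  have : cylTube k z₀ r T =
      (⋂ j, {p : Coord n | j ≠ k → ‖p.1 j - z₀ j‖ < r}) ∩ Prod.snd ⁻¹' T := by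
    ext p
    simp [cylTube]
  rw [this]
  refine (isOpen_iInter_of_finite fun j => ?_).inter (hT.preimage continuous_snd)
  by_cases h : j = k
  · simp [h]
  · simp only [ne_eq, h, not_false_eq_true, forall_const]
    exact isOpen_lt (by fun_prop) continuous_const

lemma polyTube_subset_cylTube (k : Fin n) : polyTube z₀ r T ⊆ cylTube k z₀ r T :=
  fun _ hp => ⟨fun j _ => hp.1 j, hp.2⟩

lemma polyTube_mono {r' : ℝ} (h : r' ≤ r) : polyTube z₀ r' T ⊆ polyTube z₀ r T :=
  fun _ hp => ⟨fun j => (hp.1 j).trans_le h, hp.2⟩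

/-- The part of the cylinder on which a cutoff function vanishes. -/
def outerTube (k : Fin n) (z₀ : Cn n) (r : ℝ) (T : Set (CnDual n)) : Set (Coord n) :=
  cylTube k z₀ r T ∩ {p | 3 / 4 * r < ‖p.1 k - z₀ k‖}

lemma isOpen_outerTube (k : Fin n) (hT : IsOpen T) : IsOpen (outerTube k z₀ r T) :=
  (isOpen_cylTube k hT).inter (isOpen_lt continuous_const (by fun_prop))

/-- The two open pieces are the ones used for every property of a cut-off function: on the first the
hypotheses on `G` apply, on the second the product is zero. -/
lemma cylTube_subset (k : Fin n) (hr : 0 < r) :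
    cylTube k z₀ r T ⊆ polyTube z₀ r T ∪ outerTube k z₀ r T := by
  intro p hp
  by_cases h : ‖p.1 k - z₀ k‖ < r
  · refine Or.inl ⟨fun j => ?_, hp.2⟩
    by_cases hj : j = k
    · rwa [hj]
    · exact hp.1 j hj
  · exact Or.inr ⟨hp, by simp only [mem_ofPred_eq]; linarith⟩

variable {χ : ℂ → ℂ} {G : Coord n → ℂ} {k : Fin n}

lemma tubeSupported_cutoff (hT : IsOpen T) (hr : 0 < r) (hχ : ContDiff ℝ ∞ χ)
    (hχ0 : ∀ w, 3 / 4 * r < ‖w - z₀ k‖ → χ w = 0) (hG : ContDiffOn ℝ ∞ G (polyTube z₀ r T)) :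
    TubeSupported (lineMap k) (coordMap k) (cylTube k z₀ r T) (z₀ k) r
      (fun p => χ (coordMap k p) * G p) where
  coord := coordMap_lineMap k
  isOpen := isOpen_cylTube k hT
  add_mem p hp w := by
    rw [lineMap_apply]
    refine ⟨fun j hj => ?_, ?_⟩
    · simpa [hj] using hp.1 j hj
    · have : (p + (EuclideanSpace.single k w, 0)).2 = p.2 := add_zero p.2
      rw [this]
      exact hp.2
  smooth p hp := by
    rcases cylTube_subset k hr hp with h | h
    · exact (((hχ.comp (coordMap k).contDiff).contDiffAt).mul
        (hG.contDiffAt ((isOpen_polyTube hT).mem_nhds h))).contDiffWithinAt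
    · refine ((contDiffAt_const (c := (0 : ℂ))).congr_of_eventuallyEq ?_).contDiffWithinAt
      filter_upwards [(isOpen_outerTube k hT).mem_nhds h] with q hq
      rw [coordMap_apply, hχ0 _ hq.2, zero_mul]
  support p hp hl := by
    rw [hχ0 _ (lt_trans (by linarith) hl), zero_mul]

/-- The cutoff depends on `z_k` only, so derivatives in directions with vanishing `k`-th coordinate
do not see it. -/
lemma combDeriv_cutoff_eq_zero (hT : IsOpen T) (hr : 0 < r) (hχ : ContDiff ℝ ∞ χ)
    (hχ0 : ∀ w, 3 / 4 * r < ‖w - z₀ k‖ → χ w = 0) (hG : ContDiffOn ℝ ∞ G (polyTube z₀ r T))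
    {a b : ℂ} {v w : Coord n} (hv : v.1 k = 0) (hw : w.1 k = 0)
    (h0 : EqOn (combDeriv a b v w G) 0 (polyTube z₀ r T)) :
    EqOn (combDeriv a b v w (fun p => χ (coordMap k p) * G p)) 0 (cylTube k z₀ r T) := by
  intro p hp
  rcases cylTube_subset k hr hp with h | h
  · have h1 : HasFDerivAt (fun p => χ (coordMap k p))
        ((fderiv ℝ χ (coordMap k p)).comp (coordMap k)) p :=
      ((hχ.differentiable (by simp)).differentiableAt.hasFDerivAt).comp p (coordMap k).hasFDerivAt
    have h2 : HasFDerivAt G (fderiv ℝ G p) p :=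
      ((hG.contDiffAt ((isOpen_polyTube hT).mem_nhds h)).differentiableAt (by simp)).hasFDerivAt
    have h3 := h0 h
    have h4 : ∀ v : Coord n, v.1 k = 0 →
        fderiv ℝ (fun p => χ (coordMap k p) * G p) p v = χ (coordMap k p) * fderiv ℝ G p v := by
      intro v hv
      rw [(h1.fun_mul h2).fderiv]
      have : coordMap k v = 0 := hv
      simp [this]
    simp only [combDeriv, Pi.zero_apply] at h3 ⊢
    rw [h4 v hv, h4 w hw]
    linear_combination χ (coordMap k p) * h3
  · refine ((localOp_combDeriv a b v w).congr _ _ 0 (isOpen_outerTube k hT) (fun q hq => ?_)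
      h).trans ?_
    · rw [coordMap_apply, hχ0 _ hq.2, zero_mul, Pi.zero_apply]
    · rw [(localOp_combDeriv a b v w).zero]

/-- Leibniz' rule on the polydisc, where all derivatives of the cutoff are bounded; on the outer
piece the product vanishes. -/
lemma allDec_cutoff (hT : IsOpen T) (hr : 0 < r) (hχ : ContDiff ℝ ∞ χ) (hc : HasCompactSupport χ)
    (hχ0 : ∀ w, 3 / 4 * r < ‖w - z₀ k‖ → χ w = 0) (hG : UnifNull (polyTube z₀ r T) G) :
    AllDec (𝓟 (cylTube k z₀ r T)) (fun p => χ (coordMap k p) * G p) := by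
  intro m
  have hle : 𝓟 (cylTube k z₀ r T) ≤ 𝓟 (polyTube z₀ r T) ⊔ 𝓟 (outerTube k z₀ r T) := by
    rw [sup_principal]
    exact principal_mono.2 (cylTube_subset k hr)
  refine (Dec.sup ?_ ?_).mono hle
  · choose C hC using fun i => exists_norm_iteratedFDeriv_cutoff_le hχ hc (coordMap (n := n) k) i
    have hsum := Dec.sum (Finset.range (m + 1)) (l := 𝓟 (polyTube z₀ r T)) (F := fun i x =>
      (m.choose i : ℝ) * C i * ‖iteratedFDeriv ℝ (m - i) G x‖) fun i _ =>
        (hG.2 (m - i)).of_isBigO ((isBigO_refl _ _).const_mul_left _)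
    refine hsum.of_isBigO (IsBigO.of_bound 1 (eventually_principal.2 fun x hx => ?_))
    rw [one_mul]
    refine (Real.norm_of_nonneg (norm_iteratedFDeriv_nonneg _ _ _)).le.trans
      (((norm_iteratedFDeriv_mul_le_of_isOpen (isOpen_polyTube hT)
        (hχ.comp (coordMap k).contDiff).contDiffOn hG.1.1 hx m).trans ?_).trans (le_abs_self _))
    refine Finset.sum_le_sum fun i _ => ?_
    exact mul_le_mul_of_nonneg_right (mul_le_mul_of_nonneg_left (hC i x) (Nat.cast_nonneg _))
      (norm_iteratedFDeriv_nonneg _ _ _)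
  · refine (dec_zero (E := ℝ)).congr' (eventually_principal.2 fun x hx => ?_)
    refine (norm_iteratedFDeriv_eq_zero (isOpen_outerTube k hT) (fun q hq => ?_) hx m).symm
    rw [coordMap_apply, hχ0 _ hq.2, zero_mul, Pi.zero_apply]

/-- The equation `∂u/∂z̄_k = G` is solvable on a smaller polydisc, with the same control in the
other variables. -/
lemma exists_dzbar_eq (hT : IsOpen T) (hr : 0 < r) (k : Fin n)
    (hG : UnifNull (polyTube z₀ r T) G) :
    ∃ u, UnifNull (polyTube z₀ r T) u ∧ EqOn (dzbar k u) G (polyTube z₀ (r / 2) T) ∧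
      ∀ j, j ≠ k → EqOn (dzbar j G) 0 (polyTube z₀ r T) →
        EqOn (dzbar j u) 0 (polyTube z₀ r T) := by
  obtain ⟨χ, hχ, hc, hχ1, hχ0⟩ := exists_cutoff (z₀ k) hr
  have hS := isOpen_polyTube (z₀ := z₀) (r := r) hT
  have h := tubeSupported_cutoff hT hr hχ hχ0 hG.1.1
  have hsub := polyTube_subset_cylTube (z₀ := z₀) (r := r) (T := T) k
  -- Equations that do not involve `z_k` survive both the cutoff and the transform. This gives
  -- holomorphy in `ζ` as well as the equations in the other `z̄_j`.
  have hzero : ∀ {a b : ℂ} (_ : a ≠ 0) {v w : Coord n}, v.1 k = 0 → w.1 k = 0 →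
      EqOn (combDeriv a b v w G) 0 (polyTube z₀ r T) → EqOn (combDeriv a b v w
        (cauchyTransform (lineMap k) fun p => χ (coordMap k p) * G p)) 0 (polyTube z₀ r T) :=
    fun ha _ _ hv hw h0 => (combDeriv_cauchyTransform_eq_zero h ha
      (combDeriv_cutoff_eq_zero hT hr hχ hχ0 hG.1.1 hv hw h0)).mono hsub
  refine ⟨cauchyTransform (lineMap k) fun p => χ (coordMap k p) * G p, ⟨?_, fun m => ?_⟩,
    fun p hp => ?_, fun j hj h0 => ?_⟩
  · refine (smoothHolo_iff hS).2 ⟨h.contDiffOn_cauchyTransform.mono hsub, fun η => ?_⟩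
    exact hzero one_ne_zero rfl rfl (((smoothHolo_iff hS).1 hG.1).2 η)
  · exact dec_iteratedFDeriv_cauchyTransform hsub (fun p hp => (hp.1 k).le) m h
      (allDec_cutoff hT hr hχ hc hχ0 hG)
  · rw [dzbar_cauchyTransform h (hsub (polyTube_mono (by linarith) hp))]
    beta_reduce
    rw [coordMap_apply, hχ1 _ (hp.1 k), one_mul]
  · rw [dzbar_eq] at h0 ⊢
    exact hzero (by norm_num) (by simp [hj.symm]) (by simp [hj.symm]) h0

/-- If the `∂F/∂z̄_j` decay exponentially, then `F` can be corrected by an exponentially decaying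
function to be holomorphic in `z`. -/
lemma exists_dbar_solution (hT : IsOpen T) (hr : 0 < r) {F : Coord n → ℂ}
    (hF : SmoothHolo (polyTube z₀ r T) F) (hd : ∀ j, UnifNull (polyTube z₀ r T) (dzbar j F)) :
    ∃ r', 0 < r' ∧ r' ≤ r ∧ ∃ u, UnifNull (polyTube z₀ r' T) u ∧
      ∀ j, EqOn (dzbar j (F + u)) 0 (polyTube z₀ r' T) := by
  -- Induction on the number of variables in which the equations are already solved; each step
  -- halves the polydisc.
  have key : ∀ m ≤ n, ∃ r', 0 < r' ∧ r' ≤ r ∧ ∃ u, UnifNull (polyTube z₀ r' T) u ∧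
      ∀ j : Fin n, j.1 < m → EqOn (dzbar j (F + u)) 0 (polyTube z₀ r' T) := by
    intro m hm
    induction m with
    | zero =>
      refine ⟨r, hr, le_rfl, 0, ⟨⟨contDiffOn_const, fun _ _ => differentiableAt_const 0⟩,
        fun k => (dec_zero (E := ℝ)).congr' (Eventually.of_forall fun x => ?_)⟩, by simp⟩
      exact (norm_iteratedFDeriv_eq_zero isOpen_univ (eqOn_refl _ _) (mem_univ x) k).symm
    | succ m ih =>
      obtain ⟨r', hr', hle, u, hu, H⟩ := ih (by omega)
      have hS := isOpen_polyTube (z₀ := z₀) (r := r') hT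
      have hF' := hF.mono (polyTube_mono (z₀ := z₀) (T := T) hle)
      let k : Fin n := ⟨m, hm⟩
      have hG : UnifNull (polyTube z₀ r' T) (dzbar k (F + u)) :=
        (((hd k).mono (polyTube_mono hle)).add hS (hu.dzbar hS k)).congr hS
          ((localOp_dzbar k).add _ F u hS hF'.1 hu.1.1).symm
      obtain ⟨v, hv, hvk, hvj⟩ := exists_dzbar_eq hT hr' k hG
      have hsub : polyTube z₀ (r' / 2) T ⊆ polyTube z₀ r' T := polyTube_mono (by linarith)
      -- Here `v` solves `∂v/∂z̄_k = ∂(F + u)/∂z̄_k` on the smaller polydisc, so `-v` removes this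
      -- derivative. For `j < m` the right-hand side is killed by `∂/∂z̄_j`, hence so is `v`, and
      -- the equations already solved persist.
      refine ⟨r' / 2, by positivity, by linarith, u + -v, (hu.add hS hv.neg).mono hsub,
        fun j hj p hp => ?_⟩
      have e := (localOp_dzbar j).add _ (F + u) (-v) hS (hF'.1.add hu.1.1) hv.1.1.neg (hsub hp)
      rw [← add_assoc, e, (localOp_dzbar j).neg, Pi.add_apply, Pi.neg_apply, Pi.zero_apply]
      rcases Nat.lt_succ_iff_lt_or_eq.1 hj with hj | hj
      · have hjk : j ≠ k := fun h => by simp [h, k] at hj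
        have h0 : EqOn (dzbar j (dzbar k (F + u))) 0 (polyTube z₀ r' T) := by
          have hcomm : CommOps (n := n) (dzbar j) (dzbar k) := by
            rw [dzbar_eq, dzbar_eq]
            exact commOps_combDeriv _ _ _ _ _ _ _ _
          refine (hcomm _ _ hS (hF'.1.add hu.1.1)).trans
            (((localOp_dzbar k).congr _ _ _ hS (H j hj)).trans ?_)
          rw [(localOp_dzbar k).zero]
          exact eqOn_refl _ _
        rw [H j hj (hsub hp), hvj j hjk h0 (hsub hp)]
        simp
      · obtain rfl : j = k := Fin.ext hj
        rw [hvk hp, add_neg_cancel]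
  obtain ⟨r', hr', hle, u, hu, H⟩ := key n le_rfl
  exact ⟨r', hr', hle, u, hu, fun j => H j j.2⟩

end Tubes

/-- A smooth function that is holomorphic in `ζ` and satisfies the Cauchy–Riemann equations in `z`
is holomorphic. -/
lemma SmoothHolo.differentiableOn {W : Set (Coord n)} (hW : IsOpen W) {F : Coord n → ℂ}
    (hF : SmoothHolo W F) (h : ∀ j, EqOn (Symb.dzbar j F) 0 W) : DifferentiableOn ℂ F W := by
  intro x hx
  refine (differentiableAt_of_map_I_smul ((hF.1.contDiffAt (hW.mem_nhds hx)).differentiableAt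
    (by simp)) fun v => ?_).differentiableWithinAt
  obtain ⟨a, η⟩ := v
  have h1 := ((smoothHolo_iff hW).1 hF).2 η hx
  have h2 := congrFun (dirDeriv_eq_sum a η F) x
  have h3 := congrFun (dirDeriv_eq_sum (Complex.I • a) (Complex.I • η) F) x
  have h4 : ∀ j, Symb.dzbar j F x = 0 := fun j => h j hx
  simp only [Symb.combDeriv, Pi.zero_apply] at h1
  simp only [Symb.dirDeriv, Pi.add_apply, Finset.sum_apply, h4, mul_zero, add_zero,
    PiLp.smul_apply, smul_eq_mul] at h2 h3
  have e : Complex.I • ((a, η) : Coord n) = (Complex.I • a, Complex.I • η) := rfl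
  rw [e, h2, h3, mul_add, Finset.mul_sum]
  simp only [mul_assoc]
  linear_combination h1

end Symb

namespace Symb

open Filter Asymptotics

variable {n : ℕ}

/-! ### Splitting a symbol of `C^∞`-type locally -/

/-- The covectors `t η` with `t > R` and `η` in a ball. -/
def ballCone (ζ₀ : CnDual n) (ε R : ℝ) : Set (CnDual n) :=
  {ζ | ∃ t : ℝ, R < t ∧ ((t⁻¹ : ℝ) : ℂ) • ζ ∈ Metric.ball ζ₀ ε}

lemma isOpen_ballCone (ζ₀ : CnDual n) (ε R : ℝ) : IsOpen (ballCone ζ₀ ε R) := by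
  have : ballCone ζ₀ ε R =
      ⋃ t ∈ Ioi R, (fun ζ : CnDual n => ((t⁻¹ : ℝ) : ℂ) • ζ) ⁻¹' Metric.ball ζ₀ ε := by
    ext ζ
    simp [ballCone]
  rw [this]
  exact isOpen_biUnion fun t _ => Metric.isOpen_ball.preimage (continuous_const_smul _)

lemma isCone_polyTube_ballCone (z₀ : Cn n) (r : ℝ) (ζ₀ : CnDual n) (ε : ℝ) :
    IsCone (polyTube z₀ r (ballCone ζ₀ ε 0)) := by
  rintro p ⟨hp, t, ht, hpt⟩ s hs
  refine ⟨hp, s * t, mul_pos hs ht, ?_⟩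
  have h1 := dil_dil (n := n) (s * t)⁻¹ s p
  have e : (s * t)⁻¹ * s = t⁻¹ := by field_simp
  rw [e] at h1
  have h2 := congrArg Prod.snd h1
  simp only [dil] at h2
  rw [dil]
  exact h2 ▸ hpt

/-- Truncation is invisible at infinity: a dilation by `s > R / t` carries the parameter `t` beyond
`R`. -/
lemma polyTube_ballCone_mem_dirInf {z₀ : Cn n} {r : ℝ} {ζ₀ : CnDual n} {ε R : ℝ} (hR : 0 < R)
    {p : Coord n} (hp : p ∈ polyTube z₀ r (ballCone ζ₀ ε 0)) :
    polyTube z₀ r (ballCone ζ₀ ε R) ∈ dirInf p := by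
  obtain ⟨hp1, t, ht, hpt⟩ := hp
  have ho : IsOpen ((dil t⁻¹ : Coord n → Coord n) ⁻¹' polyTube z₀ r (Metric.ball ζ₀ ε)) :=
    (isOpen_polyTube Metric.isOpen_ball).preimage (continuous_dil _)
  refine mem_dirInf.2 ⟨_, ho.mem_nhds ⟨hp1, hpt⟩, R / t, by positivity, fun q hq s hs => ?_⟩
  have hs0 : 0 < s := lt_trans (by positivity) hs
  refine ⟨hq.1, s * t, (div_lt_iff₀ ht).1 hs, ?_⟩
  have h1 := dil_dil (n := n) (s * t)⁻¹ s q
  have e : (s * t)⁻¹ * s = t⁻¹ := by field_simp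
  rw [e] at h1
  have h2 := congrArg Prod.snd h1
  have h3 := hq.2
  simp only [dil] at h2 h3
  rw [dil]
  exact h2 ▸ h3

lemma norm_le_card_mul {r : ℝ} (x : Cn n) (h : ∀ j, ‖x j‖ ≤ r) : ‖x‖ ≤ n * r := by
  have e : x = ∑ j, EuclideanSpace.single j (x j) := by
    ext i
    simp
  calc ‖x‖ ≤ ∑ j : Fin n, ‖EuclideanSpace.single j (x j)‖ := by
        conv_lhs => rw [e]
        exact norm_sum_le _ _
    _ ≤ ∑ _j : Fin n, r := Finset.sum_le_sum fun j _ => by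
        rw [EuclideanSpace.single, PiLp.norm_single]
        exact h j
    _ = n * r := by simp

lemma dil_inv_mem_closedBall {p₀ p : Coord n} {ε r t : ℝ} (hr : n * r ≤ ε)
    (hp : ∀ j, ‖p.1 j - p₀.1 j‖ < r) (ht : ((t⁻¹ : ℝ) : ℂ) • p.2 ∈ Metric.ball p₀.2 ε) :
    dil t⁻¹ p ∈ Metric.closedBall p₀ ε := by
  rw [Metric.mem_closedBall, Prod.dist_eq, max_le_iff]
  refine ⟨?_, (Metric.mem_ball.1 ht).le⟩
  rw [dist_eq_norm]
  exact (norm_le_card_mul _ fun j => (hp j).le).trans hr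

lemma continuousOn_norm_iteratedFDeriv {E : Type*} [NormedAddCommGroup E] [NormedSpace ℝ E]
    {F : E → ℂ} {W : Set E} (hW : IsOpen W) (hF : ContDiffOn ℝ ∞ F W) (k : ℕ) :
    ContinuousOn (fun x => ‖iteratedFDeriv ℝ k F x‖) W :=
  ((hF.continuousOn_iteratedFDerivWithin (m := k) (by exact_mod_cast le_top)
    hW.uniqueDiffOn).congr fun _ hx => (iteratedFDerivWithin_of_isOpen k hW hx).symm).norm

variable {V : Set (Coord n)} (ho : IsOpen V) (hc : IsCone V) (hV : ∀ p ∈ V, p.2 ≠ 0)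

include ho hc hV

/-- Near a point of `V`, a symbol of `C^∞`-type differs from a holomorphic function by a null-symbol
of `C^∞`-type. -/
lemma IsSymbolInf.exists_splitting {F : Coord n → ℂ} (hF : IsSymbolInf V F) {p₀ : Coord n}
    (hp₀ : p₀ ∈ V) : ∃ V₀ ⊆ V, IsOpen V₀ ∧ IsCone V₀ ∧ p₀ ∈ V₀ ∧
      ∃ u, ∀ p ∈ V₀, NullGerm p u ∧ HolGerm p (F + u) := by
  rw [isSymbolInf_iff ho hc hV] at hF
  obtain ⟨ε, hε, hεV⟩ := Metric.nhds_basis_closedBall.mem_iff.1 (ho.mem_nhds hp₀)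
  obtain ⟨W, hW, hw, hs⟩ := exists_wedge_smoothHolo ho hc fun p hp => (hF p hp).1
  have hL : IsCompact (Metric.closedBall p₀ ε) := isCompact_closedBall _ _
  obtain ⟨δ, hδ, Hδ⟩ := hw.2 _ ⟨_, hL, subset_rfl, hεV⟩
  let R := δ + 1
  have hR : 0 < R := by positivity
  have HR : ∀ p ∈ Metric.closedBall p₀ ε, ∀ t : ℝ, R ≤ t → dil t p ∈ W := fun p hp t ht =>
    Hδ p hp t (lt_of_lt_of_le (lt_add_one δ) ht)
  -- With `n * r ≤ ε` the polydisc lies in the Euclidean ball of radius `ε`; the denominator `n + 1`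
  -- also covers `n = 0`.
  let r := ε / (n + 1)
  have hr : 0 < r := by positivity
  have hrn : n * r ≤ ε := by
    have : (n + 1) * r = ε := by simp only [r]; field_simp
    nlinarith
  let S := polyTube p₀.1 r (ballCone p₀.2 ε R)
  have hSdil : ∀ p ∈ S, ∃ q ∈ Metric.closedBall p₀ ε, ∃ t, R ≤ t ∧ p = dil t q := by
    rintro p ⟨hp, t, ht, hpt⟩
    exact ⟨_, dil_inv_mem_closedBall hrn hp hpt, t, ht.le,
      (dil_dil_inv (hR.trans ht).ne' p).symm⟩
  have hSW : S ⊆ W := fun p hp => by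
    obtain ⟨q, hq, t, ht, rfl⟩ := hSdil p hp
    exact HR q hq t ht
  have hT := isOpen_ballCone p₀.2 ε R
  -- All points of `S` are dilates, by factors at least `R`, of points of one compact ball in `V`,
  -- so for each order the rate and the constant can be chosen uniformly on `S`.
  have hnull : ∀ j, UnifNull S (dzbar j F) := by
    intro j
    have hsj : SmoothHolo W (dzbar j F) := by
      rw [dzbar_eq]
      exact hs.combDeriv hW _ _ _ _
    refine ⟨hsj.mono hSW, fun k => ?_⟩
    obtain ⟨h, hh, H⟩ := exists_uniform_decay hL fun p hp => ((hF p (hεV hp)).2.2 j).allDec k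
    have hcont := continuousOn_norm_iteratedFDeriv hW hsj.1 k
    obtain ⟨C, -, HC⟩ := exists_bound_of_isBigO hL HR hcont H
    refine ⟨h, hh, IsBigO.of_bound C (eventually_principal.2 fun p hp => ?_)⟩
    obtain ⟨q, hq, t, ht, rfl⟩ := hSdil p hp
    rw [Real.norm_of_nonneg (Real.exp_nonneg _)]
    exact HC q hq t ht
  obtain ⟨r', hr', hle, u, hu, H⟩ := exists_dbar_solution hT hr (hs.mono hSW) hnull
  have hS' := isOpen_polyTube (z₀ := p₀.1) (r := r') hT
  -- The full cone is taken as `V₀`; near infinity it agrees with the truncated tube on which `u`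
  -- was constructed.
  refine ⟨polyTube p₀.1 r' (ballCone p₀.2 ε 0), ?_, isOpen_polyTube (isOpen_ballCone _ _ _),
    isCone_polyTube_ballCone _ _ _ _, ⟨fun j => by simpa using hr', 1, one_pos, by simpa using hε⟩,
    u, fun p hp => ?_⟩
  · rintro p ⟨hp, t, ht, hpt⟩
    rw [← dil_dil_inv ht.ne' p]
    exact hc _ (hεV (dil_inv_mem_closedBall hrn (fun j => (hp j).trans_le hle) hpt)) t ht
  · have hm := polyTube_ballCone_mem_dirInf hR hp
    refine ⟨hu.nullGerm hS' hm, _, hS', hm, SmoothHolo.differentiableOn hS' ?_ H⟩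
    exact ((hs.mono hSW).mono (polyTube_mono hle)).add hu.1

end Symb

namespace Symb

open Filter Asymptotics

variable {n : ℕ} {X : Type u} [TopologicalSpace X] [ChartedSpace (Cn n) X]

/-! ### Canonical coordinates of a covector -/

/-- The canonical coordinates of a covector in the chart `e`, the inverse of `ofCoord e`. -/
def toCoord (e : OpenPartialHomeomorph X (Cn n)) (P : Cotangent n X) : Coord n :=
  (e P.1, ContinuousLinearMap.comp (P.2 : Cn n →L[ℂ] ℂ)
    (mfderiv 𝓘(ℂ, Cn n) 𝓘(ℂ, Cn n) e.symm (e P.1) : Cn n →L[ℂ] Cn n))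

variable {e e' : OpenPartialHomeomorph X (Cn n)}

lemma mdifferentiable_of_mem_maximalAtlas (he : e ∈ IsManifold.maximalAtlas 𝓘(ℂ, Cn n) ω X) :
    e.MDifferentiable 𝓘(ℂ, Cn n) 𝓘(ℂ, Cn n) :=
  ⟨(contMDiffOn_of_mem_maximalAtlas he).mdifferentiableOn (by simp),
    (contMDiffOn_symm_of_mem_maximalAtlas he).mdifferentiableOn (by simp)⟩

lemma ofCoord_toCoord (he : e ∈ IsManifold.maximalAtlas 𝓘(ℂ, Cn n) ω X) {P : Cotangent n X}
    (hP : P.1 ∈ e.source) : ofCoord e (toCoord e P) = P := by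
  obtain ⟨x, v⟩ := P
  have h := (mdifferentiable_of_mem_maximalAtlas he).symm_comp_deriv hP
  have hx : e.symm (e x) = x := e.left_inv hP
  -- The fibre depends on the base point, so the equality `e.symm (e x) = x` is used through a
  -- variable point `y`.
  have key : ∀ y : X, y = x → (⟨y, (ContinuousLinearMap.comp (v : Cn n →L[ℂ] ℂ)
      (mfderiv 𝓘(ℂ, Cn n) 𝓘(ℂ, Cn n) e.symm (e x) : Cn n →L[ℂ] Cn n)).comp
        (mfderiv 𝓘(ℂ, Cn n) 𝓘(ℂ, Cn n) e y)⟩ : Cotangent n X) = ⟨x, v⟩ := by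
    rintro y rfl
    congr 1
    ext w
    exact congrArg v (DFunLike.congr_fun h w)
  exact key _ hx

lemma ofCoord_snd_eq_zero (e : OpenPartialHomeomorph X (Cn n)) (z : Cn n) :
    ofCoord e (z, 0) = ⟨e.symm z, 0⟩ := by
  rw [ofCoord]
  congr 1

/-- The points of the chart `e'` that lie in the domain of `e`. -/
def overlap (e e' : OpenPartialHomeomorph X (Cn n)) : Set (Cn n) :=
  e'.target ∩ e'.symm ⁻¹' e.source

/-- The change of canonical coordinates from `e'` to `e`. -/
def coordChange (e e' : OpenPartialHomeomorph X (Cn n)) : Coord n → Coord n :=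
  cotMap (e ∘ e'.symm) fun z => fderiv ℂ (e' ∘ e.symm) (e (e'.symm z))

omit [ChartedSpace (Cn n) X] in
lemma isOpen_overlap (e e' : OpenPartialHomeomorph X (Cn n)) : IsOpen (overlap e e') :=
  e'.isOpen_inter_preimage_symm e.open_source

lemma contDiffOn_transition (he : e ∈ IsManifold.maximalAtlas 𝓘(ℂ, Cn n) ω X)
    (he' : e' ∈ IsManifold.maximalAtlas 𝓘(ℂ, Cn n) ω X) :
    ContDiffOn ℂ ω (e ∘ e'.symm) (overlap e e') := by
  rw [← contMDiffOn_iff_contDiffOn]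
  exact (contMDiffOn_of_mem_maximalAtlas he).comp
    ((contMDiffOn_symm_of_mem_maximalAtlas he').mono inter_subset_left) inter_subset_right

omit [ChartedSpace (Cn n) X] in
lemma mapsTo_overlap (e e' : OpenPartialHomeomorph X (Cn n)) :
    MapsTo (e ∘ e'.symm) (overlap e e') (overlap e' e) := fun z hz =>
  ⟨e.map_source hz.2, by
    simp only [Function.comp_apply, mem_preimage, e.left_inv hz.2]
    exact e'.map_target hz.1⟩

lemma contDiffOn_transition_fderiv (he : e ∈ IsManifold.maximalAtlas 𝓘(ℂ, Cn n) ω X)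
    (he' : e' ∈ IsManifold.maximalAtlas 𝓘(ℂ, Cn n) ω X) :
    ContDiffOn ℂ ∞ (fun z => fderiv ℂ (e' ∘ e.symm) (e (e'.symm z))) (overlap e e') :=
  ((contDiffOn_transition he' he).fderiv_of_isOpen (m := ∞) (isOpen_overlap e' e)
    (by simp)).comp ((contDiffOn_transition he he').of_le le_top) (mapsTo_overlap e e')

/-- The chain rule for `e' ∘ e.symm`: covectors transform by the derivative of the inverse
transition map, so the change of coordinates has the form `cotMap`. -/
lemma toCoord_ofCoord_eq (he : e ∈ IsManifold.maximalAtlas 𝓘(ℂ, Cn n) ω X)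
    (he' : e' ∈ IsManifold.maximalAtlas 𝓘(ℂ, Cn n) ω X) {q : Coord n}
    (hq : q.1 ∈ overlap e e') : toCoord e (ofCoord e' q) = coordChange e e' q := by
  refine Prod.ext rfl ?_
  have h1 : e.symm (e (e'.symm q.1)) = e'.symm q.1 := e.left_inv hq.2
  have hd := (mdifferentiable_of_mem_maximalAtlas he).mdifferentiableAt_symm (e.map_source hq.2)
  have hd' : MDifferentiableAt 𝓘(ℂ, Cn n) 𝓘(ℂ, Cn n) e' (e.symm (e (e'.symm q.1))) := by
    rw [h1]
    exact (mdifferentiable_of_mem_maximalAtlas he').mdifferentiableAt (e'.map_target hq.1)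
  have h2 := mfderiv_comp _ hd' hd
  rw [mfderiv_eq_fderiv, h1] at h2
  ext v
  exact congrArg q.2 (DFunLike.congr_fun h2 v).symm

lemma ofCoord_coordChange (he : e ∈ IsManifold.maximalAtlas 𝓘(ℂ, Cn n) ω X)
    (he' : e' ∈ IsManifold.maximalAtlas 𝓘(ℂ, Cn n) ω X) {q : Coord n}
    (hq : q.1 ∈ overlap e e') : ofCoord e (coordChange e e' q) = ofCoord e' q := by
  rw [← toCoord_ofCoord_eq he he' hq]
  exact ofCoord_toCoord he hq.2

variable [IsManifold 𝓘(ℂ, Cn n) ω X]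

/-- In the preferred chart at `P` the trivialization of the tangent bundle is the derivative of the
inverse chart, so these coordinates are the bundle's own. -/
lemma continuousAt_toCoord_chartAt (P : Cotangent n X) :
    ContinuousAt (toCoord (chartAt (Cn n) P.1)) P := by
  have h := (continuousAt_hom_bundle _ (fun Q : Cotangent n X => Q) (x₀ := P)).1 continuousAt_id
  have hs : ∀ᶠ Q : Cotangent n X in 𝓝 P, Q.1 ∈ (chartAt (Cn n) P.1).source :=
    h.1.eventually ((chartAt (Cn n) P.1).open_source.mem_nhds (mem_chart_source _ _))
  refine ContinuousAt.prodMk ?_ ?_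
  · exact ((chartAt (Cn n) P.1).continuousAt (mem_chart_source _ P.1)).comp
      (f := fun Q : Cotangent n X => Q.1) h.1
  · refine h.2.congr ?_
    filter_upwards [hs] with Q hQ
    ext v
    have h2 := TangentBundle.symmL_trivializationAt (I := 𝓘(ℂ, Cn n)) hQ
    rw [modelWithCornersSelf_coe, range_id, mfderivWithin_univ] at h2
    simp only [ContinuousLinearMap.inCoordinates, ContinuousLinearMap.comp_apply]
    rw [h2]
    exact DFunLike.congr_fun
      (Bundle.Trivial.continuousLinearMapAt_trivialization ℂ X ℂ Q.1) _

/-- Any other chart differs from the preferred one by a continuous change of canonical coordinates.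
-/
lemma continuousAt_toCoord (he : e ∈ IsManifold.maximalAtlas 𝓘(ℂ, Cn n) ω X) {P : Cotangent n X}
    (hP : P.1 ∈ e.source) : ContinuousAt (toCoord e) P := by
  have he' := IsManifold.chart_mem_maximalAtlas (I := 𝓘(ℂ, Cn n)) (n := ω) P.1
  have h0 := continuousAt_toCoord_chartAt P
  have hp : ContinuousAt (fun Q : Cotangent n X => Q.1) P :=
    (FiberBundle.continuous_proj _ _).continuousAt
  have hmem : (toCoord (chartAt (Cn n) P.1) P).1 ∈ overlap e (chartAt (Cn n) P.1) :=
    ⟨(chartAt (Cn n) P.1).map_source (mem_chart_source _ _), by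
      simpa [toCoord, (chartAt (Cn n) P.1).left_inv (mem_chart_source _ _)] using hP⟩
  have h1 := continuousAt_cotMap (p := toCoord (chartAt (Cn n) P.1) P)
    (isOpen_overlap e (chartAt (Cn n) P.1)) hmem
    ((contDiffOn_transition he he').of_le le_top) (contDiffOn_transition_fderiv he he')
  refine (ContinuousAt.comp (f := toCoord (chartAt (Cn n) P.1)) h1 h0).congr ?_
  filter_upwards [hp.eventually ((chartAt (Cn n) P.1).open_source.mem_nhds (mem_chart_source _ _)),
    hp.eventually (e.open_source.mem_nhds hP)] with Q hQ hQe
  have hQe' : Q.1 ∈ e.source := hQe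
  have h2 : (toCoord (chartAt (Cn n) P.1) Q).1 ∈ overlap e (chartAt (Cn n) P.1) :=
    ⟨(chartAt (Cn n) P.1).map_source hQ, by
      simpa [toCoord, (chartAt (Cn n) P.1).left_inv hQ] using hQe'⟩
  have h3 := toCoord_ofCoord_eq he he' h2
  rw [ofCoord_toCoord he' hQ] at h3
  exact h3.symm

end Symb

namespace Symb

open Filter Asymptotics

variable {n : ℕ}

/-! ### Replacing germs by equal ones, and symbols over the zero section. -/

section Germs

variable {p : Coord n} {F G : Coord n → ℂ} {S : Set (Coord n)}

lemma HolGerm.congr (hF : HolGerm p F) (hS : IsOpen S) (hp : S ∈ dirInf p) (h : EqOn F G S) :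
    HolGerm p G := by
  obtain ⟨W, o, m, hd⟩ := hF
  exact ⟨W ∩ S, o.inter hS, inter_mem m hp,
    (hd.mono inter_subset_left).congr fun x hx => (h hx.2).symm⟩

lemma NullGerm.congr (hF : NullGerm p F) (hS : IsOpen S) (hp : S ∈ dirInf p) (h : EqOn F G S) :
    NullGerm p G := by
  obtain ⟨⟨W, o, m, s⟩, hd⟩ := hF
  refine ⟨⟨W ∩ S, o.inter hS, inter_mem m hp, (s.mono inter_subset_left).congr (o.inter hS)
    (h.mono inter_subset_right)⟩, fun α β => (hd α β).congr' ?_⟩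
  filter_upwards [hp] with x hx
  exact (localOp_mixed α β).congr S F G hS h hx

lemma NullGerm.dec (hF : NullGerm p F) : Dec (dirInf p) F := by
  have := hF.2 0 0
  rwa [mixed_zero] at this

lemma Infra.congr' {l : Filter (Coord n)} (hF : Infra l F) (h : F =ᶠ[l] G) : Infra l G :=
  fun c hc => h.symm.isBigO.trans (hF c hc)

/-- Off the zero section, a symbol over an open set of the zero section is a symbol. -/
lemma IsZeroSymbol.isSymbol {U : Set (Cn n)} (hU : IsOpen U) (hF : IsZeroSymbol U F)
    {V : Set (Coord n)} (ho : IsOpen V) (hc : IsCone V) (hV : ∀ p ∈ V, p.2 ≠ 0)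
    (hVU : ∀ p ∈ V, p.1 ∈ U) : IsSymbol V F := by
  refine (isSymbol_iff ho hc hV).2 fun p hp =>
    ⟨⟨_, hU.prod isOpen_univ, prod_univ_mem_dirInf hU (hVU p hp), hF.1⟩, ?_⟩
  obtain ⟨K, hK, hpK, hKU⟩ := exists_compact_subset hU (hVU p hp)
  refine infra_of_bounds (prod_univ_mem_dirInf isOpen_interior hpK) fun h hh => ?_
  obtain ⟨C, hC, H⟩ := hF.2 K hK hKU h hh
  exact ⟨C, hC, fun q hq => H q.1 (interior_subset hq.1) q.2⟩

end Germs

/-! ### Sections on `T*X`: inclusions, injectivity and local splitting. -/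

variable {X : Type u} [TopologicalSpace X] [ChartedSpace (Cn n) X] [IsManifold 𝓘(ℂ, Cn n) ω X]

lemma symbols_le_symbolsInf (V : Opens (Conic n X)) : symbols V ≤ symbolsInf V :=
  fun _ hf e he => ⟨(hf e he).1.isSymbolInf (isOpen_punct (isOpen_chartSet he V))
    (isCone_chartSet e V).punct fun _ hp => hp.2, (hf e he).2⟩

lemma nullSymbols_le_nullSymbolsInf (V : Opens (Conic n X)) : nullSymbols V ≤ nullSymbolsInf V :=
  fun _ hf e he => ⟨(hf e he).1.isNullInf (isOpen_punct (isOpen_chartSet he V))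
    (isCone_chartSet e V).punct fun _ hp => hp.2, (hf e he).2⟩

lemma mem_nullSymbols_of_mem_nullSymbolsInf (V : Opens (Conic n X)) (f : Cotangent n X → ℂ)
    (hf : f ∈ symbols V) (hf' : f ∈ nullSymbolsInf V) : f ∈ nullSymbols V :=
  fun e he => ⟨(hf e he).1.isNull_of_isNullInf (isOpen_punct (isOpen_chartSet he V))
    (isCone_chartSet e V).punct (fun _ hp => hp.2) (hf' e he).1, (hf' e he).2⟩

/-- An open cone contains the fibres over its part on the zero section. -/
lemma IsCone.mem_of_mem_zero {V : Set (Coord n)} (hc : IsCone V) (ho : IsOpen V) {z : Cn n}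
    (hz : (z, 0) ∈ V) (ζ : CnDual n) : (z, ζ) ∈ V := by
  -- Small dilates of `(z, ζ)` approach `(z, 0)` and so enter the open set `V`; one of them is then
  -- dilated back.
  have h1 : Tendsto (fun t : ℝ => dil t (z, ζ)) (𝓝[>] 0) (𝓝 (z, 0)) := by
    have h2 : Continuous fun t : ℝ => dil t (z, ζ) := by
      unfold dil
      fun_prop
    have h3 := h2.tendsto 0
    have h4 : dil 0 (z, ζ) = (z, 0) := Prod.ext rfl (by ext; simp [dil])
    rw [h4] at h3
    exact h3.mono_left nhdsWithin_le_nhds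
  obtain ⟨t, ht, ht0⟩ := ((h1.eventually (ho.mem_nhds hz)).and self_mem_nhdsWithin).exists
  rw [← dil_inv_dil (ne_of_gt ht0) (z, ζ)]
  exact hc _ ht _ (inv_pos.2 ht0)

/-- The part of an open cone that consists of the fibres over its part on the zero section. -/
def zeroCone (V : Opens (Conic n X)) : Opens (Conic n X) where
  carrier := {Q : Cotangent n X | (⟨Q.1, 0⟩ : Cotangent n X) ∈ V.1}
  is_open' := ⟨V.2.1.preimage ((Bundle.Trivialization.continuous_zeroSection ℂ).comp
    (FiberBundle.continuous_proj _ _)), fun _ hQ _ _ => hQ⟩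

lemma zeroCone_le (V : Opens (Conic n X)) : zeroCone V ≤ V := by
  rintro ⟨x, v⟩ hQ
  have he := IsManifold.chart_mem_maximalAtlas (I := 𝓘(ℂ, Cn n)) (n := ω) x
  have hs := mem_chart_source (Cn n) x
  generalize chartAt (Cn n) x = e at he hs
  have h1 := (isCone_chartSet e V).mem_of_mem_zero (isOpen_chartSet he V) (z := e x)
    ⟨e.map_source hs, by rw [ofCoord_snd_eq_zero, e.left_inv hs]; exact hQ⟩
    (toCoord e ⟨x, v⟩).2
  have h2 : ofCoord e (toCoord e ⟨x, v⟩) ∈ V.1 := h1.2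
  rwa [ofCoord_toCoord he hs] at h2

/-- Over the zero section both kinds of sections obey the same condition, and over an open set of
the zero section that condition already gives a holomorphic symbol off it. -/
lemma mem_symbols_zeroCone {V : Opens (Conic n X)} {f : Cotangent n X → ℂ}
    (hf : f ∈ symbolsInf V) : f ∈ symbols (zeroCone V) := by
  intro e he
  have hz := (hf e he).2.mono (zeroPart_mono (chartSet_mono e (zeroCone_le V)))
  refine ⟨hz.isSymbol ?_ (isOpen_punct (isOpen_chartSet he _)) (isCone_chartSet e _).punct
    (fun p hp => hp.2) fun p hp => ⟨hp.1.1, ?_⟩, hz⟩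
  · exact (isOpen_chartSet he (zeroCone V)).preimage (Continuous.prodMk_left 0)
  · have := hp.1.2
    rw [ofCoord_snd_eq_zero]
    exact this

/-- The open cone of `T*X` with the coordinates `C` in the chart `e`. -/
def coneOfCoord {e : OpenPartialHomeomorph X (Cn n)}
    (he : e ∈ IsManifold.maximalAtlas 𝓘(ℂ, Cn n) ω X) {C : Set (Coord n)} (hC : IsOpen C)
    (hc : IsCone C) : Opens (Conic n X) where
  carrier := {Q : Cotangent n X | Q.1 ∈ e.source ∧ toCoord e Q ∈ C}
  is_open' := by
    refine ⟨?_, fun Q hQ t ht => ⟨hQ.1, hc _ hQ.2 t ht⟩⟩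
    have hcont : ContinuousOn (toCoord e) {Q : Cotangent n X | Q.1 ∈ e.source} := fun Q hQ =>
      (continuousAt_toCoord he hQ).continuousWithinAt
    exact hcont.isOpen_inter_preimage (e.open_source.preimage (FiberBundle.continuous_proj _ _)) hC

/-- The splitting is made in one chart `e` at `P`, and `g = f + u` with `u` transported to `T*X`. In
any other chart `e'` both `g` and `f - g = -u` are composites with `coordChange e e'`, to which the
invariance of germs applies. -/
lemma exists_symbol_add_null {V : Opens (Conic n X)} {f : Cotangent n X → ℂ}
    (hf : f ∈ symbolsInf V) {P : Cotangent n X} (hP : P ∈ V.1) (hP0 : P.2 ≠ 0) :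
    ∃ V₀ ≤ V, P ∈ V₀.1 ∧ ∃ g ∈ symbols V₀, f - g ∈ nullSymbolsInf V₀ := by
  have he := IsManifold.chart_mem_maximalAtlas (I := 𝓘(ℂ, Cn n)) (n := ω) P.1
  have hs := mem_chart_source (Cn n) P.1
  generalize chartAt (Cn n) P.1 = e at he hs
  have ho := isOpen_punct (isOpen_chartSet he V)
  have hc := (isCone_chartSet e V).punct
  have hp₀ : toCoord e P ∈ punct (chartSet e V) := by
    refine ⟨⟨e.map_source hs, ?_⟩, fun h0 => hP0 ?_⟩
    · rw [ofCoord_toCoord he hs]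
      exact hP
    · have h1 := ofCoord_toCoord he hs
      have h2 : toCoord e P = (e P.1, 0) := Prod.ext rfl h0
      rw [h2, ofCoord_snd_eq_zero, e.left_inv hs] at h1
      rw [← h1]
  obtain ⟨C, hCV, hCo, hCc, hPC, u, hu⟩ :=
    (hf e he).1.exists_splitting ho hc (fun p hp => hp.2) hp₀
  have hinf := (isSymbolInf_iff ho hc fun p hp => hp.2).1 (hf e he).1
  have hmem : ∀ e' ∈ IsManifold.maximalAtlas 𝓘(ℂ, Cn n) ω X,
      ∀ p ∈ chartSet e' (coneOfCoord he hCo hCc),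
        p.1 ∈ overlap e e' ∧ coordChange e e' p ∈ C := by
    intro e' he' p hp
    have h1 : p.1 ∈ overlap e e' := ⟨hp.1, hp.2.1⟩
    refine ⟨h1, ?_⟩
    rw [← toCoord_ofCoord_eq he he' h1]
    exact hp.2.2
  -- The cone of the splitting avoids the zero section, so the zero-section conditions are empty on
  -- it.
  have hzero : ∀ e' ∈ IsManifold.maximalAtlas 𝓘(ℂ, Cn n) ω X,
      zeroPart (chartSet e' (coneOfCoord he hCo hCc)) = ∅ := by
    intro e' he'
    refine eq_empty_of_forall_notMem fun z hz => ?_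
    have h1 := (hCV (hmem e' he' _ hz).2).2
    exact h1 (by ext; simp [coordChange, cotMap])
  refine ⟨coneOfCoord he hCo hCc, fun Q hQ => ?_, ⟨hs, hPC⟩, fun Q => f Q + u (toCoord e Q),
    fun e' he' => ⟨?_, ?_⟩, fun e' he' => ⟨?_, ?_⟩⟩
  · have h1 := (hCV hQ.2).1.2
    rwa [ofCoord_toCoord he hQ.1] at h1
  · refine (isSymbol_iff (isOpen_punct (isOpen_chartSet he' _)) (isCone_chartSet e' _).punct
      fun p hp => hp.2).2 fun p hp => ?_
    obtain ⟨h1, h2⟩ := hmem e' he' p hp.1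
    have hS := (isOpen_overlap e e').prod (isOpen_univ (X := CnDual n))
    have hSp := prod_univ_mem_dirInf (p := p) (isOpen_overlap e e') h1
    have hφ := (contDiffOn_transition he he').of_le (m := ∞) le_top
    have hB := contDiffOn_transition_fderiv he he'
    have hEq : EqOn (fun x => ((f ∘ ofCoord e) + u) (coordChange e e' x))
        ((fun Q => f Q + u (toCoord e Q)) ∘ ofCoord e') (overlap e e' ×ˢ univ) := by
      intro x hx
      simp only [Pi.add_apply, Function.comp_apply]
      rw [ofCoord_coordChange he he' hx.1, toCoord_ofCoord_eq he he' hx.1]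
    have hI : Infra (dirInf (coordChange e e' p)) ((f ∘ ofCoord e) + u) := by
      have h3 := (hinf _ (hCV h2)).2.1 0 0
      rw [mixed_zero] at h3
      exact h3.add (hu _ h2).1.dec.infra
    refine ⟨((hu _ h2).2.comp_cotMap (isOpen_overlap e e') h1 hφ hB).congr hS hSp hEq, ?_⟩
    exact (hI.comp_cotMap (continuousAt_cotMap (isOpen_overlap e e') h1 hφ hB) hp.2
      (hCV h2).2).congr' (eventuallyEq_of_mem hSp hEq)
  · rw [hzero e' he']
    exact ⟨by rw [empty_prod]; exact differentiableOn_empty,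
      fun K hK hKe h hh => ⟨1, one_pos, fun z hz => (hKe hz).elim⟩⟩
  · refine (isNullInf_iff (isOpen_punct (isOpen_chartSet he' _)) (isCone_chartSet e' _).punct
      fun p hp => hp.2).2 fun p hp => ?_
    obtain ⟨h1, h2⟩ := hmem e' he' p hp.1
    have hS := (isOpen_overlap e e').prod (isOpen_univ (X := CnDual n))
    have hSp := prod_univ_mem_dirInf (p := p) (isOpen_overlap e e') h1
    have hφ := (contDiffOn_transition he he').of_le (m := ∞) le_top
    have hB := contDiffOn_transition_fderiv he he'
    refine ((hu _ h2).1.comp_cotMap (isOpen_overlap e e') h1 hφ hB hp.2 (hCV h2).2).neg.congr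
      hS hSp fun x hx => ?_
    have h3 := toCoord_ofCoord_eq he he' hx.1
    simp only [Pi.neg_apply, Function.comp_apply, Pi.sub_apply, h3, sub_add_cancel_left]
    rfl
  · rw [hzero e' he']
    simp

/-- At a zero covector no correction is needed: on `zeroCone V` the section `f` is itself a symbol.
-/
lemma exists_local_symbol (V : Opens (Conic n X)) (f : Cotangent n X → ℂ)
    (hf : f ∈ symbolsInf V) (P : Conic n X) (hP : P ∈ V) :
    ∃ V₀ ≤ V, P ∈ V₀ ∧ ∃ g ∈ symbols V₀, f - g ∈ nullSymbolsInf V₀ := by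
  obtain ⟨x, v⟩ := P
  by_cases h : v = 0
  · subst h
    refine ⟨zeroCone V, zeroCone_le V, hP, f, mem_symbols_zeroCone hf, ?_⟩
    rw [sub_self]
    exact zero_mem _
  · exact exists_symbol_add_null hf hP h

end Symb

namespace Symb

/-! ### Sheaves associated to quotients -/

section Quotient

variable {T : TopCat.{u}} {A : Type u} [AddCommGroup A] {S N S' N' : Opens T → AddSubgroup A}
  (hS : Antitone S) (hN : Antitone N) (hS' : Antitone S') (hN' : Antitone N')
  (iS : ∀ V, S V ≤ S' V) (iN : ∀ V, N V ≤ N' V)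

/-- Injectivity holds on every open set, before any refinement. -/
lemma isLocallyInjective_quotPresheafMap (h : ∀ V, ∀ f ∈ S V, f ∈ N' V → f ∈ N V) :
    Presheaf.IsLocallyInjective (Opens.grothendieckTopology T)
      (quotPresheafMap hS hN hS' hN' iS iN) := by
  refine Presheaf.isLocallyInjective_of_injective _ _ fun V => ?_
  refine (injective_iff_map_eq_zero
    ((quotPresheafMap hS hN hS' hN' iS iN).app V).hom).2 fun x hx => ?_
  induction x using QuotientAddGroup.induction_on with
  | H f =>
    have h1 := (QuotientAddGroup.eq_zero_iff _).1 hx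
    exact (QuotientAddGroup.eq_zero_iff _).2 (h _ f f.2 h1)

lemma isLocallySurjective_quotPresheafMap
    (h : ∀ V, ∀ f ∈ S' V, ∀ x ∈ V, ∃ V₀ ≤ V, x ∈ V₀ ∧ ∃ g ∈ S V₀, f - g ∈ N' V₀) :
    Presheaf.IsLocallySurjective (Opens.grothendieckTopology T)
      (quotPresheafMap hS hN hS' hN' iS iN) := by
  refine ⟨fun {V} s => ?_⟩
  obtain ⟨f, rfl⟩ := QuotientAddGroup.mk_surjective s
  intro x hx
  obtain ⟨V₀, hV₀, hx₀, g, hg, hfg⟩ := h V f f.2 x hx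
  refine ⟨V₀, homOfLE hV₀, ⟨QuotientAddGroup.mk ⟨g, hg⟩, ?_⟩, hx₀⟩
  refine QuotientAddGroup.eq.2 ?_
  change -g + (f : A) ∈ N' V₀
  rwa [neg_add_eq_sub]

lemma isIso_presheafToSheaf_map_quotPresheafMap
    (hinj : ∀ V, ∀ f ∈ S V, f ∈ N' V → f ∈ N V)
    (hsurj : ∀ V, ∀ f ∈ S' V, ∀ x ∈ V, ∃ V₀ ≤ V, x ∈ V₀ ∧ ∃ g ∈ S V₀, f - g ∈ N' V₀) :
    IsIso ((presheafToSheaf (Opens.grothendieckTopology T) AddCommGrpCat.{u}).map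
      (quotPresheafMap hS hN hS' hN' iS iN)) := by
  have := isLocallyInjective_quotPresheafMap hS hN hS' hN' iS iN hinj
  have := isLocallySurjective_quotPresheafMap hS hN hS' hN' iS iN hsurj
  exact (GrothendieckTopology.W_iff _ _).1 (GrothendieckTopology.W_of_isLocallyBijective _ _)

end Quotient

end Symb

end

theorem theorem3 (n : ℕ) (X : Type u) [TopologicalSpace X]
    [ChartedSpace (EuclideanSpace ℂ (Fin n)) X]
    [IsManifold 𝓘(ℂ, EuclideanSpace ℂ (Fin n)) ω X] :
    ∃ (iS : ∀ V : Opens (Symb.Conic n X), Symb.symbols V ≤ Symb.symbolsInf V)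
      (iN : ∀ V : Opens (Symb.Conic n X), Symb.nullSymbols V ≤ Symb.nullSymbolsInf V),
      IsIso (Symb.iota n X iS iN) ∧
      IsIso ((TopCat.Sheaf.pullback AddCommGrpCat.{u} (Symb.toConic n X)).map
        (Symb.iota n X iS iN)) := by
  have h : IsIso (Symb.iota n X Symb.symbols_le_symbolsInf Symb.nullSymbols_le_nullSymbolsInf) :=
    Symb.isIso_presheafToSheaf_map_quotPresheafMap _ _ _ _ _ _
      Symb.mem_nullSymbols_of_mem_nullSymbolsInf Symb.exists_local_symbol
  -- The inverse image to the bundle topology is a functor, so it preserves the isomorphism.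
  exact ⟨_, _, h, inferInstance⟩
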